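/- Let $(W,S)$ be a finite Coxeter group with length function $l$, let $R$ be a commutative ring, and let $(q_s)_{s\in S}$ be a family of units of $R$ such that $q_s=q_t$ whenever $s,t\in S$ are conjugate in $W$. Let $\mathcal H=\bigoplus_{w\in W}R\,h_w$ be the corresponding Hecke algebra, whose multiplication satisfies $h_wh_{w'}=h_{ww'}$ when $l(ww')=l(w)+l(w')$ and $h_s^2=(q_s-1)h_s+q_s$ for $s\in S$. For $I\subseteq S$ let $W_I=\langle I\rangle$ and let $\mathcal H_I=\bigoplus_{w\in W_I}R\,h_w$, a subalgebra of $\mathcal H$, which is the Hecke algebra of $(W_I,I)$ with the same $q_s$. Fix a total order on $S$. For $I_0\subseteq S$, let $X(\mathcal H_{I_0})$ be the bounded cochain complex of $\mathcal H_{I_0}$-bimodules (that is, of $\mathcal H_{I_0}\otimes_R(\mathcal H_{I_0})^\circ$-modules) whose term in degree $i$ is $\bigoplus_{I\subseteq I_0,\ |I|=i}\mathcal H_{I_0}\otimes_{\mathcal H_I}\mathcal H_{I_0}$ and whose differential, on the summand indexed by $I$, is $h\otimes_{\mathcal H_I}h'\mapsto\sum_{s\in I_0\setminus I}(-1)^{|\{t\in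 I\,:\,t<s\}|}\,h\otimes_{\mathcal H_{I\cup\{s\}}}h'$. In particular, for $I_0=S$ this defines $X(\mathcal H)$. For a ring $A$ let $\mathbf K^b(A)$ be the homotopy category of bounded cochain complexes of finitely generated left $A$-modules, and let $A^\circ$ be the opposite ring. Theorem 17 (Okuyama). For every $I_0\subseteq S$, the restriction of $X(\mathcal H)$ to $\mathcal H\otimes_R(\mathcal H_{I_0})^\circ$ is isomorphic, in $\mathbf K^b(\mathcal H\otimes_R(\mathcal H_{I_0})^\circ)$, to $\mathcal H\otimes_{\mathcal H_{I_0}}X(\mathcal H_{I_0})$. -/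

import Mathlib

open scoped TensorProduct

noncomputable section

namespace CoxeterSystem

variable {B W : Type*} [Group W] {M : CoxeterMatrix B} (cs : CoxeterSystem M W)

theorem end_mul_apply {α : Type*} (f g : Function.End α) (x : α) : (f * g) x = f (g x) := rfl

open Classical in
/-- The action of a simple reflection on pairs (element of `W`, parity). -/
def parityStep (i : B) : Function.End (W × ZMod 2) := fun p =>
  (cs.simple i * p.1 * cs.simple i, p.2 + if p.1 = cs.simple i then 1 else 0)

open Classical in
theorem parityStep_pow (i j : B) (n : ℕ) (t : W) (e : ZMod 2) :
    ((cs.parityStep i * cs.parityStep j) ^ n) (t, e) =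
      ((cs.simple i * cs.simple j) ^ n * t * ((cs.simple i * cs.simple j) ^ n)⁻¹,
        e + ∑ k ∈ Finset.range (2 * n),
          if t = cs.simple j * (cs.simple i * cs.simple j) ^ k then 1 else 0) := by
  set r := cs.simple i * cs.simple j with hr
  have hjr : ∀ k : ℕ, (r ^ k)⁻¹ * cs.simple j = cs.simple j * r ^ k := by
    intro k
    induction k with
    | zero => simp
    | succ k ih =>
      rw [pow_succ', mul_inv_rev, mul_assoc]
      have : r⁻¹ * cs.simple j = cs.simple j * r := by simp [hr, mul_assoc]
      rw [this, ← mul_assoc, ih, mul_assoc, ← pow_succ, ← pow_succ']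
  induction n with
  | zero => simp [Function.End.one_def]
  | succ n ih =>
    have h1 : (r ^ n * t * (r ^ n)⁻¹ = cs.simple j) ↔ t = cs.simple j * r ^ (2 * n) := by
      rw [mul_inv_eq_iff_eq_mul, ← eq_inv_mul_iff_mul_eq, ← mul_assoc, hjr, mul_assoc, ← pow_add,
        two_mul]
    have h2 : (cs.simple j * (r ^ n * t * (r ^ n)⁻¹) * cs.simple j = cs.simple i) ↔
        t = cs.simple j * r ^ (2 * n + 1) := by
      have e1 : (cs.simple j * (r ^ n * t * (r ^ n)⁻¹) * cs.simple j = cs.simple i) ↔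
          r ^ n * t * (r ^ n)⁻¹ = cs.simple j * r := by
        constructor
        · intro h
          have h' := congrArg (fun x => cs.simple j * x * cs.simple j) h
          simp only [mul_assoc, simple_mul_simple_cancel_left, simple_mul_simple_self, mul_one] at h'
          rw [hr, mul_assoc, h']
        · intro h
          rw [h, hr]; simp [mul_assoc]
      rw [e1, mul_inv_eq_iff_eq_mul, ← eq_inv_mul_iff_mul_eq, ← mul_assoc, ← mul_assoc, hjr,
        mul_assoc, mul_assoc, ← pow_succ', ← pow_add]
      ring_nf
    rw [pow_succ']
    change (cs.parityStep i * cs.parityStep j) (((cs.parityStep i * cs.parityStep j) ^ n) (t, e)) = _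
    rw [ih]
    change cs.parityStep i (cs.parityStep j _) = _
    simp only [parityStep, h1, h2]
    refine Prod.ext ?_ ?_
    · simp [hr, pow_succ', mul_assoc]
    · rw [show 2 * (n + 1) = 2 * n + 1 + 1 by ring, Finset.sum_range_succ, Finset.sum_range_succ]
      simp only [add_assoc]

theorem parityStep_liftable : M.IsLiftable cs.parityStep := by
  classical
  intro i j
  funext ⟨t, e⟩
  rw [parityStep_pow, cs.simple_mul_simple_pow]
  refine Prod.ext (by simp [Function.End.one_def]) ?_
  rw [two_mul, Finset.sum_range_add]
  simp only [pow_add, cs.simple_mul_simple_pow, one_mul]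
  rw [CharTwo.add_self_eq_zero, add_zero]
  rfl

/-- The parity of the number of occurrences of `t` among the right inversions of a word for `w`. -/
def invParity (w t : W) : ZMod 2 := (cs.lift ⟨cs.parityStep, cs.parityStep_liftable⟩ w (t, 0)).2

open Classical in
theorem lift_parityStep (w : W) (t : W) (e : ZMod 2) :
    cs.lift ⟨cs.parityStep, cs.parityStep_liftable⟩ w (t, e) =
      (w * t * w⁻¹, e + cs.invParity w t) := by
  unfold invParity
  induction w using cs.simple_induction_left generalizing t e with
  | one => simp [Function.End.one_def]
  | mul_simple_left w i ih =>
    rw [map_mul, end_mul_apply, end_mul_apply, ih t e, ih t 0,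
      cs.lift_apply_simple, parityStep, parityStep]
    refine Prod.ext (by simp [mul_assoc]) (by simp [add_assoc])

open Classical in
theorem invParity_simple_mul (w t : W) (i : B) :
    cs.invParity (cs.simple i * w) t =
      cs.invParity w t + if w * t * w⁻¹ = cs.simple i then 1 else 0 := by
  rw [invParity, map_mul]
  simp only [end_mul_apply, lift_parityStep, cs.lift_apply_simple,
      parityStep, zero_add]

theorem invParity_mul_simple_self (w : W) (i : B) :
    cs.invParity (w * cs.simple i) (cs.simple i) = 1 + cs.invParity w (cs.simple i) := by
  rw [invParity, map_mul]
  simp only [end_mul_apply, cs.lift_apply_simple, parityStep]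
  rw [lift_parityStep]
  simp

theorem mem_rightInvSeq_of_invParity (ω : List B) (t : W)
    (h : cs.invParity (cs.wordProd ω) t ≠ 0) : t ∈ cs.rightInvSeq ω := by
  classical
  induction ω with
  | nil => exact absurd (by simp [invParity, Function.End.one_def]) h
  | cons i ω ih =>
    rw [wordProd_cons, invParity_simple_mul] at h
    rw [rightInvSeq, List.mem_cons]
    by_cases h' : cs.wordProd ω * t * (cs.wordProd ω)⁻¹ = cs.simple i
    · left; rw [← h']; group
    · right; rw [if_neg h', add_zero] at h; exact ih h

theorem invParity_simple_eq_zero_iff (w : W) (i : B) :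
    cs.invParity w (cs.simple i) = 0 ↔ cs.length w < cs.length (w * cs.simple i) := by
  have key : ∀ w : W, cs.invParity w (cs.simple i) ≠ 0 →
      cs.length (w * cs.simple i) < cs.length w := by
    intro w h
    obtain ⟨ω, hω, rfl⟩ := cs.exists_isReduced w
    exact (cs.isRightInversion_of_mem_rightInvSeq hω (cs.mem_rightInvSeq_of_invParity ω _ h)).2
  constructor
  · intro h
    have := key (w * cs.simple i) (by rw [invParity_mul_simple_self, h]; decide)
    simpa using this
  · intro h
    by_contra h'
    exact absurd (key w h') (by omega)

/-- A consequence of the exchange condition. -/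
theorem simple_mul_eq_mul_simple (w : W) (i j : B)
    (hj : cs.length w < cs.length (w * cs.simple j))
    (hij : cs.length (cs.simple i * w * cs.simple j) < cs.length (cs.simple i * w)) :
    cs.simple i * w = w * cs.simple j := by
  classical
  by_contra hne
  rw [← invParity_simple_eq_zero_iff] at hj
  have : cs.invParity (cs.simple i * w) (cs.simple j) = 0 := by
    rw [invParity_simple_mul, hj, if_neg, add_zero]
    intro h
    exact hne (by rw [← h]; group)
  rw [invParity_simple_eq_zero_iff] at this
  omega

end CoxeterSystem

/-- Parameters of a Hecke algebra of `(W, S)` over `R`: a unit `q_s` for every simple reflection `s`,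
with `q_s = q_t` whenever `s` and `t` are conjugate in `W`. -/
structure HeckeParameter {B W : Type*} [Group W] {M : CoxeterMatrix B} (cs : CoxeterSystem M W)
    (R : Type*) [CommRing R] where
  /-- The family of units. -/
  q : B → Rˣ
  q_eq_of_isConj : ∀ i j : B, IsConj (cs.simple i) (cs.simple j) → q i = q j

section Hecke

variable {B W R : Type*} [Group W] {M : CoxeterMatrix B} {cs : CoxeterSystem M W} [CommRing R]

/-- The Hecke algebra of `(W, S)` with parameters `p`. As an `R`-module it is free on the basis
`(h_w)`, `w ∈ W`; the multiplication is constructed below and is characterized by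
`HeckeAlgebra.h_mul_h` and `HeckeAlgebra.h_simple_mul_self`. -/
def HeckeAlgebra (_p : HeckeParameter cs R) : Type _ := W →₀ R

namespace HeckeAlgebra

variable (p : HeckeParameter cs R)

instance : AddCommGroup (HeckeAlgebra p) := inferInstanceAs (AddCommGroup (W →₀ R))

instance : Module R (HeckeAlgebra p) := inferInstanceAs (Module R (W →₀ R))

/-- The standard basis of the Hecke algebra. -/
def basis : Module.Basis W R (HeckeAlgebra p) := Module.Basis.ofRepr (LinearEquiv.refl R (W →₀ R))

/-- The standard basis element `h_w`. -/
def h (w : W) : HeckeAlgebra p := basis p w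

open Classical in
/-- Left multiplication by `h_s`. -/
def leftOp (i : B) : Module.End R (HeckeAlgebra p) :=
  (basis p).constr R fun w =>
    if cs.length w < cs.length (cs.simple i * w) then h p (cs.simple i * w)
    else ((p.q i : R) - 1) • h p w + (p.q i : R) • h p (cs.simple i * w)

open Classical in
/-- Right multiplication by `h_s`. -/
def rightOp (i : B) : Module.End R (HeckeAlgebra p) :=
  (basis p).constr R fun w =>
    if cs.length w < cs.length (w * cs.simple i) then h p (w * cs.simple i)
    else ((p.q i : R) - 1) • h p w + (p.q i : R) • h p (w * cs.simple i)

open Classical in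
theorem leftOp_h (i : B) (w : W) : leftOp p i (h p w) =
    if cs.length w < cs.length (cs.simple i * w) then h p (cs.simple i * w)
    else ((p.q i : R) - 1) • h p w + (p.q i : R) • h p (cs.simple i * w) :=
  (basis p).constr_basis R _ w

open Classical in
theorem rightOp_h (i : B) (w : W) : rightOp p i (h p w) =
    if cs.length w < cs.length (w * cs.simple i) then h p (w * cs.simple i)
    else ((p.q i : R) - 1) • h p w + (p.q i : R) • h p (w * cs.simple i) :=
  (basis p).constr_basis R _ w

theorem leftOp_rightOp_comm (i j : B) : Commute (leftOp p i) (rightOp p j) := by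
  classical
  refine (basis p).ext fun w => ?_
  change leftOp p i (rightOp p j (h p w)) = rightOp p j (leftOp p i (h p w))
  have hL := cs.length_simple_mul w i
  have hR := cs.length_mul_simple w j
  have hLR := cs.length_mul_simple (cs.simple i * w) j
  have hRL := cs.length_simple_mul (w * cs.simple j) i
  rw [← mul_assoc] at hRL
  have hq : cs.simple i * w = w * cs.simple j → (p.q i : R) = p.q j := by
    intro e
    rw [p.q_eq_of_isConj i j]
    exact isConj_iff.2 ⟨w⁻¹, by rw [mul_assoc, inv_inv, e]; group⟩
  have aux1 := cs.simple_mul_eq_mul_simple w i j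
  have aux2 := cs.simple_mul_eq_mul_simple (cs.simple i * w) i j
  simp only [cs.simple_mul_simple_cancel_left, mul_assoc] at aux1 aux2 hLR hRL
  have aux : cs.length (cs.simple i * w) = cs.length (w * cs.simple j) →
      cs.length (cs.simple i * (w * cs.simple j)) = cs.length w →
      cs.simple i * w = w * cs.simple j := by
    intro h1 h2
    rcases hL with hL | hL
    · exact aux1 (by omega) (by omega)
    · nth_rw 1 [aux2 (by omega) (by omega)]
      rw [cs.simple_mul_simple_cancel_left]
  simp only [rightOp_h, leftOp_h]
  split_ifs with h1 h2 h2 <;> simp only [map_add, map_smul, rightOp_h, leftOp_h, mul_assoc] <;>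
    split_ifs <;> first | omega | skip
  · rfl
  · have e := aux (by omega) (by omega)
    rw [hq e, e]
  · rfl
  · rfl
  · have e := aux (by omega) (by omega)
    rw [hq e, e]
  · module

/-- Left multiplication by `h_w`, through a reduced word of `w`. -/
def leftOpOf (w : W) : Module.End R (HeckeAlgebra p) :=
  ((cs.exists_isReduced w).choose.map (leftOp p)).prod

/-- The left multiplication, linear in the left factor. -/
def leftMul : HeckeAlgebra p →ₗ[R] Module.End R (HeckeAlgebra p) :=
  (basis p).constr R (leftOpOf p)

instance : Mul (HeckeAlgebra p) := ⟨fun x y => leftMul p x y⟩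

instance : One (HeckeAlgebra p) := ⟨h p 1⟩

theorem mul_def (x y : HeckeAlgebra p) : x * y = leftMul p x y := rfl

theorem h_one : h p 1 = 1 := rfl

theorem prod_leftOp_one {l : List B} (hl : cs.IsReduced l) :
    (l.map (leftOp p)).prod (1 : HeckeAlgebra p) = h p (cs.wordProd l) := by
  classical
  induction l with
  | nil => simp [h_one]
  | cons i l ih =>
    have hl' : cs.IsReduced l := hl.drop 1
    rw [List.map_cons, List.prod_cons, Module.End.mul_apply, ih hl', leftOp_h, if_pos,
      cs.wordProd_cons]
    rw [← cs.wordProd_cons, hl.eq, hl'.eq]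
    simp

/-- The operators commuting with every right multiplication by an `h_s`. -/
def rightCommutant : Subalgebra R (Module.End R (HeckeAlgebra p)) :=
  Subalgebra.centralizer R (Set.range (rightOp p))

theorem leftOp_mem (i : B) : leftOp p i ∈ rightCommutant p := by
  rw [rightCommutant, Subalgebra.mem_centralizer_iff]
  rintro _ ⟨j, rfl⟩
  exact (leftOp_rightOp_comm p i j).symm.eq

theorem leftMul_mem (x : HeckeAlgebra p) : leftMul p x ∈ rightCommutant p := by
  have hle : ⊤ ≤ (Subalgebra.toSubmodule (rightCommutant p)).comap (leftMul p) := by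
    rw [← (basis p).span_eq, Submodule.span_le]
    rintro _ ⟨w, rfl⟩
    change leftMul p (basis p w) ∈ rightCommutant p
    rw [leftMul, Module.Basis.constr_basis, leftOpOf]
    refine Subalgebra.list_prod_mem _ ?_
    simp only [List.mem_map]
    rintro _ ⟨i, _, rfl⟩
    exact leftOp_mem p i
  exact hle (Submodule.mem_top (x := x))

theorem eq_of_apply_one {f g : Module.End R (HeckeAlgebra p)} (hf : f ∈ rightCommutant p)
    (hg : g ∈ rightCommutant p) (hfg : f 1 = g 1) : f = g := by
  classical
  rw [rightCommutant, Subalgebra.mem_centralizer_iff] at hf hg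
  refine (basis p).ext fun w => ?_
  change f (h p w) = g (h p w)
  obtain ⟨l, hl, rfl⟩ := cs.exists_isReduced w
  induction l using List.reverseRecOn with
  | nil => simpa [h_one] using hfg
  | append_singleton l i ih =>
    have hl' : cs.IsReduced l := by simpa using hl.take l.length
    have e : h p (cs.wordProd (l ++ [i])) = rightOp p i (h p (cs.wordProd l)) := by
      rw [rightOp_h, if_pos]
      · simp [cs.wordProd_append]
      · have := hl.eq
        simp only [cs.wordProd_append, cs.wordProd_singleton] at this
        rw [this, hl'.eq]
        simp
    rw [e, ← Module.End.mul_apply, ← Module.End.mul_apply, ← hf _ ⟨i, rfl⟩, ← hg _ ⟨i, rfl⟩,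
      Module.End.mul_apply, Module.End.mul_apply, ih hl']

theorem leftMul_apply_one (x : HeckeAlgebra p) : leftMul p x 1 = x := by
  have : (LinearMap.applyₗ (1 : HeckeAlgebra p)).comp (leftMul p) = LinearMap.id := by
    refine (basis p).ext fun w => ?_
    simp only [LinearMap.comp_apply, LinearMap.applyₗ_apply_apply, LinearMap.id_apply]
    rw [leftMul, Module.Basis.constr_basis, leftOpOf,
      prod_leftOp_one p (cs.exists_isReduced w).choose_spec.1,
      ← (cs.exists_isReduced w).choose_spec.2, h]
  exact congrArg (fun f => f x) this

theorem leftMul_mul (x y : HeckeAlgebra p) : leftMul p (x * y) = leftMul p x * leftMul p y := by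
  refine eq_of_apply_one p (leftMul_mem p _) (mul_mem (leftMul_mem p _) (leftMul_mem p _)) ?_
  rw [Module.End.mul_apply, leftMul_apply_one, leftMul_apply_one, mul_def]

theorem leftMul_one : leftMul p 1 = 1 :=
  eq_of_apply_one p (leftMul_mem p _) (one_mem _) (by rw [leftMul_apply_one]; rfl)

theorem leftMul_h_simple (i : B) : leftMul p (h p (cs.simple i)) = leftOp p i := by
  classical
  refine eq_of_apply_one p (leftMul_mem p _) (leftOp_mem p i) ?_
  rw [leftMul_apply_one, ← h_one, leftOp_h, if_pos] <;> simp

instance : Ring (HeckeAlgebra p) :=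
  { (inferInstance : AddCommGroup (HeckeAlgebra p)),
    (inferInstance : Mul (HeckeAlgebra p)),
    (inferInstance : One (HeckeAlgebra p)) with
    left_distrib := fun x y z => by simp only [mul_def, map_add]
    right_distrib := fun x y z => by simp only [mul_def, map_add, LinearMap.add_apply]
    zero_mul := fun x => by simp only [mul_def, map_zero, LinearMap.zero_apply]
    mul_zero := fun x => by simp only [mul_def, map_zero]
    mul_assoc := fun x y z => by
      rw [mul_def, leftMul_mul, Module.End.mul_apply]; rfl
    one_mul := fun x => by rw [mul_def, leftMul_one]; rfl
    mul_one := fun x => by rw [mul_def, leftMul_apply_one] }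

instance : Algebra R (HeckeAlgebra p) :=
  Algebra.ofModule (fun r x y => by simp only [mul_def, map_smul, LinearMap.smul_apply])
    (fun r x y => by simp only [mul_def, map_smul])

open Classical in
theorem h_simple_mul_h (i : B) (w : W) : h p (cs.simple i) * h p w =
    if cs.length w < cs.length (cs.simple i * w) then h p (cs.simple i * w)
    else ((p.q i : R) - 1) • h p w + (p.q i : R) • h p (cs.simple i * w) := by
  rw [mul_def, leftMul_h_simple, leftOp_h]

/-- The first defining rule: `h_w h_w' = h_{ww'}` when the lengths add. -/
theorem h_mul_h {w w' : W} (hw : cs.length (w * w') = cs.length w + cs.length w') :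
    h p w * h p w' = h p (w * w') := by
  classical
  obtain ⟨l, hl, rfl⟩ := cs.exists_isReduced w
  induction l with
  | nil => simp [h_one]
  | cons i l ih =>
    have hl' : cs.IsReduced l := hl.drop 1
    have e1 := hl.eq
    have e2 := hl'.eq
    rw [cs.wordProd_cons, mul_assoc] at hw
    rw [cs.wordProd_cons] at e1 ⊢
    rw [List.length_cons] at e1
    have b1 := cs.length_mul_le (cs.wordProd l) w'
    have b2 := cs.length_mul_le (cs.simple i) (cs.wordProd l * w')
    rw [cs.length_simple] at b2
    have e3 : h p (cs.simple i) * h p (cs.wordProd l) = h p (cs.simple i * cs.wordProd l) := by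
      rw [h_simple_mul_h, if_pos (by omega)]
    rw [← e3, mul_assoc, ih hl' (by omega), h_simple_mul_h, if_pos (by omega), mul_assoc]

/-- The second defining rule: `h_s ^ 2 = (q_s - 1) h_s + q_s`. -/
theorem h_simple_mul_self (i : B) : h p (cs.simple i) * h p (cs.simple i) =
    ((p.q i : R) - 1) • h p (cs.simple i) + algebraMap R _ (p.q i : R) := by
  classical
  rw [h_simple_mul_h, if_neg (by simp), cs.simple_mul_simple_self, h_one,
    Algebra.algebraMap_eq_smul_one]

/-- The standard parabolic subgroup `W_I` of `W`. -/
def parabolicSubgroup (cs : CoxeterSystem M W) (I : Set B) : Subgroup W :=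
  Subgroup.closure (cs.simple '' I)

/-- The `R`-span of the `h_w`, `w ∈ W_I`. -/
def parabolicSubmodule (I : Set B) : Submodule R (HeckeAlgebra p) :=
  Submodule.span R (h p '' (parabolicSubgroup cs I : Set W))

theorem h_mem_parabolicSubmodule {I : Set B} {w : W} (hw : w ∈ parabolicSubgroup cs I) :
    h p w ∈ parabolicSubmodule p I := Submodule.subset_span ⟨w, hw, rfl⟩

theorem h_mem_adjoin {I : Set B} {w : W} (hw : w ∈ parabolicSubgroup cs I) :
    h p w ∈ Algebra.adjoin R ((fun i => h p (cs.simple i)) '' I) := by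
  classical
  set T := Algebra.adjoin R ((fun i => h p (cs.simple i)) '' I)
  have step : ∀ i ∈ I, ∀ v, h p v ∈ T → h p (cs.simple i * v) ∈ T := by
    intro i hi v hv
    have hm : h p (cs.simple i) * h p v ∈ T :=
      mul_mem (Algebra.subset_adjoin ⟨i, hi, rfl⟩) hv
    rw [h_simple_mul_h] at hm
    split_ifs at hm with hl
    · exact hm
    · have := T.smul_mem (sub_mem hm (T.smul_mem hv ((p.q i : R) - 1))) ((p.q i)⁻¹ : Rˣ).val
      rwa [add_sub_cancel_left, smul_smul, Units.inv_mul, one_smul] at this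
  induction hw using Subgroup.closure_induction_left with
  | one => rw [h_one]; exact one_mem T
  | mul_left x hx y _ ih =>
    obtain ⟨i, hi, rfl⟩ := hx
    exact step i hi y ih
  | inv_mul_cancel x hx y _ ih =>
    obtain ⟨i, hi, rfl⟩ := hx
    rw [cs.inv_simple]
    exact step i hi y ih

theorem mul_mem_parabolicSubmodule {I : Set B} {x y : HeckeAlgebra p}
    (hx : x ∈ parabolicSubmodule p I) (hy : y ∈ parabolicSubmodule p I) :
    x * y ∈ parabolicSubmodule p I := by
  classical
  replace hx : x ∈ Algebra.adjoin R ((fun i => h p (cs.simple i)) '' I) := by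
    have : parabolicSubmodule p I ≤
        Subalgebra.toSubmodule (Algebra.adjoin R ((fun i => h p (cs.simple i)) '' I)) := by
      rw [parabolicSubmodule, Submodule.span_le]
      rintro _ ⟨w, hw, rfl⟩
      exact h_mem_adjoin p hw
    exact this hx
  induction hx using Algebra.adjoin_induction generalizing y with
  | mem x hx =>
    obtain ⟨i, hi, rfl⟩ := hx
    induction hy using Submodule.span_induction with
    | mem y hy =>
      obtain ⟨w, hw, rfl⟩ := hy
      have hsw : cs.simple i * w ∈ parabolicSubgroup cs I :=
        mul_mem (Subgroup.subset_closure ⟨i, hi, rfl⟩) hw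
      simp only [h_simple_mul_h]
      split_ifs
      · exact h_mem_parabolicSubmodule p hsw
      · exact add_mem (Submodule.smul_mem _ _ (h_mem_parabolicSubmodule p hw))
          (Submodule.smul_mem _ _ (h_mem_parabolicSubmodule p hsw))
    | zero => rw [mul_zero]; exact zero_mem _
    | add y z _ _ hy hz => rw [mul_add]; exact add_mem hy hz
    | smul r y _ hy => rw [mul_smul_comm]; exact Submodule.smul_mem _ _ hy
  | algebraMap r => rw [← Algebra.smul_def]; exact Submodule.smul_mem _ _ hy
  | add a b _ _ ha hb => rw [add_mul]; exact add_mem (ha hy) (hb hy)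
  | mul a b _ _ ha hb => rw [mul_assoc]; exact ha (hb hy)

/-- The parabolic subalgebra `H_I = ⨁ R h_w`, `w ∈ W_I`. -/
def parabolic (I : Set B) : Subalgebra R (HeckeAlgebra p) :=
  (parabolicSubmodule p I).toSubalgebra (h_mem_parabolicSubmodule p (one_mem _))
    (fun _ _ => mul_mem_parabolicSubmodule p)

theorem parabolic_mono {I J : Set B} (hIJ : I ⊆ J) : parabolic p I ≤ parabolic p J :=
  fun _ hx => Submodule.span_mono
    (Set.image_mono (Subgroup.closure_mono (Set.image_mono hIJ))) hx

end HeckeAlgebra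
end Hecke

section Complexes

open CategoryTheory

universe u v w

/-! ### Bounded complexes of finitely generated modules up to homotopy -/

/-- A bounded complex of finitely generated modules. -/
def IsBoundedFG {A : Type u} [Ring A] (K : CochainComplex (ModuleCat.{v} A) ℤ) : Prop :=
  (∃ a b : ℤ, K.IsStrictlyGE a ∧ K.IsStrictlyLE b) ∧ ∀ i, Module.Finite A (K.X i)

/-- The homotopy category `K^b(A)`: its objects are the bounded cochain complexes of finitely
generated left `A`-modules, its morphisms are the homotopy classes of morphisms of complexes. -/
abbrev Kb (A : Type u) [Ring A] : Type _ :=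
  ObjectProperty.FullSubcategory
    (fun K : HomotopyCategory (ModuleCat.{v} A) (ComplexShape.up ℤ) => IsBoundedFG K.as)

/-- A bounded complex of finitely generated modules as an object of `K^b(A)`. -/
def Kb.of {A : Type u} [Ring A] (K : CochainComplex (ModuleCat.{v} A) ℤ) (hK : IsBoundedFG K) :
    Kb.{u, v} A :=
  ⟨(HomotopyCategory.quotient _ _).obj K, hK⟩

/-! ### The complex of a coefficient system

A coefficient system of `A`-modules on the subsets of `S` is a functor from the poset of subsets of
`S` to `A`-modules. -/

namespace CoeffSystem

variable {A : Type u} [Ring A] {S : Type w} (F : Finset S ⥤ ModuleCat.{v} A)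

/-- The restriction map `M^I → M^J` for `I ⊆ J`. -/
def restr {I J : Finset S} (h : I ≤ J) : F.obj I →ₗ[A] F.obj J := (F.map (homOfLE h)).hom

theorem restr_restr {I J K : Finset S} (h : I ≤ J) (h' : J ≤ K) (x : F.obj I) :
    restr F h' (restr F h x) = restr F (h.trans h') x := by
  rw [restr, restr, restr, ← LinearMap.comp_apply, ← ModuleCat.hom_comp, ← F.map_comp]
  rfl

variable [LinearOrder S]

/-- The subsets of `S` with `i` elements. -/
abbrev Level (S : Type w) (i : ℤ) : Type w := {I : Finset S // (I.card : ℤ) = i}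

/-- The term of degree `i`: the finite direct sum of the `M^I` over the subsets `I` with `i`
elements. -/
abbrev Term (i : ℤ) : Type max v w := (I : Level S i) → F.obj I.1

/-- The subset `J \ {s}`. -/
def Level.erase {i : ℤ} (J : Level S (i + 1)) (s : J.1) : Level S i :=
  ⟨J.1.erase s, by
    have h1 := J.2
    have h2 := Finset.card_erase_add_one s.2
    omega⟩

theorem Level.erase_le {i : ℤ} (J : Level S (i + 1)) (s : J.1) : (J.erase s).1 ≤ J.1 :=
  Finset.erase_subset s.1 J.1

/-- The sign `(-1) ^ n(I, s)`, where `n(I, s)` is the number of elements of `I` smaller than `s`. -/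
def sign (I : Finset S) (s : S) : ℤ := (-1) ^ (I.filter (· < s)).card

/-- The differential: its component from `M^I` to `M^J` is `(-1) ^ n(I, s)` times the restriction
map if `J = I ∪ {s}` with `s ∉ I`, and `0` if `J` is not of this form. -/
def differential (i : ℤ) : Term F i →ₗ[A] Term F (i + 1) :=
  LinearMap.pi fun J => ∑ s : J.1, sign (J.erase s).1 s.1 •
    (restr F (J.erase_le s) ∘ₗ LinearMap.proj (J.erase s))

theorem differential_apply (i : ℤ) (x : Term F i) (J : Level S (i + 1)) :
    differential F i x J = ∑ s : J.1, sign (J.erase s).1 s.1 •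
      restr F (J.erase_le s) (x (J.erase s)) := by
  rw [differential, LinearMap.pi_apply, LinearMap.sum_apply]
  rfl

theorem sign_mul_sign {J : Finset S} {s t : S} (hs : s ∈ J) (hst : s < t) :
    sign (J.erase s) s * sign ((J.erase s).erase t) t =
      -(sign (J.erase t) t * sign ((J.erase t).erase s) s) := by
  have e1 : (J.erase s).filter (· < s) = ((J.erase t).erase s).filter (· < s) := by
    ext x
    simp only [Finset.mem_filter, Finset.mem_erase]
    constructor
    · rintro ⟨⟨a, b⟩, c⟩
      exact ⟨⟨a, (c.trans hst).ne, b⟩, c⟩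
    · rintro ⟨⟨a, -, b⟩, c⟩
      exact ⟨⟨a, b⟩, c⟩
  have e2 : (J.erase t).filter (· < t) = insert s (((J.erase s).erase t).filter (· < t)) := by
    ext x
    simp only [Finset.mem_filter, Finset.mem_erase, Finset.mem_insert]
    constructor
    · rintro ⟨⟨a, b⟩, c⟩
      by_cases hx : x = s
      · exact Or.inl hx
      · exact Or.inr ⟨⟨a, hx, b⟩, c⟩
    · rintro (rfl | ⟨⟨a, -, b⟩, c⟩)
      · exact ⟨⟨hst.ne, hs⟩, hst⟩
      · exact ⟨⟨a, b⟩, c⟩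
  rw [sign, sign, sign, sign, e1, e2, Finset.card_insert_of_notMem (by simp), pow_succ]
  ring

theorem differential_comp (i : ℤ) : differential F (i + 1) ∘ₗ differential F i = 0 := by
  refine LinearMap.ext fun x => funext fun J => ?_
  change differential F (i + 1) (differential F i x) J = 0
  rw [differential_apply]
  simp only [differential_apply, map_sum, map_zsmul, Finset.smul_sum, smul_smul]
  rw [Finset.sum_sigma']
  simp only [restr_restr]
  have hswap : ∀ (K K' : Level S i) (_ : K = K') (h : K.1 ≤ J.1) (h' : K'.1 ≤ J.1),
      restr F h (x K) = restr F h' (x K') := by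
    rintro K _ rfl h h'
    rfl
  refine Finset.sum_involution
    (fun p _ => ⟨⟨p.2.1, Finset.mem_of_mem_erase p.2.2⟩,
      ⟨p.1.1, Finset.mem_erase.2 ⟨(Finset.ne_of_mem_erase p.2.2).symm, p.1.2⟩⟩⟩) ?_ ?_ ?_ ?_
  · rintro ⟨⟨s, hs⟩, ⟨t, ht⟩⟩ -
    have ht' : t ∈ J.1 := Finset.mem_of_mem_erase ht
    have hne : t ≠ s := Finset.ne_of_mem_erase ht
    have hcoef : sign (J.1.erase s) s * sign ((J.1.erase s).erase t) t +
        sign (J.1.erase t) t * sign ((J.1.erase t).erase s) s = 0 := by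
      rcases lt_or_gt_of_ne hne with h | h
      · rw [sign_mul_sign ht' h]; ring
      · rw [sign_mul_sign hs h]; ring
    rw [hswap _ (Level.erase (Level.erase J ⟨t, ht'⟩) ⟨s, Finset.mem_erase.2 ⟨hne.symm, hs⟩⟩)
      (Subtype.ext (Finset.erase_right_comm)) _
      ((Level.erase_le _ _).trans (Level.erase_le _ _)), ← add_smul]
    exact (congrArg (· • _) hcoef).trans (zero_smul ℤ _)
  · rintro ⟨⟨s, hs⟩, ⟨t, ht⟩⟩ - - h
    have := congrArg (fun p => p.1.1) h
    exact Finset.ne_of_mem_erase ht this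
  · intro p _
    exact Finset.mem_univ _
  · intro p _
    rfl

/-- The cochain complex of a coefficient system. -/
def complex : CochainComplex (ModuleCat.{max v w} A) ℤ :=
  CochainComplex.of (fun i => ModuleCat.of A (Term F i)) (fun i => ModuleCat.ofHom (differential F i))
    (fun i => by rw [← ModuleCat.ofHom_comp, differential_comp]; rfl)

theorem isBoundedFG_complex [Finite S] (hF : ∀ I, Module.Finite A (F.obj I)) :
    IsBoundedFG (complex F) := by
  have := Fintype.ofFinite S
  refine ⟨⟨0, Fintype.card S, ?_, ?_⟩, fun i => ?_⟩
  · rw [CochainComplex.isStrictlyGE_iff]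
    intro i hi
    have : IsEmpty (Level S i) := ⟨fun I => by have := I.2; omega⟩
    exact @ModuleCat.isZero_of_subsingleton _ _ _
      (inferInstanceAs (Subsingleton (Term F i)))
  · rw [CochainComplex.isStrictlyLE_iff]
    intro i hi
    have : IsEmpty (Level S i) := ⟨fun I => by
      have h1 := I.2
      have h2 := I.1.card_le_univ
      omega⟩
    exact @ModuleCat.isZero_of_subsingleton _ _ _
      (inferInstanceAs (Subsingleton (Term F i)))
  · exact inferInstanceAs (Module.Finite A (Term F i))

end CoeffSystem

/-! ### Tensor products over a subalgebra -/

section SubTensor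

variable (R : Type*) [CommRing R] {A : Type*} [Ring A] [Algebra R A] (B : Subalgebra R A)
  (C : Type*) [Ring C] [Algebra R C]
  (N : Type*) [AddCommGroup N] [Module R N] [Module B N] [Module C N] [IsScalarTower R C N]

/-- `A ⊗[R] N`, for `N` a `C`-module, as a module over `A ⊗[R] C`. -/
def PreTensor (_A _C _N : Type*) [Ring _A] [Algebra R _A] [Ring _C] [Algebra R _C]
    [AddCommGroup _N] [Module R _N] : Type _ := _A ⊗[R] _N

instance (A C N : Type*) [Ring A] [Algebra R A] [Ring C] [Algebra R C]
    [AddCommGroup N] [Module R N] : AddCommGroup (PreTensor R A C N) :=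
  inferInstanceAs (AddCommGroup (A ⊗[R] N))

/-- The action of `A ⊗[R] C` on `A ⊗[R] N`. -/
def PreTensor.action (A C N : Type*) [Ring A] [Algebra R A] [Ring C] [Algebra R C]
    [AddCommGroup N] [Module R N] [Module C N] [IsScalarTower R C N] :
    A ⊗[R] C →ₐ[R] Module.End R (A ⊗[R] N) :=
  (Module.endTensorEndAlgHom (R := R) (S := R) (A := R) (M := A) (N := N)).comp
    (Algebra.TensorProduct.map (Algebra.lmul R A) (Algebra.lsmul R R N))

instance (A C N : Type*) [Ring A] [Algebra R A] [Ring C] [Algebra R C]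
    [AddCommGroup N] [Module R N] [Module C N] [IsScalarTower R C N] :
    Module (A ⊗[R] C) (PreTensor R A C N) :=
  Module.compHom (A ⊗[R] N) (PreTensor.action R A C N).toRingHom

/-- The pure tensor. -/
def PreTensor.tmul (A C : Type*) {N : Type*} [Ring A] [Algebra R A] [Ring C] [Algebra R C]
    [AddCommGroup N] [Module R N] (a : A) (n : N) : PreTensor R A C N := a ⊗ₜ[R] n

theorem PreTensor.smul_tmul (A C : Type*) {N : Type*} [Ring A] [Algebra R A] [Ring C] [Algebra R C]
    [AddCommGroup N] [Module R N] [Module C N] [IsScalarTower R C N] (a x : A) (c : C) (n : N) :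
    (a ⊗ₜ[R] c) • PreTensor.tmul R A C x n = PreTensor.tmul R A C (a * x) (c • n) := rfl

/-- The relations `a b ⊗ n = a ⊗ b n`, for `b ∈ B`, that define `A ⊗_B N`. -/
def SubTensor.relations : Submodule (A ⊗[R] C) (PreTensor R A C N) :=
  Submodule.span _ {z | ∃ (a : A) (b : B) (n : N),
    z = PreTensor.tmul R A C (a * b) n - PreTensor.tmul R A C a (b • n)}

/-- The tensor product `A ⊗_B N` of the right `B`-module `A` with a left `B`-module `N`, where `N`
carries a commuting action of `C`, as a module over `A ⊗[R] C`. -/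
abbrev SubTensor : Type _ := PreTensor R A C N ⧸ SubTensor.relations R B C N

/-- The element `a ⊗ n` of `A ⊗_B N`. -/
def SubTensor.tmul {N : Type*} [AddCommGroup N] [Module R N] [Module B N] [Module C N]
    [IsScalarTower R C N] (a : A) (n : N) : SubTensor R B C N :=
  Submodule.Quotient.mk (PreTensor.tmul R A C a n)

variable {N}

theorem PreTensor.induction {N : Type*} [AddCommGroup N] [Module R N]
    {motive : PreTensor R A C N → Prop} (zero : motive 0)
    (tmul : ∀ a n, motive (PreTensor.tmul R A C a n))
    (add : ∀ x y, motive x → motive y → motive (x + y)) (z : PreTensor R A C N) : motive z :=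
  TensorProduct.induction_on z zero tmul add

theorem SubTensor.induction {motive : SubTensor R B C N → Prop} (zero : motive 0)
    (tmul : ∀ a n, motive (SubTensor.tmul R B C a n))
    (add : ∀ x y, motive x → motive y → motive (x + y)) (z : SubTensor R B C N) : motive z := by
  obtain ⟨z, rfl⟩ := Submodule.Quotient.mk_surjective _ z
  induction z using PreTensor.induction with
  | zero => exact zero
  | tmul a n => exact tmul a n
  | add x y hx hy => exact add _ _ hx hy

theorem SubTensor.smul_tmul (a x : A) (c : C) (n : N) :
    (a ⊗ₜ[R] c) • SubTensor.tmul R B C x n = SubTensor.tmul R B C (a * x) (c • n) := rfl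

theorem SubTensor.mul_tmul (a : A) (b : B) (n : N) :
    SubTensor.tmul R B C (a * b) n = SubTensor.tmul R B C a (b • n) :=
  (Submodule.Quotient.eq _).2 (Submodule.subset_span ⟨a, b, n, rfl⟩)

theorem SubTensor.tmul_add (a : A) (m n : N) : SubTensor.tmul R B C a (m + n) =
    SubTensor.tmul R B C a m + SubTensor.tmul R B C a n :=
  congrArg Submodule.Quotient.mk (TensorProduct.tmul_add a m n)

variable {C} {N' : Type*} [AddCommGroup N'] [Module R N'] [Module B N'] [Module C N']
  [IsScalarTower R C N']

/-- The map `a ⊗ n ↦ a ⊗ g n`. -/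
def PreTensor.map (A : Type*) [Ring A] [Algebra R A] {C N N' : Type*} [Ring C] [Algebra R C]
    [AddCommGroup N] [Module R N] [Module C N] [IsScalarTower R C N]
    [AddCommGroup N'] [Module R N'] [Module C N'] [IsScalarTower R C N'] (g : N →ₗ[C] N') :
    PreTensor R A C N →ₗ[A ⊗[R] C] PreTensor R A C N' where
  toFun := (g.restrictScalars R).lTensor A
  map_add' := map_add _
  map_smul' := by
    intro t z
    change (g.restrictScalars R).lTensor A (PreTensor.action R A C N t z) =
      PreTensor.action R A C N' t ((g.restrictScalars R).lTensor A z)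
    suffices key : (g.restrictScalars R).lTensor A ∘ₗ PreTensor.action R A C N t =
      PreTensor.action R A C N' t ∘ₗ (g.restrictScalars R).lTensor A from LinearMap.congr_fun key z
    induction t using TensorProduct.induction_on with
    | zero => simp
    | tmul a c =>
      refine TensorProduct.ext' fun x n => ?_
      exact congrArg (fun y => (a * x) ⊗ₜ[R] y) (map_smul g c n)
    | add s t hs ht => rw [map_add, map_add, LinearMap.comp_add, LinearMap.add_comp, hs, ht]

theorem PreTensor.map_tmul (g : N →ₗ[C] N') (a : A) (n : N) :
    PreTensor.map R A g (PreTensor.tmul R A C a n) = PreTensor.tmul R A C a (g n) := rfl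

/-- The map `a ⊗ n ↦ a ⊗ g n` from `A ⊗_B N` to `A ⊗_B N'`. -/
def SubTensor.map (g : N →ₗ[C] N')
    (hg : ∀ (b : B) n, g (b • n) = b • g n) :
    SubTensor R B C N →ₗ[A ⊗[R] C] SubTensor R B C N' :=
  Submodule.mapQ _ _ (PreTensor.map R A g) <| by
    rw [SubTensor.relations, Submodule.span_le]
    rintro _ ⟨a, b, n, rfl⟩
    refine Submodule.subset_span ⟨a, b, g n, ?_⟩
    rw [map_sub, PreTensor.map_tmul, PreTensor.map_tmul, hg]

theorem SubTensor.map_tmul (g : N →ₗ[C] N') (hg : ∀ (b : B) n, g (b • n) = b • g n) (a : A)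
    (n : N) : SubTensor.map R B g hg (SubTensor.tmul R B C a n) = SubTensor.tmul R B C a (g n) :=
  rfl

theorem SubTensor.hom_ext {P : Type*} [AddCommGroup P] [Module (A ⊗[R] C) P]
    {f g : SubTensor R B C N →ₗ[A ⊗[R] C] P}
    (h : ∀ a n, f (SubTensor.tmul R B C a n) = g (SubTensor.tmul R B C a n)) : f = g := by
  refine LinearMap.ext fun z => ?_
  induction z using SubTensor.induction with
  | zero => rw [map_zero, map_zero]
  | tmul a n => exact h a n
  | add x y hx hy => rw [map_add, map_add, hx, hy]

end SubTensor

/-! ### Induction of bimodules -/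

section Induction

variable {R : Type*} [CommRing R] {A : Type u} [Ring A] [Algebra R A] (B : Subalgebra R A)
  (C : Type*) [Ring C] [Algebra R C]

/-- The underlying `B`-module of a `B ⊗[R] C`-module. -/
abbrev leftModuleOfTensor (N : ModuleCat.{v} (B ⊗[R] C)) : Module B N :=
  Module.compHom N (Algebra.TensorProduct.includeLeft (R := R) (S := R) (A := B) (B := C)).toRingHom

/-- The underlying `C`-module of a `B ⊗[R] C`-module. -/
abbrev rightModuleOfTensor (N : ModuleCat.{v} (B ⊗[R] C)) : Module C N :=
  Module.compHom N (Algebra.TensorProduct.includeRight (R := R) (A := B) (B := C)).toRingHom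

/-- The underlying `R`-module of a `B ⊗[R] C`-module. -/
abbrev baseModuleOfTensor (N : ModuleCat.{v} (B ⊗[R] C)) : Module R N :=
  Module.compHom N (algebraMap R (B ⊗[R] C))

attribute [local instance] leftModuleOfTensor rightModuleOfTensor baseModuleOfTensor

theorem isScalarTowerOfTensor (N : ModuleCat.{v} (B ⊗[R] C)) : IsScalarTower R C N where
  smul_assoc r c n := by
    change ((1 : B) ⊗ₜ[R] (r • c)) • n = algebraMap R (B ⊗[R] C) r • ((1 : B) ⊗ₜ[R] c) • n
    rw [← mul_smul, ← Algebra.smul_def, TensorProduct.tmul_smul]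

attribute [local instance] isScalarTowerOfTensor

/-- A morphism of `B ⊗[R] C`-modules as a morphism of `C`-modules. -/
def rightHomOfTensor {N N' : ModuleCat.{v} (B ⊗[R] C)} (f : N ⟶ N') : N →ₗ[C] N' where
  toFun := f.hom
  map_add' := map_add f.hom
  map_smul' c n := map_smul f.hom ((1 : B) ⊗ₜ[R] c) n

/-- The functor `A ⊗_B -` from `(B, D)`-bimodules to `(A, D)`-bimodules, where `B` is a subalgebra
of `A` and `C` stands for the opposite algebra of `D`. -/
def indFunctor : ModuleCat.{v} (B ⊗[R] C) ⥤ ModuleCat.{max u v} (A ⊗[R] C) where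
  obj N := ModuleCat.of (A ⊗[R] C) (SubTensor R B C N)
  map {N N'} f := ModuleCat.ofHom
    (SubTensor.map R B (rightHomOfTensor B C f) fun b n => map_smul f.hom (b ⊗ₜ[R] (1 : C)) n)
  map_id N := by
    refine ModuleCat.hom_ext (SubTensor.hom_ext R B fun a n => ?_)
    rfl
  map_comp f g := by
    refine ModuleCat.hom_ext (SubTensor.hom_ext R B fun a n => ?_)
    rfl

instance : (indFunctor.{u, v} B C).Additive where
  map_add {N N'} f g := by
    refine ModuleCat.hom_ext (SubTensor.hom_ext R B fun a n => ?_)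
    exact SubTensor.tmul_add R B C a (f.hom n) (g.hom n)

theorem finite_indFunctor (N : ModuleCat.{v} (B ⊗[R] C)) (hN : Module.Finite (B ⊗[R] C) N) :
    Module.Finite (A ⊗[R] C) ((indFunctor B C).obj N) := by
  classical
  obtain ⟨s, hs⟩ := hN.fg_top
  refine ⟨⟨s.image (SubTensor.tmul R B C (1 : A)), ?_⟩⟩
  set T := Submodule.span (A ⊗[R] C)
    ((s.image (SubTensor.tmul R B C (1 : A)) : Finset _) : Set (SubTensor R B C N)) with hT
  have h1 : ∀ (n : N) (a : A), SubTensor.tmul R B C a n ∈ T := by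
    intro n
    have hn : n ∈ Submodule.span (B ⊗[R] C) (s : Set N) := hs ▸ Submodule.mem_top
    induction hn using Submodule.span_induction with
    | mem n hn =>
      intro a
      have : SubTensor.tmul R B C a n = (a ⊗ₜ[R] (1 : C)) • SubTensor.tmul R B C (1 : A) n := by
        rw [SubTensor.smul_tmul, mul_one, one_smul]
      rw [this]
      exact T.smul_mem _ (Submodule.subset_span (Finset.mem_coe.2 (Finset.mem_image_of_mem _ hn)))
    | zero =>
      intro a
      have := SubTensor.tmul_add R B C a (0 : N) 0
      rw [add_zero, left_eq_add] at this
      rw [this]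
      exact T.zero_mem
    | add m n _ _ hm hn =>
      intro a
      rw [SubTensor.tmul_add]
      exact T.add_mem (hm a) (hn a)
    | smul t n _ hn =>
      induction t using TensorProduct.induction_on with
      | zero =>
        intro a
        have := SubTensor.tmul_add R B C a (0 : N) 0
        rw [add_zero, left_eq_add] at this
        rw [show (0 : B ⊗[R] C) • n = 0 from N.isModule.zero_smul n, this]
        exact T.zero_mem
      | tmul b c =>
        intro a
        have h2 : (b ⊗ₜ[R] c : B ⊗[R] C) • n = b • (c • n) := by
          change (b ⊗ₜ[R] c : B ⊗[R] C) • n = (b ⊗ₜ[R] (1 : C)) • ((1 : B) ⊗ₜ[R] c) • n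
          rw [← mul_smul, Algebra.TensorProduct.tmul_mul_tmul, mul_one, one_mul]
        have h3 : SubTensor.tmul R B C (a * b) (c • n) =
            ((1 : A) ⊗ₜ[R] c) • SubTensor.tmul R B C (a * b) n := by
          rw [SubTensor.smul_tmul, one_mul]
        rw [h2, ← SubTensor.mul_tmul, h3]
        exact T.smul_mem _ (hn _)
      | add t t' ht ht' =>
        intro a
        rw [add_smul, SubTensor.tmul_add]
        exact T.add_mem (ht a) (ht' a)
  refine eq_top_iff.2 fun z _ => ?_
  induction z using SubTensor.induction with
  | zero => exact T.zero_mem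
  | tmul a n => exact h1 n a
  | add x y hx hy => exact T.add_mem (hx trivial) (hy trivial)

end Induction

theorem IsBoundedFG.map {A : Type*} {A' : Type*} [Ring A] [Ring A']
    {K : CochainComplex (ModuleCat.{v} A) ℤ} (hK : IsBoundedFG K)
    (F : ModuleCat.{v} A ⥤ ModuleCat.{w} A') [F.Additive]
    (hF : ∀ i, Module.Finite A' (F.obj (K.X i))) :
    IsBoundedFG ((F.mapHomologicalComplex (ComplexShape.up ℤ)).obj K) := by
  obtain ⟨⟨a, b, ha, hb⟩, -⟩ := hK
  rw [CochainComplex.isStrictlyGE_iff] at ha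
  rw [CochainComplex.isStrictlyLE_iff] at hb
  refine ⟨⟨a, b, ?_, ?_⟩, hF⟩
  · rw [CochainComplex.isStrictlyGE_iff]
    exact fun i hi => F.map_isZero (ha i hi)
  · rw [CochainComplex.isStrictlyLE_iff]
    exact fun i hi => F.map_isZero (hb i hi)

/-! ### The two-sided complex -/

section TwoSided

variable {R : Type*} [CommRing R] {A : Type u} [Ring A] [Algebra R A]

theorem SubTensor.relations_mono {B B' : Subalgebra R A} (h : B ≤ B') :
    SubTensor.relations R B Aᵐᵒᵖ A ≤ SubTensor.relations R B' Aᵐᵒᵖ A := by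
  refine Submodule.span_mono ?_
  rintro _ ⟨a, b, n, rfl⟩
  exact ⟨a, ⟨b, h b.2⟩, n, rfl⟩

variable {S : Type w} (P : Finset S →o Subalgebra R A)

/-- The coefficient system of `A`-bimodules `I ↦ A ⊗_{P_I} A`, with restriction maps
`a ⊗ a' ↦ a ⊗ a'`. -/
def twoSidedCoeff : Finset S ⥤ ModuleCat.{u} (A ⊗[R] Aᵐᵒᵖ) where
  obj I := ModuleCat.of (A ⊗[R] Aᵐᵒᵖ) (SubTensor R (P I) Aᵐᵒᵖ A)
  map {_ _} f := ModuleCat.ofHom (Submodule.factor (SubTensor.relations_mono (P.monotone f.le)))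
  map_id I := by
    refine ModuleCat.hom_ext (SubTensor.hom_ext R (P I) fun a n => ?_)
    rfl
  map_comp {I _ _} f g := by
    refine ModuleCat.hom_ext (SubTensor.hom_ext R (P I) fun a n => ?_)
    rfl

theorem twoSidedCoeff_map_tmul {I J : Finset S} (f : I ⟶ J) (a a' : A) :
    ((twoSidedCoeff P).map f).hom (SubTensor.tmul R (P I) Aᵐᵒᵖ a a') =
      SubTensor.tmul R (P J) Aᵐᵒᵖ a a' := rfl

theorem finite_twoSidedCoeff (I : Finset S) :
    Module.Finite (A ⊗[R] Aᵐᵒᵖ) ((twoSidedCoeff P).obj I) := by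
  change Module.Finite (A ⊗[R] Aᵐᵒᵖ) (SubTensor R (P I) Aᵐᵒᵖ A)
  refine ⟨⟨{SubTensor.tmul R (P I) Aᵐᵒᵖ (1 : A) (1 : A)}, ?_⟩⟩
  refine eq_top_iff.2 fun z _ => ?_
  induction z using SubTensor.induction with
  | zero => exact Submodule.zero_mem _
  | tmul a n =>
    have : SubTensor.tmul R (P I) Aᵐᵒᵖ a n =
        (a ⊗ₜ[R] MulOpposite.op n) • SubTensor.tmul R (P I) Aᵐᵒᵖ (1 : A) (1 : A) := by
      rw [SubTensor.smul_tmul, mul_one, MulOpposite.smul_eq_mul_unop, one_mul]; rfl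
    rw [this]
    exact Submodule.smul_mem _ _ (Submodule.subset_span (by simp))
  | add x y hx hy => exact Submodule.add_mem _ (hx trivial) (hy trivial)

/-- The cochain complex of `A`-bimodules with the term `⨁ A ⊗_{P_I} A`, over the subsets `I` with
`i` elements, in degree `i`. -/
def twoSidedComplex [LinearOrder S] : CochainComplex (ModuleCat.{max u w} (A ⊗[R] Aᵐᵒᵖ)) ℤ :=
  CoeffSystem.complex (twoSidedCoeff P)

theorem isBoundedFG_twoSidedComplex [LinearOrder S] [Finite S] :
    IsBoundedFG (twoSidedComplex P) :=
  CoeffSystem.isBoundedFG_complex _ (finite_twoSidedCoeff P)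

/-- The inclusion `A ⊗[R] Dᵒᵖ → A ⊗[R] Aᵒᵖ` for a subalgebra `D` of `A`. -/
def inclRight (D : Subalgebra R A) : A ⊗[R] Dᵐᵒᵖ →ₐ[R] A ⊗[R] Aᵐᵒᵖ :=
  Algebra.TensorProduct.map (AlgHom.id R A) (AlgHom.op D.val)

theorem finite_restrictScalars [Module.Finite R A] (D : Subalgebra R A)
    (M : ModuleCat.{v} (A ⊗[R] Aᵐᵒᵖ)) (hM : Module.Finite (A ⊗[R] Aᵐᵒᵖ) M) :
    Module.Finite (A ⊗[R] Dᵐᵒᵖ)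
      ((ModuleCat.restrictScalars (inclRight D).toRingHom).obj M) := by
  let m1 : Module (A ⊗[R] Dᵐᵒᵖ) (A ⊗[R] Aᵐᵒᵖ) := Module.compHom _ (inclRight D).toRingHom
  let m2 : Module (A ⊗[R] Dᵐᵒᵖ) M := Module.compHom _ (inclRight D).toRingHom
  have t1 : IsScalarTower (A ⊗[R] Dᵐᵒᵖ) (A ⊗[R] Aᵐᵒᵖ) M :=
    ⟨fun x y z => mul_smul (inclRight D x) y z⟩
  have t2 : IsScalarTower R (A ⊗[R] Dᵐᵒᵖ) (A ⊗[R] Aᵐᵒᵖ) :=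
    ⟨fun x y z => by
      change inclRight D (x • y) * z = x • (inclRight D y * z)
      rw [map_smul, smul_mul_assoc]⟩
  have : Module.Finite R Aᵐᵒᵖ := Module.Finite.equiv (MulOpposite.opLinearEquiv R)
  have : Module.Finite (A ⊗[R] Dᵐᵒᵖ) (A ⊗[R] Aᵐᵒᵖ) :=
    Module.Finite.of_restrictScalars_finite R _ _
  exact @Module.Finite.trans (A ⊗[R] Dᵐᵒᵖ) (A ⊗[R] Aᵐᵒᵖ) M _ _ m1 _ m2 _ t1 this hM

end TwoSided
end Complexes

/-! ### The complexes of a Hecke algebra -/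

section HeckeComplexes

open CategoryTheory

variable {B W R : Type*} [Group W] {M : CoxeterMatrix B} {cs : CoxeterSystem M W} [CommRing R]
  (p : HeckeParameter cs R)

namespace HeckeAlgebra

instance [Finite W] : Module.Finite R (HeckeAlgebra p) := Module.Finite.of_basis (basis p)

/-- The family of the parabolic subalgebras `H_I` of `H`, for `I ⊆ S`. -/
def parabolicFamily : Finset B →o Subalgebra R (HeckeAlgebra p) where
  toFun I := parabolic p I
  monotone' _ _ h := parabolic_mono p h

/-- The family of the parabolic subalgebras `H_I` of `H_{I₀}`, for `I ⊆ I₀`. -/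
def parabolicFamilyOf (I₀ : Set B) : Finset I₀ →o Subalgebra R (parabolic p I₀) where
  toFun I := (parabolic p (Subtype.val '' (I : Set I₀))).comap (parabolic p I₀).val
  monotone' _ _ h := fun _ hx => parabolic_mono p (Set.image_mono h) hx

variable [LinearOrder B]

/-- The complex `X(H)` of `H`-bimodules. -/
abbrev X := twoSidedComplex (parabolicFamily p)

/-- The complex `X(H_{I₀})` of `H_{I₀}`-bimodules. It has the same definition as `X(H)`, with the
Hecke algebra `H_{I₀}` of the Coxeter group `W_{I₀}` and its parabolic subalgebras `H_I`, `I ⊆ I₀`;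
the order on `I₀` is the one induced from `S`. -/
abbrev XOf (I₀ : Set B) := twoSidedComplex (parabolicFamilyOf p I₀)

/-- The restriction of `X(H)` to `H ⊗[R] (H_{I₀})ᵒᵖ`. -/
abbrev resX (I₀ : Set B) :=
  ((ModuleCat.restrictScalars (inclRight (parabolic p I₀)).toRingHom).mapHomologicalComplex
    (ComplexShape.up ℤ)).obj (X p)

/-- The complex `H ⊗_{H_{I₀}} X(H_{I₀})`. -/
abbrev indX (I₀ : Set B) :=
  ((indFunctor (parabolic p I₀) (parabolic p I₀)ᵐᵒᵖ).mapHomologicalComplex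
    (ComplexShape.up ℤ)).obj (XOf p I₀)

theorem isBoundedFG_resX [Finite W] [Finite B] (I₀ : Set B) : IsBoundedFG (resX p I₀) :=
  (isBoundedFG_twoSidedComplex _).map _ fun i =>
    finite_restrictScalars _ _ ((isBoundedFG_twoSidedComplex _).2 i)

theorem isBoundedFG_indX [Finite B] (I₀ : Set B) : IsBoundedFG (indX p I₀) :=
  (isBoundedFG_twoSidedComplex _).map _ fun i =>
    finite_indFunctor _ _ _ ((isBoundedFG_twoSidedComplex _).2 i)

end HeckeAlgebra
end HeckeComplexes

end

noncomputable section

open HeckeAlgebra (parabolicSubgroup)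

namespace CoxeterSystem

variable {B W : Type*} [Group W] {M : CoxeterMatrix B} (cs : CoxeterSystem M W)

theorem invParity_mul (x y t : W) :
    cs.invParity (x * y) t = cs.invParity y t + cs.invParity x (y * t * y⁻¹) := by
  rw [invParity, map_mul]
  simp only [end_mul_apply, lift_parityStep, zero_add]

theorem length_mul_lt_of_invParity {w t : W} (h : cs.invParity w t ≠ 0) :
    cs.length (w * t) < cs.length w := by
  obtain ⟨ω, hω, rfl⟩ := cs.exists_isReduced w
  exact (cs.isRightInversion_of_mem_rightInvSeq hω (cs.mem_rightInvSeq_of_invParity ω _ h)).2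

/-- If `s` is a left descent of `x * y` but not of `x`, the corresponding reflection is an inversion
of `y`. -/
theorem invParity_ne_zero_of_descent {x y : W} {s : B}
    (hxy : cs.length (cs.simple s * (x * y)) < cs.length (x * y))
    (hx : cs.length x < cs.length (cs.simple s * x)) :
    cs.invParity y ((x * y)⁻¹ * cs.simple s * (x * y)) ≠ 0 := by
  classical
  set t := (x * y)⁻¹ * cs.simple s * (x * y) with ht
  intro h0
  have e1 : cs.invParity (x * y) t = 0 := by
    rw [invParity_mul, h0, zero_add]
    by_contra h
    have := cs.length_mul_lt_of_invParity h
    have e : x * (y * t * y⁻¹) = cs.simple s * x := by rw [ht]; group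
    rw [e] at this
    omega
  have e2 : cs.invParity (cs.simple s * (x * y)) t ≠ 0 := by
    rw [invParity_simple_mul, e1, if_pos (by rw [ht]; group)]
    decide
  have := cs.length_mul_lt_of_invParity e2
  have e : cs.simple s * (x * y) * t = x * y := by
    rw [ht]
    have : cs.simple s * (x * y) * ((x * y)⁻¹ * cs.simple s * (x * y)) =
      cs.simple s * cs.simple s * (x * y) := by group
    rw [this, cs.simple_mul_simple_self, one_mul]
  rw [e] at this
  omega

theorem simple_mem_parabolicSubgroup {I : Set B} {i : B} (hi : i ∈ I) :
    cs.simple i ∈ parabolicSubgroup cs I := Subgroup.subset_closure ⟨i, hi, rfl⟩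

theorem wordProd_mem_parabolicSubgroup {I : Set B} {ω : List B} (hω : ∀ i ∈ ω, i ∈ I) :
    cs.wordProd ω ∈ parabolicSubgroup cs I := by
  refine Subgroup.list_prod_mem _ fun x hx => ?_
  obtain ⟨i, hi, rfl⟩ := List.mem_map.1 hx
  exact cs.simple_mem_parabolicSubgroup (hω i hi)

theorem exists_word_of_mem_parabolicSubgroup {I : Set B} {a : W}
    (ha : a ∈ parabolicSubgroup cs I) : ∃ ω : List B, (∀ i ∈ ω, i ∈ I) ∧ cs.wordProd ω = a := by
  induction ha using Subgroup.closure_induction_left with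
  | one => exact ⟨[], by simp, by simp⟩
  | mul_left x hx y _ ih =>
    obtain ⟨i, hi, rfl⟩ := hx
    obtain ⟨ω, h1, rfl⟩ := ih
    exact ⟨i :: ω, by simpa using ⟨hi, h1⟩, cs.wordProd_cons i ω⟩
  | inv_mul_cancel x hx y _ ih =>
    obtain ⟨i, hi, rfl⟩ := hx
    obtain ⟨ω, h1, rfl⟩ := ih
    exact ⟨i :: ω, by simpa using ⟨hi, h1⟩, by rw [cs.inv_simple]; exact cs.wordProd_cons i ω⟩

theorem mem_parabolicSubgroup_of_invParity {I : Set B} {a t : W}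
    (ha : a ∈ parabolicSubgroup cs I) (h : cs.invParity a t ≠ 0) :
    t ∈ parabolicSubgroup cs I := by
  obtain ⟨ω, hω, rfl⟩ := cs.exists_word_of_mem_parabolicSubgroup ha
  have := cs.mem_rightInvSeq_of_invParity ω t h
  obtain ⟨j, hj, rfl⟩ := List.mem_iff_getElem.1 this
  have e := cs.wordProd_mul_getD_rightInvSeq ω j
  rw [List.getD_eq_getElem _ _ hj] at e
  rw [← inv_mul_cancel_left (cs.wordProd ω) ((cs.rightInvSeq ω)[j]), e]
  exact mul_mem (inv_mem ha) (cs.wordProd_mem_parabolicSubgroup fun i hi =>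
    hω i (List.mem_of_mem_eraseIdx hi))

/-- A nontrivial element of `W_I` has a left descent in `I`. -/
theorem exists_descent_of_mem_parabolicSubgroup {I : Set B} {a : W}
    (ha : a ∈ parabolicSubgroup cs I) (h1 : a ≠ 1) :
    ∃ i ∈ I, cs.length (cs.simple i * a) < cs.length a := by
  classical
  have hex : ∃ n, ∃ ω : List B, ω.length = n ∧ (∀ i ∈ ω, i ∈ I) ∧ cs.wordProd ω = a := by
    obtain ⟨ω, h⟩ := cs.exists_word_of_mem_parabolicSubgroup ha
    exact ⟨_, ω, rfl, h⟩
  obtain ⟨ω, hn, hω, hωa⟩ := Nat.find_spec hex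
  have hmin := fun m hm => Nat.find_min hex (m := m) hm
  rw [← hn] at hmin
  match ω with
  | [] => exact absurd (by simpa using hωa.symm) h1
  | i :: ω =>
    refine ⟨i, hω i (by simp), ?_⟩
    rw [← hωa, cs.wordProd_cons, cs.simple_mul_simple_cancel_left]
    by_contra hlt
    have hlt' : cs.length (cs.simple i * (cs.wordProd ω * 1)) < cs.length (cs.wordProd ω * 1) := by
      have := cs.length_simple_mul_ne (cs.wordProd ω) i
      rw [mul_one]; omega
    have key : cs.invParity (cs.wordProd ω)
        ((cs.wordProd ω)⁻¹ * cs.simple i * cs.wordProd ω) ≠ 0 := by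
      have := cs.invParity_ne_zero_of_descent (x := 1) (y := cs.wordProd ω) (s := i)
        (by simpa using hlt') (by simp)
      simpa using this
    have := cs.mem_rightInvSeq_of_invParity ω _ key
    obtain ⟨j, hj, he⟩ := List.mem_iff_getElem.1 this
    have e := cs.wordProd_mul_getD_rightInvSeq ω j
    rw [List.getD_eq_getElem _ _ hj, he] at e
    rw [cs.length_rightInvSeq] at hj
    have hl : (ω.eraseIdx j).length < (i :: ω).length := by
      rw [List.length_eraseIdx, List.length_cons]; split_ifs; omega
    refine hmin _ hl ⟨ω.eraseIdx j, rfl, fun k hk => hω k ?_, ?_⟩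
    · exact List.mem_cons_of_mem _ (List.mem_of_mem_eraseIdx hk)
    · rw [← e, ← hωa, cs.wordProd_cons]; group

/-- `u` is minimal in the coset `W_I u`: it has no left descent in `I`. -/
def IsMin (I : Set B) (u : W) : Prop := ∀ i ∈ I, cs.length u < cs.length (cs.simple i * u)

theorem exists_mul_le (I : Set B) (w : W) : ∃ u, w * u⁻¹ ∈ parabolicSubgroup cs I ∧
    ∀ a ∈ parabolicSubgroup cs I, cs.length u ≤ cs.length (a * u) := by
  classical
  have hex : ∃ n, ∃ u, cs.length u = n ∧ w * u⁻¹ ∈ parabolicSubgroup cs I :=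
    ⟨_, w, rfl, by simp [one_mem]⟩
  obtain ⟨u, hn, hu⟩ := Nat.find_spec hex
  refine ⟨u, hu, fun a ha => ?_⟩
  rw [hn]
  refine Nat.find_min' hex ⟨a * u, rfl, ?_⟩
  rw [mul_inv_rev, ← mul_assoc]
  exact mul_mem hu (inv_mem ha)

theorem length_mul_of_le {I : Set B} {u : W}
    (hu : ∀ a ∈ parabolicSubgroup cs I, cs.length u ≤ cs.length (a * u)) {a : W}
    (ha : a ∈ parabolicSubgroup cs I) : cs.length (a * u) = cs.length a + cs.length u := by
  have step : ∀ i ∈ I, ∀ b ∈ parabolicSubgroup cs I,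
      cs.length (b * u) = cs.length b + cs.length u →
      cs.length (cs.simple i * b * u) = cs.length (cs.simple i * b) + cs.length u := by
    intro i hi b hb ih
    have h1 := cs.length_simple_mul b i
    have h2 := cs.length_simple_mul (b * u) i
    have h3 := cs.length_mul_le (cs.simple i * b) u
    rw [mul_assoc] at h3 ⊢
    rcases h1 with h1 | h1
    · rcases h2 with h2 | h2
      · omega
      · exfalso
        have := cs.length_mul_lt_of_invParity
          (cs.invParity_ne_zero_of_descent (x := b) (y := u) (s := i) (by omega) (by omega))
        have e : u * ((b * u)⁻¹ * cs.simple i * (b * u)) = b⁻¹ * cs.simple i * b * u := by group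
        rw [e] at this
        have := hu (b⁻¹ * cs.simple i * b)
          (mul_mem (mul_mem (inv_mem hb) (cs.simple_mem_parabolicSubgroup hi)) hb)
        omega
    · omega
  induction ha using Subgroup.closure_induction_left with
  | one => simp
  | mul_left x hx y hy ih =>
    obtain ⟨i, hi, rfl⟩ := hx
    exact step i hi y hy ih
  | inv_mul_cancel x hx y hy ih =>
    obtain ⟨i, hi, rfl⟩ := hx
    rw [cs.inv_simple]
    exact step i hi y hy ih

/-- The minimal element of the coset `W_I w`. -/
def minPart (I : Set B) (w : W) : W := (cs.exists_mul_le I w).choose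

theorem mul_minPart_inv_mem (I : Set B) (w : W) :
    w * (cs.minPart I w)⁻¹ ∈ parabolicSubgroup cs I := (cs.exists_mul_le I w).choose_spec.1

theorem length_mul_minPart {I : Set B} {a : W} (w : W) (ha : a ∈ parabolicSubgroup cs I) :
    cs.length (a * cs.minPart I w) = cs.length a + cs.length (cs.minPart I w) :=
  cs.length_mul_of_le (cs.exists_mul_le I w).choose_spec.2 ha

theorem exists_eq_mul_minPart (I : Set B) (w : W) : ∃ a ∈ parabolicSubgroup cs I,
    w = a * cs.minPart I w := ⟨_, cs.mul_minPart_inv_mem I w, by group⟩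

theorem isMin_minPart (I : Set B) (w : W) : cs.IsMin I (cs.minPart I w) := by
  intro i hi
  rw [cs.length_mul_minPart w (cs.simple_mem_parabolicSubgroup hi), cs.length_simple]
  omega

theorem IsMin.eq_minPart {cs : CoxeterSystem M W} {I : Set B} {u : W} (hu : cs.IsMin I u) :
    cs.minPart I u = u := by
  obtain ⟨a, ha, e⟩ := cs.exists_eq_mul_minPart I u
  by_cases h1 : a = 1
  · rw [h1, one_mul] at e; exact e.symm
  · obtain ⟨i, hi, hlt⟩ := cs.exists_descent_of_mem_parabolicSubgroup ha h1
    have h2 := hu i hi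
    have hia := mul_mem (cs.simple_mem_parabolicSubgroup hi) ha
    rw [e, ← mul_assoc, cs.length_mul_minPart u hia, cs.length_mul_minPart u ha] at h2
    omega

theorem minPart_mul {I : Set B} {a : W} (w : W) (ha : a ∈ parabolicSubgroup cs I) :
    cs.minPart I (a * w) = cs.minPart I w := by
  obtain ⟨b, hb, e⟩ := cs.exists_eq_mul_minPart I w
  obtain ⟨c, hc, e'⟩ := cs.exists_eq_mul_minPart I (a * w)
  set u := cs.minPart I w with hu
  set v := cs.minPart I (a * w) with hv
  have e1 : v = c⁻¹ * a * b * u := by rw [mul_assoc _ b, ← e, mul_assoc, e']; group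
  have e2 : u = (c⁻¹ * a * b)⁻¹ * v := by rw [e1]; group
  have hm : c⁻¹ * a * b ∈ parabolicSubgroup cs I := mul_mem (mul_mem (inv_mem hc) ha) hb
  have l1 := cs.length_mul_minPart w hm
  have l2 := cs.length_mul_minPart (a * w) (inv_mem hm)
  rw [← hu, ← e1] at l1
  rw [← hv, ← e2, cs.length_inv] at l2
  have : c⁻¹ * a * b = 1 := by rw [← cs.length_eq_zero_iff]; omega
  rw [e1, this, one_mul]

theorem length_minPart_le (I : Set B) (w : W) : cs.length (cs.minPart I w) ≤ cs.length w := by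
  obtain ⟨a, ha, e⟩ := cs.exists_eq_mul_minPart I w
  have := cs.length_mul_minPart w ha
  rw [← e] at this
  omega

/-! ### The geometric representation -/

/-- Twice the linear form `B(α_i, -)` of the geometric representation. -/
def geomForm (M : CoxeterMatrix B) (i : B) : Module.Dual ℝ (B →₀ ℝ) :=
  Finsupp.linearCombination ℝ fun j => -2 * Real.cos (Real.pi / M i j)

theorem geomForm_single (i j : B) :
    geomForm M i (Finsupp.single j 1) = -2 * Real.cos (Real.pi / M i j) := by
  simp [geomForm]

theorem geomForm_self (i : B) : geomForm M i (Finsupp.single i 1) = 2 := by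
  simp [geomForm_single]

theorem geomReflection_liftable :
    M.IsLiftable fun i => Module.reflection (geomForm_self (M := M) i) := by
  intro i j
  by_cases h0 : M i j = 0
  · rw [h0, pow_zero]
  by_cases h1 : M i j = 1
  · have hij : i = j := by
      by_contra h
      exact M.off_diagonal i j h h1
    subst hij
    rw [h1, pow_one]
    refine LinearEquiv.ext fun x => ?_
    rw [LinearEquiv.mul_apply]
    exact Module.involutive_reflection (geomForm_self i) x
  have hm : (2 : ℝ) ≤ M i j := by exact_mod_cast (by omega : 2 ≤ M i j)
  set m := M i j with hmdef
  refine LinearEquiv.ext fun z => ?_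
  set θ : ℝ := 2 * (Real.pi / m) with hθ
  have hmθ : m * θ = 2 * Real.pi := by rw [hθ]; field_simp
  have ht : 2 * Real.cos θ = geomForm M i (Finsupp.single j 1) *
      geomForm M j (Finsupp.single i 1) - 2 := by
    rw [geomForm_single, geomForm_single, M.symmetric j i, ← hmdef, hθ, Real.cos_two_mul]
    ring
  rw [Module.reflection_mul_reflection_pow_apply _ _ m z _ ht]
  have hS := fun n : ℤ => Polynomial.Chebyshev.S_two_mul_real_cos θ n
  rcases eq_or_ne m 2 with h2 | h2
  · have hc : Real.cos (Real.pi / 2) = 0 := Real.cos_pi_div_two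
    have ha : geomForm M i (Finsupp.single j 1) = 0 := by
      rw [geomForm_single, ← hmdef, h2, Nat.cast_ofNat, hc, mul_zero]
    have hb : geomForm M j (Finsupp.single i 1) = 0 := by
      rw [geomForm_single, M.symmetric j i, ← hmdef, h2, Nat.cast_ofNat, hc, mul_zero]
    rw [ht, ha, hb, h2]
    norm_num
    module
  · have hsin : Real.sin θ ≠ 0 := by
      have h3 : (3 : ℝ) ≤ m := by exact_mod_cast (by omega : 3 ≤ m)
      have hpi := Real.pi_pos
      refine (Real.sin_pos_of_pos_of_lt_pi (by positivity) ?_).ne'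
      rw [hθ, ← mul_div_assoc, div_lt_iff₀ (by linarith)]
      nlinarith
    rcases Nat.even_or_odd' m with ⟨k, hk | hk⟩
    · have hkθ : (k : ℝ) * θ = Real.pi := by
        rw [hk] at hmθ; push_cast at hmθ; linarith
      have e : (Polynomial.Chebyshev.S ℝ (k - 1)).eval (2 * Real.cos θ) = 0 := by
        have := hS (k - 1)
        push_cast at this
        rw [sub_add_cancel, hkθ, Real.sin_pi] at this
        exact (mul_eq_zero.1 this).resolve_right hsin
      have i1 : ((m : ℤ) - 2) / 2 = k - 1 := by omega
      have i2 : ((m : ℤ) - 1) / 2 = k - 1 := by omega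
      rw [i1, i2, e]
      simp
    · have hkθ : (2 * (k : ℝ) + 1) * θ = 2 * Real.pi := by
        rw [hk] at hmθ; push_cast at hmθ; linarith
      have e : (Polynomial.Chebyshev.S ℝ k).eval (2 * Real.cos θ) +
          (Polynomial.Chebyshev.S ℝ (k - 1)).eval (2 * Real.cos θ) = 0 := by
        have h1 := hS (k - 1)
        have h2 := hS k
        push_cast at h1 h2
        rw [sub_add_cancel] at h1
        have h3 : Real.sin ((k + 1) * θ) = - Real.sin (k * θ) := by
          rw [show ((k : ℝ) + 1) * θ = 2 * Real.pi - k * θ by linarith, Real.sin_two_pi_sub]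
        refine (mul_eq_zero.1 ?_).resolve_right hsin
        rw [add_mul, h1, h2, h3]
        ring
      have i1 : ((m : ℤ) - 2) / 2 = k - 1 := by omega
      have i2 : ((m : ℤ) - 1) / 2 = k := by omega
      have i3 : ((m : ℤ) - 3) / 2 = k - 1 := by omega
      have i4 : (m : ℤ) / 2 = k := by omega
      rw [i1, i2, i3, i4, e]
      simp

theorem simple_injective : Function.Injective cs.simple := by
  intro i j hij
  by_contra hne
  have h := congrArg (fun w => cs.lift ⟨_, geomReflection_liftable⟩ w (Finsupp.single i 1) i) hij
  simp only [cs.lift_apply_simple, Module.reflection_apply, geomForm_self] at h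
  simp [hne] at h

theorem mem_of_simple_mem_parabolicSubgroup {I : Set B} {i : B}
    (h : cs.simple i ∈ parabolicSubgroup cs I) : i ∈ I := by
  obtain ⟨j, hj, hlt⟩ := cs.exists_descent_of_mem_parabolicSubgroup h (by
    intro h; have := cs.length_simple i; rw [h, cs.length_one] at this; omega)
  rw [cs.length_simple, Nat.lt_one_iff, cs.length_eq_zero_iff] at hlt
  have : cs.simple j = cs.simple i := by
    rw [← mul_one (cs.simple j), ← cs.simple_mul_simple_self i, ← mul_assoc, hlt, one_mul]
  rwa [← cs.simple_injective this]

/-- Deodhar's lemma. -/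
theorem IsMin.mul_simple {cs : CoxeterSystem M W} {I : Set B} {u : W} (hu : cs.IsMin I u) (t : B) :
    cs.IsMin I (u * cs.simple t) ∨ ∃ i ∈ I, cs.simple i * u = u * cs.simple t := by
  by_cases h : cs.IsMin I (u * cs.simple t)
  · exact Or.inl h
  · right
    simp only [IsMin, not_forall] at h
    obtain ⟨i, hi, h⟩ := h
    refine ⟨i, hi, ?_⟩
    have h1 := hu i hi
    have h2 := cs.length_mul_simple u t
    have h3 := cs.length_simple_mul u i
    have h4 := cs.length_mul_simple (cs.simple i * u) t
    have h5 := cs.length_simple_mul (u * cs.simple t) i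
    rw [← mul_assoc] at h h5
    exact cs.simple_mul_eq_mul_simple u i t (by omega) (by omega)

/-! ### Minimal representatives of right cosets -/

/-- The minimal element of `w W_I`. -/
def rightMin (I : Set B) (w : W) : W := (cs.minPart I w⁻¹)⁻¹

theorem rightMin_inv_mul_mem (I : Set B) (w : W) :
    (cs.rightMin I w)⁻¹ * w ∈ parabolicSubgroup cs I := by
  have := inv_mem (cs.mul_minPart_inv_mem I w⁻¹)
  simpa [rightMin] using this

theorem length_rightMin_mul {I : Set B} {b : W} (w : W) (hb : b ∈ parabolicSubgroup cs I) :
    cs.length (cs.rightMin I w * b) = cs.length (cs.rightMin I w) + cs.length b := by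
  rw [← cs.length_inv, mul_inv_rev, rightMin, inv_inv, cs.length_mul_minPart _ (inv_mem hb),
    cs.length_inv, cs.length_inv, add_comm]

theorem rightMin_mul {I : Set B} {b : W} (w : W) (hb : b ∈ parabolicSubgroup cs I) :
    cs.rightMin I (w * b) = cs.rightMin I w := by
  rw [rightMin, rightMin, mul_inv_rev, cs.minPart_mul _ (inv_mem hb)]

theorem exists_eq_rightMin_mul (I : Set B) (w : W) : ∃ b ∈ parabolicSubgroup cs I,
    w = cs.rightMin I w * b := ⟨_, cs.rightMin_inv_mul_mem I w, by group⟩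

theorem rightMin_rightMin (I : Set B) (w : W) :
    cs.rightMin I (cs.rightMin I w) = cs.rightMin I w := by
  obtain ⟨b, hb, e⟩ := cs.exists_eq_rightMin_mul I w
  conv_rhs => rw [e]
  rw [cs.rightMin_mul _ hb]

theorem length_rightMin_lt {I : Set B} {w : W} (h : cs.rightMin I w ≠ w) :
    cs.length (cs.rightMin I w) < cs.length w := by
  obtain ⟨b, hb, e⟩ := cs.exists_eq_rightMin_mul I w
  have h1 := cs.length_rightMin_mul w hb
  rw [← e] at h1
  have h2 : cs.length b ≠ 0 := by
    rw [ne_eq, cs.length_eq_zero_iff]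
    rintro rfl
    exact h (by rw [mul_one] at e; exact e.symm)
  omega

theorem length_lt_simple_mul_mul {I : Set B} {d b : W} {s : B}
    (hb : b ∈ parabolicSubgroup cs I) (hs : cs.length d < cs.length (cs.simple s * d))
    (hd : d⁻¹ * cs.simple s * d ∉ parabolicSubgroup cs I) :
    cs.length (d * b) < cs.length (cs.simple s * (d * b)) := by
  by_contra h
  have hne := cs.length_simple_mul_ne (d * b) s
  have := cs.mem_parabolicSubgroup_of_invParity hb
    (cs.invParity_ne_zero_of_descent (x := d) (y := b) (s := s) (by omega) hs)
  apply hd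
  have e : d⁻¹ * cs.simple s * d = b * ((d * b)⁻¹ * cs.simple s * (d * b)) * b⁻¹ := by group
  rw [e]
  exact mul_mem (mul_mem hb this) (inv_mem hb)

/-! ### The longest element -/

variable [Finite W]

/-- An element of maximal length. -/
def longest : W := (Finite.exists_max cs.length).choose

theorem length_le_longest (w : W) : cs.length w ≤ cs.length cs.longest :=
  (Finite.exists_max cs.length).choose_spec w

theorem length_mul_longest_add (x : W) :
    cs.length (x * cs.longest) + cs.length x = cs.length cs.longest := by
  induction x using cs.simple_induction_left with
  | one => simp
  | mul_simple_left x i ih =>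
    have h1 := cs.length_simple_mul x i
    have h2 := cs.length_simple_mul (x * cs.longest) i
    have h3 := cs.length_le_length_mul_add_left (cs.simple i * x) cs.longest
    rw [mul_assoc] at h3 ⊢
    rcases h1 with h1 | h1
    · rcases h2 with h2 | h2
      swap
      · omega
      exfalso
      set w := cs.longest
      set y := x * w with hy
      set t := y⁻¹ * cs.simple i * y with ht
      have e1 : cs.invParity y t = 0 := by
        by_contra h
        have := cs.length_mul_lt_of_invParity h
        rw [show y * t = cs.simple i * y by rw [ht]; group] at this
        omega
      have e2 : cs.invParity x⁻¹ (cs.simple i) = 0 := by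
        by_contra h
        have := cs.length_mul_lt_of_invParity h
        rw [show x⁻¹ * cs.simple i = (cs.simple i * x)⁻¹ by simp, cs.length_inv,
          cs.length_inv] at this
        omega
      have e3 : cs.invParity (x⁻¹ * (cs.simple i * y)) t ≠ 0 := by
        rw [invParity_mul, invParity_simple_mul, e1, if_pos (by rw [ht]; group)]
        have : cs.simple i * y * t * (cs.simple i * y)⁻¹ = cs.simple i := by rw [ht]; group
        rw [this, e2]
        decide
      have h4 := cs.length_mul_lt_of_invParity e3
      have e4 : x⁻¹ * (cs.simple i * y) * t = w := by
        have : x⁻¹ * (cs.simple i * y) * t = x⁻¹ * (cs.simple i * cs.simple i) * y := by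
          rw [ht]; group
        rw [this, cs.simple_mul_simple_self, hy]; group
      rw [e4] at h4
      have h5 : _ ≤ cs.length w := cs.length_le_longest (x⁻¹ * (cs.simple i * y))
      omega
    · omega

theorem eq_longest {w : W} (h : ∀ i, cs.length (cs.simple i * w) < cs.length w) :
    w = cs.longest := by
  by_contra hne
  have : w * cs.longest⁻¹ ≠ 1 := fun h => hne (mul_inv_eq_one.1 h)
  obtain ⟨i, hi⟩ := cs.exists_leftDescent_of_ne_one this
  have h1 := cs.length_mul_longest_add (w * cs.longest⁻¹)
  have h2 := cs.length_mul_longest_add (cs.simple i * (w * cs.longest⁻¹))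
  rw [IsLeftDescent] at hi
  have e1 : w * cs.longest⁻¹ * cs.longest = w := by group
  have e2 : cs.simple i * (w * cs.longest⁻¹) * cs.longest = cs.simple i * w := by group
  rw [e1] at h1
  rw [e2] at h2
  have := h i
  omega

end CoxeterSystem
end

noncomputable section

open HeckeAlgebra (parabolicSubgroup)

namespace CoxeterSystem

variable {B W : Type*} [Group W] {M : CoxeterMatrix B} (cs : CoxeterSystem M W)

open Classical in
/-- A left ascent `s` of the minimal element `d` of `w W_I` with `s d ∉ d W_I`, if there is one. -/
def freeAscent (I : Set B) (w : W) : Option B :=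
  if h : ∃ s, cs.length (cs.rightMin I w) < cs.length (cs.simple s * cs.rightMin I w) ∧
    (cs.rightMin I w)⁻¹ * cs.simple s * cs.rightMin I w ∉ parabolicSubgroup cs I
  then some h.choose else none

theorem freeAscent_mul {I : Set B} {b : W} (w : W) (hb : b ∈ parabolicSubgroup cs I) :
    cs.freeAscent I (w * b) = cs.freeAscent I w := by
  rw [freeAscent, freeAscent, cs.rightMin_mul w hb]

theorem freeAscent_rightMin (I : Set B) (w : W) :
    cs.freeAscent I (cs.rightMin I w) = cs.freeAscent I w := by
  rw [freeAscent, freeAscent, cs.rightMin_rightMin]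

theorem length_lt_of_freeAscent {I : Set B} {w : W} {s : B} (h : cs.freeAscent I w = some s) :
    cs.length (cs.rightMin I w) < cs.length (cs.simple s * cs.rightMin I w) := by
  rw [freeAscent] at h
  split_ifs at h with h'
  obtain rfl := Option.some.inj h
  exact h'.choose_spec.1

theorem notMem_of_freeAscent {I : Set B} {w : W} {s : B} (h : cs.freeAscent I w = some s) :
    w⁻¹ * cs.simple s * w ∉ parabolicSubgroup cs I := by
  have h2 : (cs.rightMin I w)⁻¹ * cs.simple s * cs.rightMin I w ∉ parabolicSubgroup cs I := by
    rw [freeAscent] at h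
    split_ifs at h with h'
    obtain rfl := Option.some.inj h
    exact h'.choose_spec.2
  intro hm
  obtain ⟨b, hb, e⟩ := cs.exists_eq_rightMin_mul I w
  apply h2
  rw [show (cs.rightMin I w)⁻¹ * cs.simple s * cs.rightMin I w =
    b * ((cs.rightMin I w * b)⁻¹ * cs.simple s * (cs.rightMin I w * b)) * b⁻¹ by group, ← e]
  exact mul_mem (mul_mem hb hm) (inv_mem hb)

variable [Finite W] (I : Set B)

/-- The longest of the minimal representatives of the cosets `w W_I`. -/
def topMin : W := cs.rightMin I cs.longest

theorem rightMin_topMin : cs.rightMin I (cs.topMin I) = cs.topMin I := cs.rightMin_rightMin I _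

theorem exists_longest_parabolicSubgroup : ∃ b ∈ parabolicSubgroup cs I,
    ∀ c ∈ parabolicSubgroup cs I, cs.length c ≤ cs.length b := by
  obtain ⟨b, hb⟩ := Finite.exists_max fun c : parabolicSubgroup cs I => cs.length c.1
  exact ⟨b.1, b.2, fun c hc => hb ⟨c, hc⟩⟩

theorem length_rightMin_le_topMin (w : W) :
    cs.length (cs.rightMin I w) ≤ cs.length (cs.topMin I) := by
  obtain ⟨b, hb, hmax⟩ := cs.exists_longest_parabolicSubgroup I
  obtain ⟨c, hc, e⟩ := cs.exists_eq_rightMin_mul I cs.longest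
  have h1 := cs.length_le_longest (cs.rightMin I w * b)
  have h2 := cs.length_rightMin_mul cs.longest hc
  rw [← e] at h2
  rw [cs.length_rightMin_mul w hb] at h1
  have := hmax c hc
  rw [topMin]
  omega

theorem rightMin_eq_topMin {w : W} (h : cs.freeAscent I w = none) :
    cs.rightMin I w = cs.topMin I := by
  classical
  rw [freeAscent, dite_eq_right_iff] at h
  simp only [reduceCtorEq, imp_false, not_exists, not_and, not_not] at h
  obtain ⟨b, hb, hmax⟩ := cs.exists_longest_parabolicSubgroup I
  set d := cs.rightMin I w with hd
  have key : d * b = cs.longest := by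
    refine cs.eq_longest fun s => ?_
    have h0 := cs.length_rightMin_mul w hb
    rw [← hd] at h0
    have h2 := cs.length_simple_mul_ne (d * b) s
    by_cases hs : cs.length d < cs.length (cs.simple s * d)
    · have hm := mul_mem (h s hs) hb
      have h1 := cs.length_rightMin_mul w hm
      rw [← hd] at h1
      have := hmax _ hm
      have e : d * (d⁻¹ * cs.simple s * d * b) = cs.simple s * (d * b) := by group
      rw [e] at h1
      omega
    · have h3 := cs.length_simple_mul_ne d s
      have h4 := cs.length_mul_le (cs.simple s * d) b
      rw [mul_assoc] at h4
      omega
  rw [topMin, ← key, cs.rightMin_mul d hb, hd, cs.rightMin_rightMin]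

theorem length_rightMin_lt_topMin {w : W} {s : B} (h : cs.freeAscent I w = some s) :
    cs.length (cs.rightMin I w) < cs.length (cs.topMin I) := by
  set d := cs.rightMin I w with hd
  have h1 := cs.length_lt_of_freeAscent h
  rw [← freeAscent_rightMin, ← hd] at h
  have h2 := cs.notMem_of_freeAscent h
  rw [← hd] at h1
  have hmin : cs.IsMin I d⁻¹ := by
    rw [hd, rightMin, inv_inv]
    exact cs.isMin_minPart I w⁻¹
  rcases hmin.mul_simple s with h3 | ⟨i, hi, e⟩
  · have h4 := cs.length_rightMin_le_topMin I (cs.simple s * d)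
    rw [rightMin, mul_inv_rev, cs.inv_simple, h3.eq_minPart, mul_inv_rev, inv_inv,
      cs.inv_simple] at h4
    omega
  · refine absurd ?_ h2
    rw [← e, inv_mul_cancel_right]
    exact cs.simple_mem_parabolicSubgroup hi

theorem freeAscent_topMin : cs.freeAscent I (cs.topMin I) = none := by
  by_contra h
  obtain ⟨s, hs⟩ := Option.ne_none_iff_exists'.1 h
  have h1 := cs.length_lt_of_freeAscent hs
  have h2 := cs.notMem_of_freeAscent hs
  rw [rightMin_topMin] at h1
  obtain ⟨b, hb, e⟩ := cs.exists_eq_rightMin_mul I cs.longest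
  have h3 := cs.length_lt_simple_mul_mul hb h1 h2
  rw [topMin, ← e] at h3
  have := cs.length_le_longest (cs.simple s * cs.longest)
  omega

theorem exists_of_length_lt_topMin {s : B}
    (hs : cs.length (cs.topMin I) < cs.length (cs.simple s * cs.topMin I)) :
    ∃ t ∈ I, cs.simple s * cs.topMin I = cs.topMin I * cs.simple t := by
  classical
  have h := cs.freeAscent_topMin I
  rw [freeAscent, dite_eq_right_iff, rightMin_topMin] at h
  simp only [reduceCtorEq, imp_false, not_exists, not_and, not_not] at h
  have hm := h s hs
  have h1 := cs.length_rightMin_mul cs.longest hm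
  rw [← topMin] at h1
  have e : cs.topMin I * ((cs.topMin I)⁻¹ * cs.simple s * cs.topMin I) =
    cs.simple s * cs.topMin I := by group
  rw [e] at h1
  have h2 := cs.length_simple_mul (cs.topMin I) s
  obtain ⟨t, ht⟩ := cs.length_eq_one_iff.1
    (show cs.length ((cs.topMin I)⁻¹ * cs.simple s * cs.topMin I) = 1 by omega)
  rw [ht] at hm
  exact ⟨t, cs.mem_of_simple_mem_parabolicSubgroup hm, by rw [← ht, e]⟩

theorem exists_simple_mul_topMin {t : B} (ht : t ∈ I) :
    ∃ s, cs.simple s * cs.topMin I = cs.topMin I * cs.simple t := by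
  obtain ⟨b, hb, e⟩ := cs.exists_eq_rightMin_mul I cs.longest
  rw [← topMin] at e
  have hm := mul_mem (cs.simple_mem_parabolicSubgroup ht) hb
  have h1 := cs.length_rightMin_mul cs.longest hb
  have h2 := cs.length_rightMin_mul cs.longest hm
  rw [← topMin] at h1 h2
  have h3 := cs.length_mul_longest_add (cs.topMin I * cs.simple t * (cs.topMin I)⁻¹)
  rw [← e] at h1
  rw [show cs.topMin I * cs.simple t * (cs.topMin I)⁻¹ * cs.longest =
    cs.topMin I * (cs.simple t * b) by rw [e]; group] at h3
  have h4 := cs.length_simple_mul b t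
  have h5 := cs.length_le_longest (cs.topMin I * (cs.simple t * b))
  have h6 : cs.length (cs.topMin I * cs.simple t * (cs.topMin I)⁻¹) = 1 := by omega
  obtain ⟨s, hs⟩ := cs.length_eq_one_iff.1 h6
  exact ⟨s, by rw [← hs]; group⟩

/-- The embedding `t ↦ d t d⁻¹` of `I` into the set of simple reflections, where `d` is the longest
minimal representative of the cosets `w W_I`. -/
def conjTop : I ↪ B where
  toFun t := (cs.exists_simple_mul_topMin I t.2).choose
  inj' := by
    intro t t' h
    have h1 := (cs.exists_simple_mul_topMin I t.2).choose_spec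
    have h2 := (cs.exists_simple_mul_topMin I t'.2).choose_spec
    simp only at h
    rw [h, h2] at h1
    exact Subtype.ext (cs.simple_injective (mul_left_cancel h1)).symm

theorem simple_conjTop_mul (t : I) :
    cs.simple (cs.conjTop I t) * cs.topMin I = cs.topMin I * cs.simple t :=
  (cs.exists_simple_mul_topMin I t.2).choose_spec

theorem mem_range_conjTop {s : B}
    (hs : cs.length (cs.topMin I) < cs.length (cs.simple s * cs.topMin I)) :
    s ∈ Set.range (cs.conjTop I) := by
  obtain ⟨t, ht, e⟩ := cs.exists_of_length_lt_topMin I hs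
  refine ⟨⟨t, ht⟩, cs.simple_injective (mul_right_cancel (b := cs.topMin I) ?_)⟩
  rw [simple_conjTop_mul, e]

end CoxeterSystem
end

noncomputable section

open CategoryTheory

universe u v w

theorem HomotopyCategory.nonempty_iso_of_surjective {A : Type u} [Ring A]
    {K L : CochainComplex (ModuleCat.{v} A) ℤ} (π : K ⟶ L) (e : K ⟶ K)
    (he : (HomotopyCategory.quotient _ (ComplexShape.up ℤ)).map e = 𝟙 _)
    (hπ : ∀ i, Function.Surjective (π.f i).hom)
    (hker : ∀ i x, (π.f i).hom x = 0 → (e.f i).hom x = 0) (heπ : e ≫ π = π) :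
    Nonempty ((HomotopyCategory.quotient _ (ComplexShape.up ℤ)).obj K ≅
      (HomotopyCategory.quotient _ (ComplexShape.up ℤ)).obj L) := by
  let σ : ∀ i, L.X i →ₗ[A] K.X i := fun i =>
    ((LinearMap.ker (π.f i).hom).liftQ (e.f i).hom fun x hx => hker i x hx) ∘ₗ
      ((π.f i).hom.quotKerEquivOfSurjective (hπ i)).symm.toLinearMap
  have hσ : ∀ i x, σ i ((π.f i).hom x) = (e.f i).hom x := by
    intro i x
    have : ((π.f i).hom.quotKerEquivOfSurjective (hπ i)).symm ((π.f i).hom x) =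
        Submodule.Quotient.mk x := by
      rw [LinearEquiv.symm_apply_eq]
      rfl
    simp only [σ, LinearMap.comp_apply, LinearEquiv.coe_coe, this]
    rfl
  let σ' : L ⟶ K :=
    { f := fun i => ModuleCat.ofHom (σ i)
      comm' := by
        intro i j _
        refine ModuleCat.hom_ext (LinearMap.ext fun y => ?_)
        obtain ⟨x, rfl⟩ := hπ i y
        have h1 := congrArg (fun f => f.hom x) (π.comm i j)
        have h2 := congrArg (fun f => f.hom x) (e.comm i j)
        simp only [ModuleCat.hom_comp, LinearMap.comp_apply] at h1 h2 ⊢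
        change (K.d i j).hom (σ i _) = σ j _
        rw [hσ, h1, hσ, h2] }
  have e1 : π ≫ σ' = e := by
    ext i x
    exact hσ i x
  have e2 : σ' ≫ π = 𝟙 L := by
    ext i y
    obtain ⟨x, rfl⟩ := hπ i y
    change (π.f i).hom (σ i _) = _
    rw [hσ]
    exact congrArg (fun f => (f.f i).hom x) heπ
  exact ⟨⟨(HomotopyCategory.quotient _ _).map π, (HomotopyCategory.quotient _ _).map σ',
    by rw [← Functor.map_comp, e1, he],
    by rw [← Functor.map_comp, e2]; exact (HomotopyCategory.quotient _ _).map_id L⟩⟩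

namespace CoeffSystem

theorem sign_mul_self {S : Type w} [LinearOrder S] (I : Finset S) (s : S) :
    sign I s * sign I s = 1 := by
  rw [sign, ← mul_pow]; simp

theorem sign_insert {S : Type w} [LinearOrder S] (I : Finset S) {s : S} (hs : s ∉ I) (r : S) :
    sign (insert s I) r = sign I r * (if s < r then -1 else 1) := by
  rw [sign, sign, Finset.filter_insert]
  split_ifs with h
  · rw [Finset.card_insert_of_notMem (by simp [hs]), pow_succ]
  · rw [mul_one]

theorem sign_mul_sign_insert {S : Type w} [LinearOrder S] (I : Finset S) {s r : S} (hs : s ∉ I)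
    (hr : r ∉ I) (h : r ≠ s) :
    sign (insert s I) r * sign (insert r I) s = -(sign I s * sign I r) := by
  rw [sign_insert I hs, sign_insert I hr]
  rcases lt_or_gt_of_ne h with h | h
  · rw [if_neg h.not_gt, if_pos h]; ring
  · rw [if_neg h.not_gt, if_pos h]; ring

variable {A : Type u} [Ring A] {S : Type w} [LinearOrder S] {F : Finset S ⥤ ModuleCat.{v} A}

theorem complex_d (i : ℤ) : (complex F).d i (i + 1) = ModuleCat.ofHom (differential F i) :=
  CochainComplex.of_d (fun i => ModuleCat.of A (Term F i))
    (fun i => ModuleCat.ofHom (differential F i)) i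

/-- The subset `J ∪ {s}`. -/
abbrev Level.insert {i j : ℤ} (hij : j + 1 = i) (J : Level S j) (s : {s : S // s ∉ J.1}) :
    Level S i :=
  ⟨Insert.insert s.1 J.1, by
    have h1 := J.2
    rw [Finset.card_insert_of_notMem s.2]
    omega⟩

theorem sum_notMem_erase {X : Type*} [AddCommMonoid X] [Fintype S] (J : Finset S) {s : S}
    (hs : s ∈ J) (f : {r // r ∉ J.erase s} → X) :
    ∑ r, f r = f ⟨s, Finset.notMem_erase s J⟩ +
      ∑ r : {r // r ∉ J}, f ⟨r.1, fun h => r.2 (Finset.mem_of_mem_erase h)⟩ := by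
  refine Eq.trans (Fintype.sum_bijective (fun o : Option {r // r ∉ J} =>
    o.elim (⟨s, Finset.notMem_erase s J⟩ : {r // r ∉ J.erase s})
    fun r => ⟨r.1, fun h => r.2 (Finset.mem_of_mem_erase h)⟩) ⟨?_, ?_⟩ _ f fun _ => rfl).symm
    (Fintype.sum_option _)
  · rintro (_ | ⟨r, hr⟩) (_ | ⟨r', hr'⟩) h
    · rfl
    · exact absurd hs (by have := congrArg Subtype.val h; simp only [Option.elim] at this; rwa [this])
    · exact absurd hs (by have := congrArg Subtype.val h; simp only [Option.elim] at this; rwa [← this])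
    · simpa using h
  · rintro ⟨r, hr⟩
    by_cases h : r = s
    · exact ⟨none, Subtype.ext h.symm⟩
    · exact ⟨some ⟨r, fun h' => hr (Finset.mem_erase.2 ⟨h, h'⟩)⟩, rfl⟩

theorem sum_mem_insert {X : Type*} [AddCommMonoid X] (J : Finset S) {r : S}
    (hr : r ∉ J) (f : {s // s ∈ insert r J} → X) :
    ∑ s, f s = f ⟨r, Finset.mem_insert_self r J⟩ +
      ∑ s : J, f ⟨s.1, Finset.mem_insert_of_mem s.2⟩ := by
  refine Eq.trans (Fintype.sum_bijective (fun o : Option J =>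
    o.elim (⟨r, Finset.mem_insert_self r J⟩ : {s // s ∈ insert r J})
    fun s => ⟨s.1, Finset.mem_insert_of_mem s.2⟩) ⟨?_, ?_⟩ _ f fun _ => rfl).symm
    (Fintype.sum_option _)
  · rintro (_ | ⟨s, hs⟩) (_ | ⟨s', hs'⟩) h
    · rfl
    · exact absurd hs' (by have := congrArg Subtype.val h; simp only [Option.elim] at this; rwa [← this])
    · exact absurd hs (by have := congrArg Subtype.val h; simp only [Option.elim] at this; rwa [this])
    · simpa using h
  · rintro ⟨s, hs⟩
    rcases Finset.mem_insert.1 hs with h | h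
    · exact ⟨none, Subtype.ext h.symm⟩
    · exact ⟨some ⟨s, h⟩, rfl⟩

section Homotopy

variable (θ : ∀ (I J : Finset S) (r : S), r ∉ I → insert r I = J → (F.obj J →ₗ[A] F.obj I))

/-- The commutator of the restriction along `I ⊆ I ∪ {s}` with `θ` along `r`. -/
def commutator (I J J' K : Finset S) (r : S) (hr : r ∉ I) (hr' : r ∉ J') (hJ : insert r I = J)
    (hK : insert r J' = K) (h : I ≤ J') (h' : J ≤ K) : F.obj J →ₗ[A] F.obj J' :=
  restr F h ∘ₗ θ I J r hr hJ - θ J' K r hr' hK ∘ₗ restr F h'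

variable [Fintype S]

/-- The map of degree `-1` with components `± θ`. -/
def codifferential {i j : ℤ} (hij : j + 1 = i) : Term F i →ₗ[A] Term F j :=
  LinearMap.pi fun J => ∑ s : {s : S // s ∉ J.1}, sign J.1 s.1 •
    (θ J.1 _ s.1 s.2 rfl ∘ₗ LinearMap.proj (J.insert hij s))

theorem codifferential_apply {i j : ℤ} (hij : j + 1 = i) (x : Term F i) (J : Level S j) :
    codifferential θ hij x J = ∑ s : {s : S // s ∉ J.1}, sign J.1 s.1 •
      θ J.1 _ s.1 s.2 rfl (x (J.insert hij s)) := by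
  rw [codifferential, LinearMap.pi_apply, LinearMap.sum_apply]
  rfl

/-- The diagonal components of the anticommutator of the differential and the codifferential. -/
def diagonal (J : Finset S) : F.obj J →ₗ[A] F.obj J :=
  ∑ s : J, restr F (Finset.erase_subset s.1 J) ∘ₗ
      θ (J.erase s.1) J s.1 (Finset.notMem_erase s.1 J) (Finset.insert_erase s.2) +
    ∑ r : {r // r ∉ J}, θ J _ r.1 r.2 rfl ∘ₗ restr F (Finset.subset_insert r.1 J)

theorem differential_codifferential_add (k : ℤ) (x : Term F (k + 1)) (J : Level S (k + 1)) :
    differential F k (codifferential θ rfl x) J + codifferential θ rfl (differential F (k + 1) x) J =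
      diagonal θ J.1 (x J) + ∑ s : J.1, ∑ r : {r // r ∉ J.1},
        (sign (J.1.erase s.1) s.1 * sign (J.1.erase s.1) r.1) •
          commutator θ (J.1.erase s.1) _ J.1 _ r.1 (fun h => r.2 (Finset.mem_of_mem_erase h)) r.2
            rfl rfl (Finset.erase_subset s.1 J.1)
            (Finset.insert_subset_insert _ (Finset.erase_subset s.1 J.1))
            (x ((J.erase s).insert rfl ⟨r.1, fun h => r.2 (Finset.mem_of_mem_erase h)⟩)) := by
  have hθ : ∀ (K K' : Level S (k + 1)) (_ : K = K') (I : Finset S) (s : S) (hs : s ∉ I) (h h'),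
      θ I K.1 s hs h (x K) = θ I K'.1 s hs h' (x K') := by
    rintro K _ rfl I s hs h h'
    rfl
  have hres : ∀ (K K' : Level S (k + 1)) (_ : K = K') (I : Finset S) (h : K.1 ≤ I) (h' : K'.1 ≤ I),
      restr F h (x K) = restr F h' (x K') := by
    rintro K _ rfl I h h'
    rfl
  have e1 : differential F k (codifferential θ rfl x) J =
      ∑ s : J.1, restr F (J.erase_le s)
        (θ (J.1.erase s.1) J.1 s.1 (Finset.notMem_erase s.1 J.1) (Finset.insert_erase s.2) (x J)) +
      ∑ s : J.1, ∑ r : {r // r ∉ J.1}, (sign (J.1.erase s.1) s.1 * sign (J.1.erase s.1) r.1) •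
        restr F (J.erase_le s) (θ (J.1.erase s.1) _ r.1 (fun h => r.2 (Finset.mem_of_mem_erase h))
          rfl (x ((J.erase s).insert rfl ⟨r.1, fun h => r.2 (Finset.mem_of_mem_erase h)⟩))) := by
    rw [differential_apply, ← Finset.sum_add_distrib]
    refine Finset.sum_congr rfl fun s _ => ?_
    have h1 := (codifferential_apply θ rfl x (J.erase s)).trans
      (sum_notMem_erase J.1 s.2 _)
    rw [h1, map_add, smul_add, map_zsmul, smul_smul, map_sum, Finset.smul_sum]
    simp only [map_zsmul, smul_smul]
    congr 1
    change (sign (J.1.erase s.1) s.1 * sign (J.1.erase s.1) s.1) • _ = _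
    rw [sign_mul_self, one_smul]
    exact congrArg _ (hθ ((J.erase s).insert rfl ⟨s.1, Finset.notMem_erase s.1 J.1⟩) J
      (Subtype.ext (Finset.insert_erase s.2)) _ _ _ _ _)
  have e2 : codifferential θ rfl (differential F (k + 1) x) J =
      ∑ r : {r // r ∉ J.1}, θ J.1 _ r.1 r.2 rfl
        (restr F (Finset.subset_insert r.1 J.1) (x J)) -
      ∑ s : J.1, ∑ r : {r // r ∉ J.1}, (sign (J.1.erase s.1) s.1 * sign (J.1.erase s.1) r.1) •
        θ J.1 _ r.1 r.2 rfl
          (restr F (Finset.insert_subset_insert _ (Finset.erase_subset s.1 J.1))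
          (x ((J.erase s).insert rfl ⟨r.1, fun h => r.2 (Finset.mem_of_mem_erase h)⟩))) := by
    rw [codifferential_apply, Finset.sum_comm, ← Finset.sum_sub_distrib]
    refine Finset.sum_congr rfl fun r _ => ?_
    have h1 := (differential_apply F (k + 1) x (J.insert rfl r)).trans
      (sum_mem_insert J.1 r.2 _)
    rw [h1, map_add, smul_add, map_zsmul, smul_smul, map_sum, Finset.smul_sum, sub_eq_add_neg,
      ← Finset.sum_neg_distrib]
    simp only [map_zsmul, smul_smul]
    have hL : (J.insert rfl r).erase ⟨r.1, Finset.mem_insert_self r.1 J.1⟩ = J :=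
      Subtype.ext (Finset.erase_insert r.2)
    refine congrArg₂ (· + ·) ?_ (Finset.sum_congr rfl fun s _ => ?_)
    · have h3 : sign ((J.insert rfl r).erase ⟨r.1, Finset.mem_insert_self r.1 J.1⟩).1 r.1 =
        sign J.1 r.1 := by rw [hL]
      rw [h3, sign_mul_self, one_smul]
      exact congrArg _ (hres _ _ hL _ _ _)
    · have hne : r.1 ≠ s.1 := fun h => r.2 (h ▸ s.2)
      have hE : (insert r.1 J.1).erase s.1 = insert r.1 (J.1.erase s.1) :=
        Finset.erase_insert_of_ne hne
      have h3 := sign_mul_sign_insert (J.1.erase s.1) (Finset.notMem_erase s.1 J.1)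
        (fun h => r.2 (Finset.mem_of_mem_erase h)) hne
      rw [Finset.insert_erase s.2] at h3
      have h4 : sign J.1 r.1 * sign ((J.insert rfl r).erase
          ⟨s.1, Finset.mem_insert_of_mem s.2⟩).1 s.1 =
          -(sign (J.1.erase s.1) s.1 * sign (J.1.erase s.1) r.1) := by
        rw [← h3]
        exact congrArg (fun z => sign J.1 r.1 * sign z s.1) hE
      rw [h4, neg_smul]
      exact congrArg (fun z => -(_ • θ _ _ _ _ _ z)) (hres
        ((J.insert rfl r).erase ⟨s.1, Finset.mem_insert_of_mem s.2⟩)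
        ((J.erase s).insert rfl ⟨r.1, fun h => r.2 (Finset.mem_of_mem_erase h)⟩)
        (Subtype.ext hE) _ _ _)
  have aux : ∀ a b c d e : F.obj J.1, b - d = e → a + b + (c - d) = a + c + e := by
    rintro a b c d _ rfl
    abel
  rw [e1, e2, diagonal, LinearMap.add_apply, LinearMap.sum_apply, LinearMap.sum_apply]
  refine aux _ _ _ _ _ ?_
  rw [← Finset.sum_sub_distrib]
  refine Finset.sum_congr rfl fun s _ => ?_
  rw [← Finset.sum_sub_distrib]
  exact Finset.sum_congr rfl fun r _ => (smul_sub _ _ _).symm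

end Homotopy
end CoeffSystem
end

noncomputable section

open CategoryTheory

universe u v w

namespace CoeffSystem

/-- The image of a subset under an embedding. -/
abbrev Level.map {S T : Type w} (φ : T ↪ S) {i : ℤ} (J : Level T i) : Level S i :=
  ⟨J.1.map φ, by rw [Finset.card_map]; exact J.2⟩

section Reorder

variable {S T : Type w} [LinearOrder S] [LinearOrder T] (φ : T ↪ S)

/-- The sign of the reordering of a subset under an embedding. -/
def reorderSign (J : Finset T) : ℤ :=
  ∏ t ∈ J, ∏ u ∈ J, if t < u ∧ φ u < φ t then -1 else 1

theorem reorderSign_mul_self (J : Finset T) : reorderSign φ J * reorderSign φ J = 1 := by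
  simp only [reorderSign, ← Finset.prod_mul_distrib]
  exact Finset.prod_eq_one fun t _ => Finset.prod_eq_one fun u _ => by split_ifs <;> rfl

theorem sign_eq_prod (I : Finset S) (s : S) : sign I s = ∏ t ∈ I, if t < s then -1 else 1 := by
  rw [sign, Finset.prod_ite, Finset.prod_const, Finset.prod_const_one, mul_one]

theorem reorderSign_insert (J : Finset T) {s : T} (hs : s ∉ J) :
    reorderSign φ (insert s J) * sign (J.map φ) (φ s) = reorderSign φ J * sign J s := by
  simp only [sign_eq_prod, reorderSign, Finset.prod_map, Finset.prod_insert hs,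
    Finset.prod_mul_distrib]
  rw [if_neg (by simp), one_mul]
  have key : ∀ t ∈ J, (if s < t ∧ φ t < φ s then (-1 : ℤ) else 1) *
      (if t < s ∧ φ s < φ t then -1 else 1) * (if φ t < φ s then -1 else 1) =
      if t < s then -1 else 1 := by
    intro t ht
    have hne : t ≠ s := fun h => hs (h ▸ ht)
    have hne' : φ t ≠ φ s := fun h => hne (φ.injective h)
    rcases lt_or_gt_of_ne hne with h | h <;> rcases lt_or_gt_of_ne hne' with h' | h' <;>
      simp [h, h', h.not_gt, h'.not_gt]
  rw [← Finset.prod_congr rfl key, Finset.prod_mul_distrib, Finset.prod_mul_distrib]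
  ring

end Reorder

section Comparison

variable {A : Type u} [Ring A] {S T : Type w} [LinearOrder S] [LinearOrder T]
  {F : Finset S ⥤ ModuleCat.{v} A} (φ : T ↪ S) {G : Finset T ⥤ ModuleCat.{v} A}
  (p : ∀ J : Finset T, F.obj (J.map φ) →ₗ[A] G.obj J)

/-- The map of terms defined by a family of maps of coefficients. -/
def compareTerm (i : ℤ) : Term F i →ₗ[A] Term G i :=
  LinearMap.pi fun J => reorderSign φ J.1 • (p J.1 ∘ₗ LinearMap.proj (J.map φ))

theorem compareTerm_apply (i : ℤ) (x : Term F i) (J : Level T i) :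
    compareTerm φ p i x J = reorderSign φ J.1 • p J.1 (x (J.map φ)) := rfl

theorem compareTerm_differential
    (hp : ∀ (J J' : Finset T) (h : J ≤ J') (x : F.obj (J.map φ)),
      p J' (restr F (Finset.map_subset_map.2 h) x) = restr G h (p J x)) (i : ℤ) (x : Term F i) :
    compareTerm φ p (i + 1) (differential F i x) = differential G i (compareTerm φ p i x) := by
  have hres : ∀ (K K' : Level S i) (_ : K = K') (I : Finset S) (h : K.1 ≤ I) (h' : K'.1 ≤ I),
      restr F h (x K) = restr F h' (x K') := by
    rintro K _ rfl I h h'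
    rfl
  funext J
  rw [compareTerm_apply, differential_apply, differential_apply, map_sum, Finset.smul_sum]
  refine (Fintype.sum_bijective
    (fun t : J.1 => (⟨φ t.1, Finset.mem_map_of_mem φ t.2⟩ : (J.map φ).1)) ⟨?_, ?_⟩ _ _ ?_).symm
  · intro t t' h
    exact Subtype.ext (φ.injective (congrArg Subtype.val h))
  · rintro ⟨s, hs⟩
    obtain ⟨t, ht, rfl⟩ := Finset.mem_map.1 hs
    exact ⟨⟨t, ht⟩, rfl⟩
  · intro t
    have hE : (J.map φ).erase ⟨φ t.1, Finset.mem_map_of_mem φ t.2⟩ = (J.erase t).map φ :=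
      Subtype.ext (Finset.map_erase φ J.1 t.1).symm
    have h1 := reorderSign_insert φ (J.1.erase t.1) (Finset.notMem_erase t.1 J.1)
    rw [Finset.insert_erase t.2] at h1
    have h2 : sign ((J.map φ).erase ⟨φ t.1, Finset.mem_map_of_mem φ t.2⟩).1 (φ t.1) =
      sign ((J.1.erase t.1).map φ) (φ t.1) := by rw [hE]; rfl
    rw [map_zsmul, smul_smul, h2, h1, compareTerm_apply, map_zsmul, smul_smul, mul_comm]
    refine congrArg₂ (· • ·) rfl ?_
    rw [hres _ _ hE _ _ (Finset.map_subset_map.2 (J.erase_le t))]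
    exact (hp _ _ (J.erase_le t) _).symm

/-- The chain map defined by a natural family of maps of coefficients. -/
def compareHom
    (hp : ∀ (J J' : Finset T) (h : J ≤ J') (x : F.obj (J.map φ)),
      p J' (restr F (Finset.map_subset_map.2 h) x) = restr G h (p J x)) : complex F ⟶ complex G where
  f i := ModuleCat.ofHom (compareTerm φ p i)
  comm' := by
    rintro i _ rfl
    rw [complex_d, complex_d]
    exact ModuleCat.hom_ext (LinearMap.ext fun x => (compareTerm_differential φ p hp i x).symm)

end Comparison

variable {A : Type u} [Ring A] {S : Type w} [LinearOrder S] [Fintype S]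
  {F : Finset S ⥤ ModuleCat.{v} A}
  (θ : ∀ (I J : Finset S) (r : S), r ∉ I → insert r I = J → (F.obj J →ₗ[A] F.obj I))

/-- The null-homotopic endomorphism defined by the codifferential. -/
def anticommutator : complex F ⟶ complex F :=
  Homotopy.nullHomotopicMap' fun i j (hij : (ComplexShape.up ℤ).Rel j i) =>
    ModuleCat.ofHom (codifferential θ (show j + 1 = i from hij))

/-- The anticommutator of the differential and the codifferential in a given degree. -/
def anticommutatorTerm (k : ℤ) : Term F (k + 1) →ₗ[A] Term F (k + 1) :=
  differential F k ∘ₗ codifferential θ rfl + codifferential θ rfl ∘ₗ differential F (k + 1)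

theorem anticommutator_f (k : ℤ) :
    (anticommutator θ).f (k + 1) = ModuleCat.ofHom (anticommutatorTerm θ k) := by
  refine (Homotopy.nullHomotopicMap'_f (show (ComplexShape.up ℤ).Rel k (k + 1) from rfl)
    (show (ComplexShape.up ℤ).Rel (k + 1) (k + 1 + 1) from rfl) _).trans ?_
  rw [complex_d, complex_d]
  exact ModuleCat.hom_ext (add_comm _ _)

theorem quotient_map_anticommutator :
    (HomotopyCategory.quotient _ (ComplexShape.up ℤ)).map (anticommutator θ) = 0 := by
  refine (HomotopyCategory.eq_of_homotopy _ _ (Homotopy.nullHomotopy' _)).trans ?_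
  exact (HomotopyCategory.quotient _ (ComplexShape.up ℤ)).map_zero _ _

/-- Compatibility of the maps `θ` with a filtration of a coefficient system: up to terms lower in
the filtration, the maps `θ` commute with the restriction maps, and the diagonal part of the
anticommutator is the identity on the part `N m` of the filtration and zero on the whole. -/
structure IsContraction (N : ℕ → ∀ I, Submodule A (F.obj I)) (m : ℕ) : Prop where
  bot : ∀ I, N 0 I = ⊥
  top : ∀ I, N (m + 1) I = ⊤
  commutator_mem : ∀ n ≤ m, ∀ I J J' K r hr hr' hJ hK h h', ∀ x ∈ N (n + 1) J,
    commutator θ I J J' K r hr hr' hJ hK h h' x ∈ N n J'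
  sub_diagonal_mem : ∀ n < m, ∀ J, ∀ x ∈ N (n + 1) J, x - diagonal θ J x ∈ N n J
  diagonal_mem : ∀ J x, diagonal θ J x ∈ N m J

variable {θ} {N : ℕ → ∀ I, Submodule A (F.obj I)} {m : ℕ}

theorem IsContraction.exists_end (hθ : IsContraction θ N m) :
    ∃ e : complex F ⟶ complex F,
      (HomotopyCategory.quotient _ (ComplexShape.up ℤ)).map e = 𝟙 _ ∧
      (∀ i (x : Term F i), (∀ I, x I ∈ N m I.1) → (e.f i).hom x = 0) ∧
      ∀ i (x : Term F i) (I : Level S i), ((e.f i).hom x : Term F i) I - x I ∈ N m I.1 := by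
  have hcomm : ∀ n ≤ m, ∀ k (x : Term F (k + 1)), (∀ I, x I ∈ N (n + 1) I.1) →
      ∀ J : Level S (k + 1), anticommutatorTerm θ k x J - diagonal θ J.1 (x J) ∈ N n J.1 := by
    intro n hn k x hx J
    change differential F k (codifferential θ rfl x) J +
      codifferential θ rfl (differential F (k + 1) x) J - _ ∈ _
    rw [differential_codifferential_add, add_sub_cancel_left]
    refine Submodule.sum_mem _ fun s _ => Submodule.sum_mem _ fun r _ => zsmul_mem ?_ _
    exact hθ.commutator_mem n hn _ _ _ _ _ _ _ _ _ _ _ _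
      (hx ((J.erase s).insert rfl ⟨r.1, fun h => r.2 (Finset.mem_of_mem_erase h)⟩))
  have main : ∀ n ≤ m, ∃ e : complex F ⟶ complex F,
      (HomotopyCategory.quotient _ (ComplexShape.up ℤ)).map e = 𝟙 _ ∧
      (∀ i (x : Term F i), (∀ I, x I ∈ N n I.1) → (e.f i).hom x = 0) ∧
      ∀ i (x : Term F i) (I : Level S i), ((e.f i).hom x : Term F i) I - x I ∈ N m I.1 := by
    intro n
    induction n with
    | zero =>
      intro _
      refine ⟨𝟙 _, (HomotopyCategory.quotient _ _).map_id _, fun i x hx => ?_, fun i x I => ?_⟩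
      · funext I
        have := hx I
        rw [hθ.bot] at this
        exact (Submodule.mem_bot A).1 this
      · change x I - x I ∈ _
        rw [sub_self]
        exact zero_mem _
    | succ n ih =>
      intro hn
      obtain ⟨e, h1, h2, h3⟩ := ih (by omega)
      refine ⟨(𝟙 _ - anticommutator θ) ≫ e, ?_, fun i x hx => ?_, fun i x I => ?_⟩
      · rw [Functor.map_comp, h1, Functor.map_sub, quotient_map_anticommutator, sub_zero]
        exact (Category.comp_id _).trans ((HomotopyCategory.quotient _ _).map_id _)
      · obtain ⟨k, rfl⟩ : ∃ k, i = k + 1 := ⟨i - 1, by ring⟩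
        have e0 : ((𝟙 _ - anticommutator θ).f (k + 1)).hom x = x - anticommutatorTerm θ k x := by
          rw [← ModuleCat.hom_ofHom (anticommutatorTerm θ k), ← anticommutator_f]
          rfl
        refine (congrArg _ e0).trans (h2 (k + 1) (x - anticommutatorTerm θ k x) fun J => ?_)
        have e1 := hcomm n (by omega) k x hx J
        have e2 := hθ.sub_diagonal_mem n (by omega) J.1 _ (hx J)
        have := sub_mem e2 e1
        rwa [sub_sub_sub_cancel_right] at this
      · obtain ⟨k, rfl⟩ : ∃ k, i = k + 1 := ⟨i - 1, by ring⟩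
        have e0 : ((𝟙 _ - anticommutator θ).f (k + 1)).hom x = x - anticommutatorTerm θ k x := by
          rw [← ModuleCat.hom_ofHom (anticommutatorTerm θ k), ← anticommutator_f]
          rfl
        set y : Term F (k + 1) := x - anticommutatorTerm θ k x with hy
        have e1 := hcomm m le_rfl k x (fun J => hθ.top J.1 ▸ Submodule.mem_top) I
        have e2 := hθ.diagonal_mem I.1 (x I)
        have e3 := h3 (k + 1) y I
        have e4 := sub_mem e3 (add_mem e1 e2)
        rw [sub_add_cancel] at e4
        have e5 : y I = x I - anticommutatorTerm θ k x I := rfl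
        have e6 : ((((𝟙 _ - anticommutator θ) ≫ e).f (k + 1)).hom x : Term F (k + 1)) =
          ((e.f (k + 1)).hom y : Term F (k + 1)) := congrArg (e.f (k + 1)).hom e0
        rw [e6]
        rw [e5] at e4
        rwa [sub_sub, sub_add_cancel] at e4
  exact main m le_rfl

variable {T : Type w} [LinearOrder T] (φ : T ↪ S) {G : Finset T ⥤ ModuleCat.{v} A}
  (p : ∀ J : Finset T, F.obj (J.map φ) →ₗ[A] G.obj J)

theorem IsContraction.nonempty_iso (hθ : IsContraction θ N m)
    (hp : ∀ (J J' : Finset T) (h : J ≤ J') (x : F.obj (J.map φ)),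
      p J' (restr F (Finset.map_subset_map.2 h) x) = restr G h (p J x))
    (hsurj : ∀ J, Function.Surjective (p J)) (hker : ∀ J x, p J x = 0 ↔ x ∈ N m (J.map φ))
    (htop : ∀ I, (∀ J : Finset T, J.map φ ≠ I) → N m I = ⊤) :
    Nonempty ((HomotopyCategory.quotient _ (ComplexShape.up ℤ)).obj (complex F) ≅
      (HomotopyCategory.quotient _ (ComplexShape.up ℤ)).obj (complex G)) := by
  classical
  obtain ⟨e, h1, h2, h3⟩ := hθ.exists_end
  have hinj : ∀ i (J J' : Level T i), J.map φ = J'.map φ → J = J' := fun i J J' h =>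
    Subtype.ext (Finset.map_injective φ (congrArg Subtype.val h))
  refine HomotopyCategory.nonempty_iso_of_surjective (compareHom φ p hp) e h1 (fun i => ?_)
    (fun i x hx => ?_) ?_
  · intro y
    choose z hz using fun J : Level T i => hsurj J.1 (reorderSign φ J.1 • (y : Term G i) J)
    let x : Term F i := fun I => if h : ∃ J : Level T i, J.map φ = I then h.choose_spec ▸ z h.choose
      else 0
    have hx : ∀ J : Level T i, x (J.map φ) = z J := by
      intro J
      have hex : ∃ J' : Level T i, J'.map φ = J.map φ := ⟨J, rfl⟩
      have : ∀ (J' : Level T i) (h : J'.map φ = J.map φ), (h ▸ z J' : F.obj (J.map φ).1) = z J := by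
        intro J' h
        obtain rfl := hinj i _ _ h
        rfl
      simp only [x, dif_pos hex]
      exact this _ _
    refine ⟨x, funext fun J => ?_⟩
    change reorderSign φ J.1 • p J.1 (x (J.map φ)) = _
    rw [hx, hz, smul_smul, reorderSign_mul_self, one_smul]
  · refine h2 i x fun I => ?_
    by_cases h : ∃ J : Finset T, J.map φ = I.1
    · obtain ⟨J, hJ⟩ := h
      obtain ⟨I, hI⟩ := I
      subst hJ
      rw [Finset.card_map] at hI
      have h4 : reorderSign φ J • p J ((x : Term F i) (Level.map φ ⟨J, hI⟩)) = 0 :=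
        congrFun hx ⟨J, hI⟩
      have h5 := congrArg (reorderSign φ J • ·) h4
      simp only [smul_smul, reorderSign_mul_self, one_smul, smul_zero] at h5
      exact (hker _ _).1 h5
    · rw [htop I.1 fun J hJ => h ⟨J, hJ⟩]
      exact Submodule.mem_top
  · ext i x
    funext J
    change reorderSign φ J.1 • p J.1 (((e.f i).hom x : Term F i) (J.map φ)) =
      reorderSign φ J.1 • p J.1 ((x : Term F i) (J.map φ))
    rw [← sub_eq_zero, ← smul_sub, ← map_sub, (hker _ _).2 (h3 i x (J.map φ)), smul_zero]

end CoeffSystem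
end

noncomputable section

open CategoryTheory

universe u v v' w

namespace CoeffSystem

section Restrict

variable {A : Type*} {A' : Type*} [Ring A] [Ring A'] (f : A →+* A') {S : Type w} [LinearOrder S]
  (F : Finset S ⥤ ModuleCat.{v} A')

/-- Restriction of scalars commutes with the formation of the terms. -/
def restrictTermEquiv (i : ℤ) :
    (ModuleCat.restrictScalars f).obj (ModuleCat.of A' (Term F i)) ≃ₗ[A]
      Term (F ⋙ ModuleCat.restrictScalars f) i where
  toFun x := x
  invFun x := x
  map_add' _ _ := rfl
  map_smul' _ _ := rfl

/-- Restriction of scalars commutes with the complex of a coefficient system. -/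
def restrictIso : ((ModuleCat.restrictScalars f).mapHomologicalComplex (ComplexShape.up ℤ)).obj
    (complex F) ≅ complex (F ⋙ ModuleCat.restrictScalars f) :=
  HomologicalComplex.Hom.isoOfComponents (fun i => (restrictTermEquiv f F i).toModuleIso) <| by
    rintro i _ rfl
    rw [complex_d, Functor.mapHomologicalComplex_obj_d, complex_d]
    refine ModuleCat.hom_ext (LinearMap.ext fun x => funext fun J => ?_)
    exact (differential_apply _ i _ J).trans (differential_apply F i _ J).symm

end Restrict

end CoeffSystem

section Induction

variable {R : Type*} [CommRing R] {A : Type u} [Ring A] [Algebra R A] (B : Subalgebra R A)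
  (C : Type*) [Ring C] [Algebra R C]

attribute [local instance] leftModuleOfTensor rightModuleOfTensor baseModuleOfTensor
  isScalarTowerOfTensor

variable {C} in
/-- The map `a ⊗ n ↦ a ⊗ f n` defined by a linear map `f`. -/
def indMap {N : ModuleCat.{v} (B ⊗[R] C)} {N' : ModuleCat.{v'} (B ⊗[R] C)}
    (f : N →ₗ[B ⊗[R] C] N') : SubTensor R B C N →ₗ[A ⊗[R] C] SubTensor R B C N' :=
  SubTensor.map R B
    { toFun := f, map_add' := map_add f, map_smul' := fun c n => map_smul f ((1 : B) ⊗ₜ[R] c) n }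
    fun b n => map_smul f (b ⊗ₜ[R] (1 : C)) n

variable {C} in
/-- The map `n ↦ a ⊗ n`. -/
def SubTensor.tmulHom {N : ModuleCat.{v} (B ⊗[R] C)} (a : A) : N →+ SubTensor R B C N :=
  AddMonoidHom.mk' (SubTensor.tmul R B C a) (SubTensor.tmul_add R B C a)

namespace CoeffSystem

variable {S : Type w} [LinearOrder S] [Fintype S] (F : Finset S ⥤ ModuleCat.{v} (B ⊗[R] C))

/-- The projections `A ⊗_B ⨁ M^I → A ⊗_B M^I`. -/
def indTermHom (i : ℤ) :
    SubTensor R B C (ModuleCat.of (B ⊗[R] C) (Term F i)) →ₗ[A ⊗[R] C]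
      Term (F ⋙ indFunctor (A := A) B C) i :=
  LinearMap.pi fun I => (indMap B (N := ModuleCat.of (B ⊗[R] C) (Term F i)) (LinearMap.proj I) :
    SubTensor R B C (ModuleCat.of (B ⊗[R] C) (Term F i)) →ₗ[A ⊗[R] C] SubTensor R B C (F.obj I.1))

/-- The sum of the inclusions `A ⊗_B M^I → A ⊗_B ⨁ M^I`. -/
def indTermInv (i : ℤ) :
    Term (F ⋙ indFunctor (A := A) B C) i →ₗ[A ⊗[R] C]
      SubTensor R B C (ModuleCat.of (B ⊗[R] C) (Term F i)) :=
  LinearMap.lsum (A ⊗[R] C) (fun I : Level S i => (F ⋙ indFunctor (A := A) B C).obj I.1) ℕ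
    fun I => (indMap B (N' := ModuleCat.of (B ⊗[R] C) (Term F i))
      (LinearMap.single (B ⊗[R] C) (fun I : Level S i => F.obj I.1) I))

theorem indTermInv_apply (i : ℤ) (z : Term (F ⋙ indFunctor (A := A) B C) i) :
    indTermInv B C F i z = ∑ I : Level S i, indMap B (N' := ModuleCat.of (B ⊗[R] C) (Term F i))
      (LinearMap.single (B ⊗[R] C) (fun I : Level S i => F.obj I.1) I) (z I) := by
  refine (LinearMap.congr_fun (LinearMap.lsum_apply _ _ _ _) z).trans ?_
  rw [LinearMap.sum_apply]
  rfl

theorem indTermHom_indTermInv (i : ℤ) (z : Term (F ⋙ indFunctor (A := A) B C) i) :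
    indTermHom B C F i (indTermInv B C F i z) = z := by
  suffices h : indTermHom B C F i ∘ₗ indTermInv B C F i = LinearMap.id from
    LinearMap.congr_fun h z
  refine LinearMap.pi_ext' fun I => SubTensor.hom_ext R B fun a n => ?_
  change indTermHom B C F i (indTermInv B C F i (Pi.single I (SubTensor.tmul R B C a n))) =
    Pi.single I (SubTensor.tmul R B C a n)
  have h1 : indTermInv B C F i (Pi.single I (SubTensor.tmul R B C a n)) =
      SubTensor.tmul R B C (N := ModuleCat.of (B ⊗[R] C) (Term F i)) a (Pi.single I n) :=
    LinearMap.lsum_piSingle _ _ _ _ _ _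
  rw [h1]
  funext J
  change SubTensor.tmul R B C a ((Pi.single I n : Term F i) J) = _
  rcases eq_or_ne J I with rfl | h
  · rw [Pi.single_eq_same]
    exact (Pi.single_eq_same (M := fun I : Level S i => (F ⋙ indFunctor (A := A) B C).obj I.1)
      J _).symm
  · rw [Pi.single_eq_of_ne h]
    exact ((SubTensor.tmulHom B a).map_zero).trans (Pi.single_eq_of_ne
      (M := fun I : Level S i => (F ⋙ indFunctor (A := A) B C).obj I.1) h _).symm

theorem indTermInv_indTermHom (i : ℤ)
    (z : SubTensor R B C (ModuleCat.of (B ⊗[R] C) (Term F i))) :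
    indTermInv B C F i (indTermHom B C F i z) = z := by
  suffices h : indTermInv B C F i ∘ₗ indTermHom (A := A) B C F i = LinearMap.id from
    LinearMap.congr_fun h z
  refine SubTensor.hom_ext R B fun a (x : Term F i) => ?_
  change indTermInv B C F i (indTermHom B C F i (SubTensor.tmul R B C a x)) =
    SubTensor.tmul R B C (N := ModuleCat.of (B ⊗[R] C) (Term F i)) a x
  rw [indTermInv_apply]
  refine Eq.trans ?_ (congrArg (SubTensor.tmulHom B a) (Finset.univ_sum_single x))
  rw [map_sum]
  rfl

/-- Induction commutes with the formation of the terms. -/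
def indTermEquiv (i : ℤ) :
    (indFunctor (A := A) B C).obj (ModuleCat.of (B ⊗[R] C) (Term F i)) ≃ₗ[A ⊗[R] C]
      Term (F ⋙ indFunctor (A := A) B C) i :=
  { indTermHom B C F i with
    invFun := indTermInv B C F i
    left_inv := indTermInv_indTermHom B C F i
    right_inv := indTermHom_indTermInv B C F i }

/-- Induction commutes with the complex of a coefficient system. -/
def indIso : ((indFunctor (A := A) B C).mapHomologicalComplex (ComplexShape.up ℤ)).obj
    (complex F) ≅ complex (F ⋙ indFunctor (A := A) B C) :=
  HomologicalComplex.Hom.isoOfComponents (fun i => (indTermEquiv B C F i).toModuleIso) <| by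
    rintro i _ rfl
    rw [complex_d, Functor.mapHomologicalComplex_obj_d, complex_d]
    refine ModuleCat.hom_ext (SubTensor.hom_ext R B fun a (x : Term F i) => funext fun J => ?_)
    refine (differential_apply _ i _ J).trans ?_
    refine Eq.trans ?_ (congrArg (SubTensor.tmulHom B a) (differential_apply F i x J)).symm
    rw [map_sum]
    refine Finset.sum_congr rfl fun s _ => ?_
    rw [map_zsmul]
    rfl

end CoeffSystem
end Induction
end

noncomputable section

/-! ### Maps out of tensor products over a subalgebra -/

section Lift

variable {R : Type*} [CommRing R] {A : Type*} [Ring A] [Algebra R A] (B : Subalgebra R A)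
  {C : Type*} [Ring C] [Algebra R C]
  {N : Type*} [AddCommGroup N] [Module R N] [Module B N] [Module C N] [IsScalarTower R C N]
  {Q : Type*} [AddCommGroup Q]

/-- The additive map on `A ⊗_B N` defined by a balanced biadditive map. -/
def SubTensor.lift (f : A →+ N →+ Q) (hR : ∀ (r : R) a n, f (r • a) n = f a (r • n))
    (hB : ∀ a (b : B) (c : C) n, f (a * b) (c • n) = f a (c • b • n)) : SubTensor R B C N →+ Q :=
  QuotientAddGroup.lift (SubTensor.relations R B C N).toAddSubgroup
    (TensorProduct.liftAddHom f hR) <| by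
    intro z hz
    change z ∈ SubTensor.relations R B C N at hz
    rw [SubTensor.relations] at hz
    induction hz using Submodule.closure_induction with
    | zero => exact map_zero _
    | add x y _ _ hx hy => exact (map_add _ x y).trans (by rw [hx, hy, add_zero])
    | smul_mem t x hx =>
      obtain ⟨a, b, n, rfl⟩ := hx
      induction t using TensorProduct.induction_on with
      | zero => rw [zero_smul]; exact map_zero _
      | add t t' ht ht' =>
        rw [add_smul]
        exact (map_add _ _ _).trans (by rw [ht, ht', add_zero])
      | tmul a' c =>
        rw [smul_sub, PreTensor.smul_tmul, PreTensor.smul_tmul]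
        refine (map_sub _ _ _).trans (sub_eq_zero.2 ?_)
        change f (a' * (a * b)) (c • n) = f (a' * a) (c • b • n)
        rw [← mul_assoc, hB]

end Lift

/-- An additive map compatible with the action of the pure tensors is linear. -/
def AddMonoidHom.toTensorLinearMap {R A C X Y : Type*} [CommRing R] [Ring A] [Algebra R A] [Ring C]
    [Algebra R C] [AddCommGroup X] [AddCommGroup Y] [Module (A ⊗[R] C) X] [Module (A ⊗[R] C) Y]
    (g : X →+ Y) (hg : ∀ (a : A) (c : C) x, g ((a ⊗ₜ[R] c) • x) = (a ⊗ₜ[R] c) • g x) :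
    X →ₗ[A ⊗[R] C] Y where
  toFun := g
  map_add' := map_add g
  map_smul' t x := by
    induction t using TensorProduct.induction_on with
    | zero => simp
    | tmul a c => exact hg a c x
    | add s t hs ht => simp only [add_smul, map_add, hs, ht, RingHom.id_apply] at *

/-- A biadditive map from a map of two variables. -/
def AddMonoidHom.mkBiadd {X Y Z : Type*} [AddCommGroup X] [AddCommGroup Y] [AddCommGroup Z]
    (f : X → Y → Z) (h1 : ∀ x x' y, f (x + x') y = f x y + f x' y)
    (h2 : ∀ x y y', f x (y + y') = f x y + f x y') : X →+ Y →+ Z :=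
  AddMonoidHom.mk' (fun x => AddMonoidHom.mk' (f x) (h2 x))
    fun x x' => AddMonoidHom.ext fun y => h1 x x' y

namespace HeckeAlgebra

variable {B W R : Type*} [Group W] {M : CoxeterMatrix B} {cs : CoxeterSystem M W} [CommRing R]
  (p : HeckeParameter cs R)

open Classical in
theorem h_mul_h_simple (w : W) (i : B) : h p w * h p (cs.simple i) =
    if cs.length w < cs.length (w * cs.simple i) then h p (w * cs.simple i)
    else ((p.q i : R) - 1) • h p w + (p.q i : R) • h p (w * cs.simple i) := by
  have hl := cs.length_mul_simple w i
  have hs := cs.length_simple i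
  split_ifs with hlt
  · exact h_mul_h p (by omega)
  · have e : h p (w * cs.simple i) * h p (cs.simple i) = h p w := by
      rw [h_mul_h p (by rw [cs.simple_mul_simple_cancel_right]; omega),
        cs.simple_mul_simple_cancel_right]
    rw [← e, mul_assoc, h_simple_mul_self, mul_add, mul_smul_comm, e, ← Algebra.commutes,
      ← Algebra.smul_def]

theorem h_induction {motive : HeckeAlgebra p → Prop} (add : ∀ x y, motive x → motive y → motive (x + y))
    (smul : ∀ (r : R) w, motive (r • h p w)) (x : HeckeAlgebra p) : motive x := by
  have hz : motive 0 := by simpa using smul 0 1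
  have hx : x ∈ Submodule.span R (Set.range (basis p)) := (basis p).span_eq ▸ Submodule.mem_top
  induction hx using Submodule.closure_induction with
  | zero => exact hz
  | add x y _ _ hx hy => exact add x y hx hy
  | smul_mem r x hx =>
    obtain ⟨w, rfl⟩ := hx
    exact smul r w

theorem isUnit_h (w : W) : IsUnit (h p w) := by
  have hs : ∀ i, IsUnit (h p (cs.simple i)) := by
    intro i
    have e : h p (cs.simple i) * (h p (cs.simple i) - algebraMap R _ ((p.q i : R) - 1)) =
        algebraMap R _ (p.q i : R) := by
      rw [mul_sub, h_simple_mul_self, ← Algebra.commutes, ← Algebra.smul_def, add_sub_cancel_left]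
    have e' : (h p (cs.simple i) - algebraMap R _ ((p.q i : R) - 1)) * h p (cs.simple i) =
        algebraMap R _ (p.q i : R) := by
      rw [sub_mul, h_simple_mul_self, ← Algebra.smul_def, add_sub_cancel_left]
    have hu : IsUnit (algebraMap R (HeckeAlgebra p) (p.q i : R)) := (p.q i).isUnit.map _
    have hc : Commute (h p (cs.simple i)) (h p (cs.simple i) - algebraMap R _ ((p.q i : R) - 1)) :=
      e.trans e'.symm
    exact (hc.isUnit_mul_iff.1 (e ▸ hu)).1
  obtain ⟨l, hl, rfl⟩ := cs.exists_isReduced w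
  rw [← prod_leftOp_one p hl]
  clear hl
  induction l with
  | nil => simp
  | cons i l ih =>
    rw [List.map_cons, List.prod_cons, Module.End.mul_apply, ← leftMul_h_simple, ← mul_def]
    exact (hs i).mul ih

theorem parabolic_induction {I : Set B} {motive : HeckeAlgebra p → Prop}
    (simple : ∀ i ∈ I, motive (h p (cs.simple i))) (algebraMap : ∀ r, motive (algebraMap R _ r))
    (add : ∀ x y, motive x → motive y → motive (x + y))
    (mul : ∀ x y, motive x → motive y → motive (x * y)) {x : HeckeAlgebra p}
    (hx : x ∈ parabolic p I) : motive x := by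
  have hle : parabolicSubmodule p I ≤
      Subalgebra.toSubmodule (Algebra.adjoin R ((fun i => h p (cs.simple i)) '' I)) := by
    rw [parabolicSubmodule, Submodule.span_le]
    rintro _ ⟨w, hw, rfl⟩
    exact h_mem_adjoin p hw
  have hx' : x ∈ Algebra.adjoin R ((fun i => h p (cs.simple i)) '' I) := hle hx
  clear hx
  induction hx' using Algebra.adjoin_induction with
  | mem x hx =>
    obtain ⟨i, hi, rfl⟩ := hx
    exact simple i hi
  | algebraMap r => exact algebraMap r
  | add x y _ _ hx hy => exact add x y hx hy
  | mul x y _ _ hx hy => exact mul x y hx hy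

end HeckeAlgebra
end

noncomputable section

open CategoryTheory

namespace HeckeAlgebra

variable {B W R : Type*} [Group W] {M : CoxeterMatrix B} {cs : CoxeterSystem M W} [CommRing R]
  (p : HeckeParameter cs R) (I₀ : Set B)

/-- The coefficient system `I ↦ H ⊗_{H_I} H` of `(H, H_{I₀})`-bimodules. -/
abbrev resCoeff := twoSidedCoeff (parabolicFamily p) ⋙
  ModuleCat.restrictScalars (inclRight (parabolic p I₀)).toRingHom

/-- The coefficient system `I ↦ H ⊗_{H_{I₀}} (H_{I₀} ⊗_{H_I} H_{I₀})` of `(H, H_{I₀})`-bimodules. -/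
abbrev indCoeff := twoSidedCoeff (parabolicFamilyOf p I₀) ⋙
  indFunctor (A := HeckeAlgebra p) (parabolic p I₀) (parabolic p I₀)ᵐᵒᵖ

variable {I₀} in
/-- The element `a ⊗ x` of `H ⊗_{H_I} H`. -/
def resTmul (I : Finset B) : HeckeAlgebra p →+ HeckeAlgebra p →+ (resCoeff p I₀).obj I :=
  AddMonoidHom.mkBiadd (fun a x => SubTensor.tmul R (parabolicFamily p I) (HeckeAlgebra p)ᵐᵒᵖ a x)
    (fun a a' x => congrArg Submodule.Quotient.mk (TensorProduct.add_tmul a a' x))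
    (fun a x x' => SubTensor.tmul_add R _ _ a x x')

variable {I₀} {I J : Finset B}

theorem smul_resTmul (a b x : HeckeAlgebra p) (d : parabolic p I₀) :
    (a ⊗ₜ[R] MulOpposite.op d) • resTmul (I₀ := I₀) p I b x = resTmul p I (a * b) (x * d) := rfl

theorem resTmul_mul {b : HeckeAlgebra p} (hb : b ∈ parabolic p I) (a x : HeckeAlgebra p) :
    resTmul (I₀ := I₀) p I (a * b) x = resTmul p I a (b * x) :=
  SubTensor.mul_tmul R (parabolicFamily p I) _ a ⟨b, hb⟩ x

theorem resTmul_smul (r : R) (a x : HeckeAlgebra p) :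
    resTmul (I₀ := I₀) p I (r • a) x = resTmul p I a (r • x) :=
  congrArg Submodule.Quotient.mk (TensorProduct.smul_tmul r a x)

theorem resTmul_eq_smul (a x : HeckeAlgebra p) : resTmul (I₀ := I₀) p I a x =
    (a ⊗ₜ[R] MulOpposite.op (1 : parabolic p I₀)) • resTmul p I 1 x := by
  rw [smul_resTmul, mul_one, OneMemClass.coe_one, mul_one]

theorem resTmul_mul_h {b : W} (hb : b ∈ parabolicSubgroup cs I₀) (a x : HeckeAlgebra p) :
    resTmul (I₀ := I₀) p I a (x * h p b) = ((1 : HeckeAlgebra p) ⊗ₜ[R] MulOpposite.op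
      (⟨h p b, h_mem_parabolicSubmodule p hb⟩ : parabolic p I₀)) • resTmul p I a x := by
  rw [smul_resTmul, one_mul]

theorem resTmul_induction {motive : (resCoeff p I₀).obj I → Prop}
    (add : ∀ x y, motive x → motive y → motive (x + y))
    (tmul : ∀ a w, motive (resTmul p I a (h p w))) (z : (resCoeff p I₀).obj I) : motive z := by
  have key : ∀ x a, motive (resTmul p I a x) := by
    intro x
    induction x using h_induction with
    | add x y hx hy =>
      intro a
      rw [map_add]
      exact add _ _ (hx a) (hy a)
    | smul r w =>
      intro a
      rw [← resTmul_smul]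
      exact tmul _ w
  exact SubTensor.induction R (parabolicFamily p I) (HeckeAlgebra p)ᵐᵒᵖ
    (by have := key 0 0; rwa [map_zero] at this) (fun a x => key x a) add z

variable (I₀) in
/-- The filtration of `H ⊗_{H_I} H` by the sub-bimodules generated by the `1 ⊗ h_w` with
`l(w) < n`. -/
def lengthFiltration (n : ℕ) (I : Finset B) :
    Submodule (HeckeAlgebra p ⊗[R] (parabolic p I₀)ᵐᵒᵖ) ((resCoeff p I₀).obj I) :=
  Submodule.span _ {z | ∃ w, cs.length w < n ∧ z = resTmul p I 1 (h p w)}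

theorem resTmul_mem {n : ℕ} {w : W} (hw : cs.length w < n) (a : HeckeAlgebra p) :
    resTmul p I a (h p w) ∈ lengthFiltration p I₀ n I := by
  rw [resTmul_eq_smul]
  exact Submodule.smul_mem _ _ (Submodule.subset_span ⟨w, hw, rfl⟩)

theorem lengthFiltration_zero : lengthFiltration p I₀ 0 I = ⊥ := by
  rw [lengthFiltration, Submodule.span_eq_bot]
  rintro _ ⟨w, hw, -⟩
  exact absurd hw (Nat.not_lt_zero _)

theorem map_mem_lengthFiltration {n : ℕ} {Q : ModuleCat (HeckeAlgebra p ⊗[R] (parabolic p I₀)ᵐᵒᵖ)}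
    (f : (resCoeff p I₀).obj I →ₗ[HeckeAlgebra p ⊗[R] (parabolic p I₀)ᵐᵒᵖ] Q)
    (T : Submodule (HeckeAlgebra p ⊗[R] (parabolic p I₀)ᵐᵒᵖ) Q)
    (hf : ∀ w, cs.length w < n → f (resTmul p I 1 (h p w)) ∈ T)
    {x} (hx : x ∈ lengthFiltration p I₀ n I) : f x ∈ T := by
  have : lengthFiltration p I₀ n I ≤ T.comap f := by
    rw [lengthFiltration, Submodule.span_le]
    rintro _ ⟨w, hw, rfl⟩
    exact hf w hw
  exact this hx

theorem resTmul_mem_of_rightMin_ne {w : W} (hw : cs.rightMin I₀ w ≠ w) (a : HeckeAlgebra p) :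
    resTmul p I a (h p w) ∈ lengthFiltration p I₀ (cs.length w) I := by
  obtain ⟨b, hb, e⟩ := cs.exists_eq_rightMin_mul I₀ w
  have h1 := cs.length_rightMin_mul w hb
  have h2 := cs.length_rightMin_lt hw
  have h3 : h p w = h p (cs.rightMin I₀ w) * h p b := by rw [h_mul_h p h1, ← e]
  rw [h3, resTmul_mul_h p hb]
  exact Submodule.smul_mem _ _ (resTmul_mem p h2 a)

theorem resTmul_mem_of_descent {w : W} {s : B} (hs : s ∈ I)
    (hw : cs.length (cs.simple s * w) < cs.length w) (a : HeckeAlgebra p) :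
    resTmul p I a (h p w) ∈ lengthFiltration p I₀ (cs.length w) I := by
  have h1 : h p w = h p (cs.simple s) * h p (cs.simple s * w) := by
    have := cs.length_simple_mul w s
    rw [h_mul_h, cs.simple_mul_simple_cancel_left]
    rw [cs.simple_mul_simple_cancel_left, cs.length_simple]
    omega
  rw [h1, ← resTmul_mul p (h_mem_parabolicSubmodule p (cs.simple_mem_parabolicSubgroup hs))]
  exact resTmul_mem p hw _

theorem resTmul_mem_of_not_isMin {w : W} (hw : ¬ cs.IsMin (I : Set B) w) (a : HeckeAlgebra p) :
    resTmul p I a (h p w) ∈ lengthFiltration p I₀ (cs.length w) I := by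
  simp only [CoxeterSystem.IsMin, not_forall] at hw
  obtain ⟨s, hs, hlt⟩ := hw
  have := cs.length_simple_mul_ne w s
  exact resTmul_mem_of_descent p hs (by omega) a

/-- To check that a bimodule map lowers the filtration, it suffices to consider the generators
`1 ⊗ h_w` with `w` minimal in `W_I w` and in `w W_{I₀}`. -/
theorem map_mem_of_forall_isMin {n : ℕ}
    {Q : ModuleCat (HeckeAlgebra p ⊗[R] (parabolic p I₀)ᵐᵒᵖ)}
    (f : (resCoeff p I₀).obj I →ₗ[HeckeAlgebra p ⊗[R] (parabolic p I₀)ᵐᵒᵖ] Q)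
    (T : Submodule (HeckeAlgebra p ⊗[R] (parabolic p I₀)ᵐᵒᵖ) Q)
    (hf : ∀ x ∈ lengthFiltration p I₀ n I, f x ∈ T)
    (hmin : ∀ w, cs.length w = n → cs.rightMin I₀ w = w → cs.IsMin (I : Set B) w →
      f (resTmul p I 1 (h p w)) ∈ T)
    {x} (hx : x ∈ lengthFiltration p I₀ (n + 1) I) : f x ∈ T := by
  refine map_mem_lengthFiltration p f T (fun w hw => ?_) hx
  rcases Nat.lt_succ_iff_lt_or_eq.1 hw with hw | rfl
  · exact hf _ (resTmul_mem p hw _)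
  · by_cases h1 : cs.rightMin I₀ w = w
    · by_cases h2 : cs.IsMin (I : Set B) w
      · exact hmin w rfl h1 h2
      · exact hf _ (resTmul_mem_of_not_isMin p h2 _)
    · exact hf _ (resTmul_mem_of_rightMin_ne p h1 _)

theorem restr_mem_lengthFiltration {n : ℕ} (hIJ : I ≤ J) {x}
    (hx : x ∈ lengthFiltration p I₀ n I) :
    CoeffSystem.restr (resCoeff p I₀) hIJ x ∈ lengthFiltration p I₀ n J :=
  map_mem_lengthFiltration p _ _ (fun _ hw => resTmul_mem p hw 1) hx

theorem lengthFiltration_top [Finite W] :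
    lengthFiltration p I₀ (cs.length (cs.topMin I₀) + 1) I = ⊤ := by
  refine eq_top_iff.2 fun z _ => ?_
  induction z using resTmul_induction with
  | add x y hx hy => exact add_mem (hx trivial) (hy trivial)
  | tmul a w =>
    obtain ⟨b, hb, e⟩ := cs.exists_eq_rightMin_mul I₀ w
    rw [e, ← h_mul_h p (cs.length_rightMin_mul w hb), resTmul_mul_h p hb]
    exact Submodule.smul_mem _ _ (resTmul_mem p
      (Nat.lt_succ_of_le (cs.length_rightMin_le_topMin I₀ w)) a)

end HeckeAlgebra
end

noncomputable section

open CategoryTheory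

namespace HeckeAlgebra

variable {B W R : Type*} [Group W] {M : CoxeterMatrix B} {cs : CoxeterSystem M W} [CommRing R]
  (p : HeckeParameter cs R) (I₀ : Set B)

open Classical in
/-- The map `H → H ⊗ H`, `h_w ↦ h_a ⊗ h_u`, for `w = a u` with `a ∈ W_K` and `u` minimal in `W_K u`,
if `r` is the free ascent of `u`, and `h_w ↦ 0` otherwise. -/
def splitMap (K : Set B) (r : B) : HeckeAlgebra p →ₗ[R] HeckeAlgebra p ⊗[R] HeckeAlgebra p :=
  (basis p).constr R fun w =>
    if cs.freeAscent I₀ (cs.minPart K w) = some r then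
      h p (w * (cs.minPart K w)⁻¹) ⊗ₜ[R] h p (cs.minPart K w) else 0

open Classical in
theorem splitMap_h (K : Set B) (r : B) (w : W) : splitMap p I₀ K r (h p w) =
    if cs.freeAscent I₀ (cs.minPart K w) = some r then
      h p (w * (cs.minPart K w)⁻¹) ⊗ₜ[R] h p (cs.minPart K w) else 0 :=
  (basis p).constr_basis R _ w

open Classical in
theorem splitMap_isMin {K : Set B} (r : B) {u : W} (hu : cs.IsMin K u) :
    splitMap p I₀ K r (h p u) =
      if cs.freeAscent I₀ u = some r then (1 : HeckeAlgebra p) ⊗ₜ[R] h p u else 0 := by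
  rw [splitMap_h, hu.eq_minPart, mul_inv_cancel, h_one]

theorem splitMap_simple_mul {K : Set B} (r : B) {s : B} (hs : s ∈ K) (x : HeckeAlgebra p) :
    splitMap p I₀ K r (h p (cs.simple s) * x) =
      (LinearMap.mulLeft R (h p (cs.simple s))).rTensor _ (splitMap p I₀ K r x) := by
  classical
  induction x using h_induction with
  | add x y hx hy => rw [mul_add, map_add, hx, hy, map_add, map_add]
  | smul c w =>
    rw [mul_smul_comm, map_smul, map_smul, map_smul]
    refine congrArg (c • ·) ?_
    obtain ⟨a, ha, e⟩ := cs.exists_eq_mul_minPart K w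
    set u := cs.minPart K w with hu
    have hs' := cs.simple_mem_parabolicSubgroup hs
    have h1 := cs.length_mul_minPart w ha
    have h2 := cs.length_mul_minPart w (mul_mem hs' ha)
    rw [← hu, ← e] at h1
    rw [← hu, mul_assoc, ← e] at h2
    have h3 := cs.minPart_mul w hs'
    have ha' : a = w * u⁻¹ := by rw [e]; group
    have e2 : cs.simple s * w * u⁻¹ = cs.simple s * a := by rw [ha', mul_assoc]
    by_cases hf : cs.freeAscent I₀ u = some r
    · have e3 : splitMap p I₀ K r (h p w) = h p a ⊗ₜ[R] h p u := by
        rw [splitMap_h, ← hu, if_pos hf, ha']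
      have e4 : splitMap p I₀ K r (h p (cs.simple s * w)) = h p (cs.simple s * a) ⊗ₜ[R] h p u := by
        rw [splitMap_h, h3, ← hu, if_pos hf, e2]
      rw [h_simple_mul_h, e3, LinearMap.rTensor_tmul, LinearMap.mulLeft_apply, h_simple_mul_h]
      by_cases hl : cs.length w < cs.length (cs.simple s * w)
      · rw [if_pos hl, if_pos (by omega), e4]
      · rw [if_neg hl, if_neg (by omega), map_add, map_smul, map_smul, e3, e4,
          TensorProduct.add_tmul, TensorProduct.smul_tmul', TensorProduct.smul_tmul']
    · have e3 : splitMap p I₀ K r (h p w) = 0 := by rw [splitMap_h, ← hu, if_neg hf]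
      have e4 : splitMap p I₀ K r (h p (cs.simple s * w)) = 0 := by
        rw [splitMap_h, h3, ← hu, if_neg hf]
      rw [h_simple_mul_h, e3, map_zero]
      split_ifs <;> simp only [map_add, map_smul, e3, e4, smul_zero, add_zero]

theorem splitMap_mul {K : Set B} (r : B) {b : HeckeAlgebra p} (hb : b ∈ parabolic p K)
    (x : HeckeAlgebra p) : splitMap p I₀ K r (b * x) =
      (LinearMap.mulLeft R b).rTensor _ (splitMap p I₀ K r x) := by
  revert x
  refine parabolic_induction p (motive := fun b => ∀ x, splitMap p I₀ K r (b * x) =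
      (LinearMap.mulLeft R b).rTensor _ (splitMap p I₀ K r x))
    (fun i hi => splitMap_simple_mul p I₀ r hi) (fun c x => ?_) (fun a b ha hb x => ?_)
    (fun a b ha hb x => ?_) hb
  · rw [← Algebra.smul_def, map_smul]
    have : LinearMap.mulLeft R (algebraMap R (HeckeAlgebra p) c) = c • LinearMap.id :=
      LinearMap.ext fun y => (Algebra.smul_def c y).symm
    rw [this, LinearMap.rTensor_smul, LinearMap.rTensor_id, LinearMap.smul_apply,
      LinearMap.id_apply]
  · have : LinearMap.mulLeft R (a + b) = LinearMap.mulLeft R a + LinearMap.mulLeft R b :=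
      LinearMap.ext fun y => add_mul a b y
    rw [add_mul, map_add, ha, hb, this, LinearMap.rTensor_add, LinearMap.add_apply]
  · rw [mul_assoc, ha, hb, LinearMap.mulLeft_mul, LinearMap.rTensor_comp, LinearMap.comp_apply]

/-- The quotient map `H ⊗ H → H ⊗_{H_I} H`. -/
def resMk (I : Finset B) : HeckeAlgebra p ⊗[R] HeckeAlgebra p →+ (resCoeff p I₀).obj I :=
  TensorProduct.liftAddHom (resTmul p I) (resTmul_smul p)

theorem resMk_tmul (I : Finset B) (a x : HeckeAlgebra p) :
    resMk p I₀ I (a ⊗ₜ[R] x) = resTmul p I a x := rfl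

theorem resMk_mulLeft (I : Finset B) (a : HeckeAlgebra p) (z : HeckeAlgebra p ⊗[R] HeckeAlgebra p) :
    resMk p I₀ I ((LinearMap.mulLeft R a).rTensor _ z) =
      (a ⊗ₜ[R] MulOpposite.op (1 : parabolic p I₀)) • resMk p I₀ I z := by
  induction z using TensorProduct.induction_on with
  | zero => rw [map_zero, map_zero, smul_zero]
  | add x y hx hy => rw [map_add, map_add, hx, hy, map_add, smul_add]
  | tmul b x =>
    rw [LinearMap.rTensor_tmul, resMk_tmul, resMk_tmul, smul_resTmul, LinearMap.mulLeft_apply,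
      OneMemClass.coe_one, mul_one]

variable {I₀} in
theorem resMk_splitMap_mul_simple [DecidableEq B] (I : Finset B) (r : B) {t : B} (ht : t ∈ I₀)
    (x : HeckeAlgebra p) :
    resMk p I₀ I (splitMap p I₀ (insert r I : Finset B) r (x * h p (cs.simple t))) =
      ((1 : HeckeAlgebra p) ⊗ₜ[R] MulOpposite.op (⟨h p (cs.simple t),
        h_mem_parabolicSubmodule p (cs.simple_mem_parabolicSubgroup ht)⟩ : parabolic p I₀)) •
        resMk p I₀ I (splitMap p I₀ (insert r I : Finset B) r x) := by
  classical
  set K : Set B := ((insert r I : Finset B) : Set B) with hK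
  set τ : parabolic p I₀ := ⟨h p (cs.simple t),
        h_mem_parabolicSubmodule p (cs.simple_mem_parabolicSubgroup ht)⟩ with hτ
  have ht' := cs.simple_mem_parabolicSubgroup ht
  have hmin : ∀ u, cs.IsMin K u →
      resMk p I₀ I (splitMap p I₀ K r (h p u * h p (cs.simple t))) =
      ((1 : HeckeAlgebra p) ⊗ₜ[R] MulOpposite.op τ) • resMk p I₀ I (splitMap p I₀ K r (h p u)) := by
    intro u hu
    rcases hu.mul_simple t with hut | ⟨s, hs, e⟩
    · have e1 := splitMap_isMin p I₀ r hu
      have e2 := splitMap_isMin p I₀ r hut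
      rw [cs.freeAscent_mul u ht'] at e2
      by_cases hf : cs.freeAscent I₀ u = some r
      · rw [if_pos hf] at e1 e2
        have e3 : splitMap p I₀ K r (h p u * h p (cs.simple t)) =
            (1 : HeckeAlgebra p) ⊗ₜ[R] (h p u * h p (cs.simple t)) := by
          rw [h_mul_h_simple]
          split_ifs
          · exact e2
          · rw [map_add, map_smul, map_smul, e1, e2, TensorProduct.tmul_add,
              TensorProduct.tmul_smul, TensorProduct.tmul_smul]
        rw [e3, e1, resMk_tmul, resMk_tmul, smul_resTmul, one_mul]
      · rw [if_neg hf] at e1 e2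
        rw [e1, h_mul_h_simple]
        split_ifs <;> simp only [map_add, map_smul, e1, e2, smul_zero, add_zero, map_zero]
    · have h1 := hu s hs
      have e1 : h p u * h p (cs.simple t) = h p (cs.simple s) * h p u := by
        rw [h_mul_h_simple, ← e, if_pos h1, h_simple_mul_h, if_pos h1]
      have e2 := splitMap_isMin p I₀ r hu
      by_cases hf : cs.freeAscent I₀ u = some r
      · rw [if_pos hf] at e2
        have hne : s ≠ r := by
          rintro rfl
          refine cs.notMem_of_freeAscent hf ?_
          rw [mul_assoc, e, inv_mul_cancel_left]
          exact ht'
        have hsI : s ∈ I := (Finset.mem_insert.1 hs).resolve_left hne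
        have e3 : resMk p I₀ I (splitMap p I₀ K r (h p u * h p (cs.simple t))) =
            resTmul p I 1 (h p u * h p (cs.simple t)) := by
          rw [e1, splitMap_simple_mul p I₀ r hs, e2, LinearMap.rTensor_tmul, resMk_tmul,
            LinearMap.mulLeft_apply, mul_one, ← resTmul_mul p (h_mem_parabolicSubmodule p
              (cs.simple_mem_parabolicSubgroup (Finset.mem_coe.2 hsI))), one_mul]
        rw [e3, e2, resMk_tmul, smul_resTmul, one_mul]
      · rw [if_neg hf] at e2
        rw [e1, splitMap_simple_mul p I₀ r hs, e2, map_zero, map_zero, smul_zero]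
  induction x using h_induction with
  | add x y hx hy => rw [add_mul, map_add, map_add, hx, hy, map_add, map_add, smul_add]
  | smul c w =>
    obtain ⟨a, ha, e⟩ := cs.exists_eq_mul_minPart K w
    have h1 := cs.length_mul_minPart w ha
    have hw : c • h p w = (c • h p a) * h p (cs.minPart K w) := by
      rw [smul_mul_assoc, h_mul_h p h1, ← e]
    have hmem : c • h p a ∈ parabolic p K :=
      (parabolic p K).smul_mem (h_mem_parabolicSubmodule p ha) c
    rw [hw, mul_assoc, splitMap_mul p I₀ r hmem, splitMap_mul p I₀ r hmem, resMk_mulLeft,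
      resMk_mulLeft, hmin _ (cs.isMin_minPart K w), ← mul_smul, ← mul_smul,
      Algebra.TensorProduct.tmul_mul_tmul, Algebra.TensorProduct.tmul_mul_tmul]
    simp only [MulOpposite.op_one, mul_one, one_mul]

variable {I₀} in
theorem resMk_splitMap_mul [DecidableEq B] (I : Finset B) (r : B) (d : parabolic p I₀)
    (x : HeckeAlgebra p) :
    resMk p I₀ I (splitMap p I₀ (insert r I : Finset B) r (x * d)) =
      ((1 : HeckeAlgebra p) ⊗ₜ[R] MulOpposite.op d) •
        resMk p I₀ I (splitMap p I₀ (insert r I : Finset B) r x) := by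
  have key : ∃ hd : d.1 ∈ parabolic p I₀, ∀ x,
      resMk p I₀ I (splitMap p I₀ (insert r I : Finset B) r (x * d)) =
      ((1 : HeckeAlgebra p) ⊗ₜ[R] MulOpposite.op (⟨d, hd⟩ : parabolic p I₀)) •
        resMk p I₀ I (splitMap p I₀ (insert r I : Finset B) r x) := by
    refine parabolic_induction p (motive := fun d => ∃ hd : d ∈ parabolic p I₀, ∀ x,
      resMk p I₀ I (splitMap p I₀ (insert r I : Finset B) r (x * d)) =
      ((1 : HeckeAlgebra p) ⊗ₜ[R] MulOpposite.op (⟨d, hd⟩ : parabolic p I₀)) •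
        resMk p I₀ I (splitMap p I₀ (insert r I : Finset B) r x))
      (fun t ht => ⟨_, resMk_splitMap_mul_simple p I r ht⟩)
      (fun c => ⟨(parabolic p I₀).algebraMap_mem c, fun x => ?_⟩)
      (fun a b ⟨ha, ha'⟩ ⟨hb, hb'⟩ => ⟨add_mem ha hb, fun x => ?_⟩)
      (fun a b ⟨ha, ha'⟩ ⟨hb, hb'⟩ => ⟨mul_mem ha hb, fun x => ?_⟩) d.2
    · rw [← Algebra.commutes, ← Algebra.smul_def, map_smul]
      generalize splitMap p I₀ (insert r I : Finset B) r x = z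
      induction z using TensorProduct.induction_on with
      | zero => rw [smul_zero, map_zero, smul_zero]
      | add x y hx hy => rw [smul_add, map_add, hx, hy, map_add, smul_add]
      | tmul a y =>
        rw [← TensorProduct.tmul_smul, resMk_tmul, resMk_tmul, smul_resTmul, one_mul,
          ← Algebra.commutes, ← Algebra.smul_def]
    · rw [mul_add, map_add, map_add, ha', hb', ← add_smul, ← TensorProduct.tmul_add]
      rfl
    · rw [← mul_assoc, hb', ha', ← mul_smul, Algebra.TensorProduct.tmul_mul_tmul, one_mul]
      rfl
  obtain ⟨_, h⟩ := key
  exact h x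

/-- The additive map underlying the splitting `H ⊗_{H_J} H → H ⊗_{H_I} H`, for `J = I ∪ {r}`. -/
def splitAdd (I J : Finset B) (r : B) : (resCoeff p I₀).obj J →+ (resCoeff p I₀).obj I :=
  SubTensor.lift (parabolicFamily p J)
    (AddMonoidHom.mkBiadd (fun a x => (a ⊗ₜ[R] MulOpposite.op (1 : parabolic p I₀)) •
        resMk p I₀ I (splitMap p I₀ J r x))
      (fun a a' x => by rw [TensorProduct.add_tmul, add_smul])
      (fun a x x' => by rw [map_add, map_add, smul_add]))
    (fun c a x => by
      change ((c • a) ⊗ₜ[R] MulOpposite.op (1 : parabolic p I₀)) •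
        resMk p I₀ I (splitMap p I₀ J r x) = (a ⊗ₜ[R] MulOpposite.op (1 : parabolic p I₀)) •
        resMk p I₀ I (splitMap p I₀ J r (c • x))
      rw [← resMk_mulLeft, ← resMk_mulLeft, map_smul, map_smul, ← LinearMap.smul_apply,
        ← LinearMap.rTensor_smul]
      congr 3
      exact LinearMap.ext fun y => smul_mul_assoc c a y)
    (fun a b c x => by
      obtain ⟨b, hb⟩ := b
      change ((a * b) ⊗ₜ[R] MulOpposite.op (1 : parabolic p I₀)) •
        resMk p I₀ I (splitMap p I₀ J r (x * c.unop)) =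
        (a ⊗ₜ[R] MulOpposite.op (1 : parabolic p I₀)) •
        resMk p I₀ I (splitMap p I₀ J r (b * x * c.unop))
      rw [mul_assoc b, splitMap_mul p I₀ r hb, resMk_mulLeft, ← mul_smul,
        Algebra.TensorProduct.tmul_mul_tmul, MulOpposite.op_one, one_mul])

theorem splitAdd_resTmul (I J : Finset B) (r : B) (a x : HeckeAlgebra p) :
    splitAdd p I₀ I J r (resTmul p J a x) =
      (a ⊗ₜ[R] MulOpposite.op (1 : parabolic p I₀)) • resMk p I₀ I (splitMap p I₀ J r x) := rfl

theorem splitAdd_smul [DecidableEq B] {I J : Finset B} {r : B} (hJ : insert r I = J)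
    (a : HeckeAlgebra p) (d : (parabolic p I₀)ᵐᵒᵖ) (z : (resCoeff p I₀).obj J) :
    splitAdd p I₀ I J r ((a ⊗ₜ[R] d) • z) = (a ⊗ₜ[R] d) • splitAdd p I₀ I J r z := by
  subst hJ
  induction d using MulOpposite.rec' with | _ d
  induction z using resTmul_induction with
  | add x y hx hy =>
    exact (congrArg _ (smul_add (a ⊗ₜ[R] MulOpposite.op d) x y)).trans <|
      (map_add (splitAdd p I₀ I _ r) _ _).trans <| (congrArg₂ (· + ·) hx hy).trans <|
      (smul_add (a ⊗ₜ[R] MulOpposite.op d) _ _).symm.trans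
        (congrArg _ (map_add (splitAdd p I₀ I _ r) x y).symm)
  | tmul b w =>
    rw [smul_resTmul, splitAdd_resTmul, splitAdd_resTmul, resMk_splitMap_mul, ← mul_smul,
      ← mul_smul, Algebra.TensorProduct.tmul_mul_tmul, Algebra.TensorProduct.tmul_mul_tmul]
    simp only [MulOpposite.op_one, mul_one, one_mul]

/-- The splitting `H ⊗_{H_J} H → H ⊗_{H_I} H`, for `J = I ∪ {r}`. -/
def split [DecidableEq B] (I J : Finset B) (r : B) (hJ : insert r I = J) :
    (resCoeff p I₀).obj J →ₗ[HeckeAlgebra p ⊗[R] (parabolic p I₀)ᵐᵒᵖ] (resCoeff p I₀).obj I :=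
  AddMonoidHom.toTensorLinearMap (splitAdd p I₀ I J r) (splitAdd_smul p I₀ hJ)

variable {I J : Finset B} {r : B}

theorem split_resTmul [DecidableEq B] (hJ : insert r I = J) (x : HeckeAlgebra p) :
    split p I₀ I J r hJ (resTmul p J 1 x) = resMk p I₀ I (splitMap p I₀ J r x) :=
  one_smul (HeckeAlgebra p ⊗[R] (parabolic p I₀)ᵐᵒᵖ) _

theorem split_resTmul_isMin [DecidableEq B] (hJ : insert r I = J) {w : W} (hw : cs.IsMin (J : Set B) w) :
    split p I₀ I J r hJ (resTmul p J 1 (h p w)) =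
      if cs.freeAscent I₀ w = some r then resTmul p I 1 (h p w) else 0 := by
  rw [split_resTmul, splitMap_isMin p I₀ r hw]
  by_cases h : cs.freeAscent I₀ w = some r
  · rw [if_pos h, if_pos h]
    rfl
  · rw [if_neg h, if_neg h, map_zero]

theorem split_mem_lengthFiltration [DecidableEq B] (hJ : insert r I = J) {n : ℕ} {x}
    (hx : x ∈ lengthFiltration p I₀ n J) :
    split p I₀ I J r hJ x ∈ lengthFiltration p I₀ n I := by
  classical
  refine map_mem_lengthFiltration p _ _ (fun w hw => ?_) hx
  rw [split_resTmul, splitMap_h]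
  split_ifs
  · exact resTmul_mem p ((cs.length_minPart_le _ w).trans_lt hw) _
  · rw [map_zero]
    exact zero_mem _

end HeckeAlgebra
end

noncomputable section

open CategoryTheory

theorem CoeffSystem.diagonal_apply {A : Type*} [Ring A] {S : Type*} [LinearOrder S] [Fintype S]
    {F : Finset S ⥤ ModuleCat A}
    (θ : ∀ (I J : Finset S) (r : S), r ∉ I → insert r I = J → (F.obj J →ₗ[A] F.obj I))
    (J : Finset S) (x : F.obj J) : diagonal θ J x =
      ∑ s : J, restr F (Finset.erase_subset s.1 J)
        (θ (J.erase s.1) J s.1 (Finset.notMem_erase s.1 J) (Finset.insert_erase s.2) x) +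
      ∑ r : {r // r ∉ J}, θ J _ r.1 r.2 rfl (restr F (Finset.subset_insert r.1 J) x) := by
  rw [diagonal, LinearMap.add_apply, LinearMap.sum_apply, LinearMap.sum_apply]
  rfl

theorem CoeffSystem.diagonal_sub_mem {A : Type*} [Ring A] {S : Type*} [LinearOrder S] [Fintype S]
    {F : Finset S ⥤ ModuleCat A}
    (θ : ∀ (I J : Finset S) (r : S), r ∉ I → insert r I = J → (F.obj J →ₗ[A] F.obj I))
    {J : Finset S} {x : F.obj J} (T : Submodule A (F.obj J)) (o : Option S)
    (h1 : ∀ s (hs : s ∈ J), restr F (Finset.erase_subset s J)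
      (θ (J.erase s) J s (Finset.notMem_erase s J) (Finset.insert_erase hs) x) =
        if o = some s then x else 0)
    (h2 : ∀ r (hr : r ∉ J), θ J _ r hr rfl (restr F (Finset.subset_insert r J) x) -
      (if o = some r then x else 0) ∈ T) :
    diagonal θ J x - o.elim 0 (fun _ => x) ∈ T := by
  have e : o.elim 0 (fun _ => x) = ∑ s : J, (if o = some s.1 then x else 0) +
      ∑ r : {r // r ∉ J}, if o = some r.1 then x else 0 := by
    trans ∑ r : S, if o = some r then x else 0
    · cases o <;> simp
    · rw [← Fintype.sum_subtype_add_sum_subtype (· ∈ J)]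
      congr!
  rw [e, diagonal_apply, Finset.sum_congr rfl fun s (_ : s ∈ Finset.univ) => h1 s.1 s.2,
    add_sub_add_left_eq_sub, ← Finset.sum_sub_distrib]
  exact T.sum_mem fun r _ => h2 r.1 r.2

namespace HeckeAlgebra

variable {B W R : Type*} [LinearOrder B] [Group W] {M : CoxeterMatrix B} {cs : CoxeterSystem M W}
  [CommRing R] (p : HeckeParameter cs R) (I₀ : Set B)

theorem split_resTmul_sub_mem {J K : Finset B} {r : B} (hK : insert r J = K) {w : W}
    (hw : cs.rightMin I₀ w = w) (hmin : cs.IsMin (J : Set B) w) :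
    split p I₀ J K r hK (resTmul p K 1 (h p w)) -
      (if cs.freeAscent I₀ w = some r then resTmul p J 1 (h p w) else 0) ∈
      lengthFiltration p I₀ (cs.length w) J := by
  subst hK
  by_cases hmin' : cs.IsMin ((insert r J : Finset B) : Set B) w
  · rw [split_resTmul_isMin p I₀ rfl hmin', sub_self]
    exact zero_mem _
  · rw [if_neg, sub_zero]
    · exact split_mem_lengthFiltration p I₀ rfl (resTmul_mem_of_not_isMin p hmin' 1)
    · intro hf
      have := cs.length_lt_of_freeAscent hf
      rw [hw] at this
      refine hmin' fun s hs => ?_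
      rcases Finset.mem_insert.1 hs with rfl | hs
      · exact this
      · exact hmin s hs

variable {I₀} in
theorem commutator_split_mem {n : ℕ} {I J J' K : Finset B} {r : B} (hr : r ∉ I) (hr' : r ∉ J')
    (hJ : insert r I = J) (hK : insert r J' = K) (hI : I ≤ J') (hJK : J ≤ K) {x}
    (hx : x ∈ lengthFiltration p I₀ (n + 1) J) :
    CoeffSystem.commutator (F := resCoeff p I₀) (fun I J r _ hJ => split p I₀ I J r hJ)
      I J J' K r hr hr' hJ hK hI hJK x ∈ lengthFiltration p I₀ n J' := by
  refine map_mem_of_forall_isMin p _ _ (fun x hx => ?_) (fun w hn hw hmin => ?_) hx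
  · exact sub_mem
      (restr_mem_lengthFiltration p hI (split_mem_lengthFiltration p I₀ hJ hx))
      (split_mem_lengthFiltration p I₀ hK (restr_mem_lengthFiltration p hJK hx))
  · subst hn
    change CoeffSystem.restr (resCoeff p I₀) hI (split p I₀ I J r hJ (resTmul p J 1 (h p w))) -
      split p I₀ J' K r hK (resTmul p K 1 (h p w)) ∈ _
    have e : CoeffSystem.restr (resCoeff p I₀) hI (split p I₀ I J r hJ (resTmul p J 1 (h p w))) =
        if cs.freeAscent I₀ w = some r then resTmul p J' 1 (h p w) else 0 := by
      rw [split_resTmul_isMin p I₀ hJ hmin]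
      split_ifs
      · rfl
      · exact map_zero _
    by_cases hmin' : cs.IsMin (J' : Set B) w
    · rw [e, ← neg_sub]
      exact neg_mem (split_resTmul_sub_mem p I₀ hK hw hmin')
    · refine sub_mem ?_ (split_mem_lengthFiltration p I₀ hK (resTmul_mem_of_not_isMin p
        (fun hm => hmin' fun s hs => hm s ?_) 1))
      · rw [e]
        split_ifs
        · exact resTmul_mem_of_not_isMin p hmin' 1
        · exact zero_mem _
      · exact hK ▸ Finset.mem_insert_of_mem hs

variable [Fintype B]

theorem diagonal_split_sub_mem {J : Finset B} {w : W} (hw : cs.rightMin I₀ w = w)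
    (hmin : cs.IsMin (J : Set B) w) :
    CoeffSystem.diagonal (F := resCoeff p I₀) (fun I J r _ hJ => split p I₀ I J r hJ) J
      (resTmul p J 1 (h p w)) -
      (cs.freeAscent I₀ w).elim 0 (fun _ => resTmul p J 1 (h p w)) ∈
      lengthFiltration p I₀ (cs.length w) J := by
  refine CoeffSystem.diagonal_sub_mem (F := resCoeff p I₀) _ _ _ (fun s hs => ?_)
    fun r _ => split_resTmul_sub_mem p I₀ rfl hw hmin
  rw [split_resTmul_isMin p I₀ _ hmin]
  split_ifs
  · rfl
  · exact map_zero _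

theorem diagonal_split_mem {n : ℕ} {J : Finset B} {x} (hx : x ∈ lengthFiltration p I₀ n J) :
    CoeffSystem.diagonal (F := resCoeff p I₀) (fun I J r _ hJ => split p I₀ I J r hJ) J x ∈
      lengthFiltration p I₀ n J := by
  rw [CoeffSystem.diagonal_apply]
  refine Submodule.add_mem _ (Submodule.sum_mem _ fun s _ => ?_)
    (Submodule.sum_mem _ fun r _ => ?_)
  · exact restr_mem_lengthFiltration p _ (split_mem_lengthFiltration p I₀ _ hx)
  · exact split_mem_lengthFiltration p I₀ _ (restr_mem_lengthFiltration p _ hx)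

variable [Finite W]

theorem isContraction_split :
    CoeffSystem.IsContraction (F := resCoeff p I₀) (fun I J r _ hJ => split p I₀ I J r hJ)
      (lengthFiltration p I₀) (cs.length (cs.topMin I₀)) := by
  refine ⟨fun I => lengthFiltration_zero p, fun I => lengthFiltration_top p, ?_, ?_, ?_⟩
  · intro n _ I J J' K r hr hr' hJ hK hI hJK x hx
    exact commutator_split_mem p hr hr' hJ hK hI hJK hx
  · intro n hn J x hx
    refine map_mem_of_forall_isMin p (LinearMap.id - CoeffSystem.diagonal (F := resCoeff p I₀)
      (fun I J r _ hJ => split p I₀ I J r hJ) J) _ (fun x hx => Submodule.sub_mem _ hx (diagonal_split_mem p I₀ hx))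
      (fun w hw hr hmin => ?_) hx
    have h1 := diagonal_split_sub_mem p I₀ hr hmin
    rw [hw] at h1
    cases hf : cs.freeAscent I₀ w with
    | none =>
      have h2 := cs.rightMin_eq_topMin I₀ hf
      rw [← h2, hr] at hn
      omega
    | some s =>
      rw [hf, ← neg_mem_iff, neg_sub] at h1
      exact h1
  · intro J x
    refine map_mem_of_forall_isMin p _ _ (fun x hx => diagonal_split_mem p I₀ hx) (fun w hw hr hmin => ?_)
      (lengthFiltration_top p (I₀ := I₀) ▸ Submodule.mem_top)
    have h1 := diagonal_split_sub_mem p I₀ hr hmin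
    rw [hw] at h1
    cases hf : cs.freeAscent I₀ w with
    | none => 
      rw [hf] at h1
      exact (sub_zero (CoeffSystem.diagonal (F := resCoeff p I₀) _ J _)) ▸ h1
    | some s =>
      have h2 := cs.length_rightMin_lt_topMin I₀ hf
      rw [hr] at h2
      omega

end HeckeAlgebra
end

noncomputable section

open CategoryTheory

namespace HeckeAlgebra

variable {B W R : Type*} [Group W] [Finite W] {M : CoxeterMatrix B} {cs : CoxeterSystem M W}
  [CommRing R] (p : HeckeParameter cs R) (I₀ : Set B)

open Classical in
/-- The projection `H → H_{I₀}`, `h_d h_b ↦ h_b` for `b ∈ W_{I₀}` and `h_w ↦ 0` for `w ∉ d W_{I₀}`,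
where `d` is the longest minimal representative of the cosets `w W_{I₀}`. -/
def topProj : HeckeAlgebra p →ₗ[R] parabolic p I₀ :=
  (basis p).constr R fun w =>
    if hw : (cs.topMin I₀)⁻¹ * w ∈ parabolicSubgroup cs I₀ then
      ⟨h p ((cs.topMin I₀)⁻¹ * w), h_mem_parabolicSubmodule p hw⟩ else 0

theorem topProj_of_notMem {w : W} (hw : (cs.topMin I₀)⁻¹ * w ∉ parabolicSubgroup cs I₀) :
    topProj p I₀ (h p w) = 0 :=
  ((basis p).constr_basis R _ w).trans (dif_neg hw)

variable {I₀}

theorem topProj_topMin_mul {b : W} (hb : b ∈ parabolicSubgroup cs I₀) :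
    topProj p I₀ (h p (cs.topMin I₀ * b)) = ⟨h p b, h_mem_parabolicSubmodule p hb⟩ := by
  refine ((basis p).constr_basis R _ _).trans ((dif_pos (by rwa [inv_mul_cancel_left])).trans ?_)
  exact Subtype.ext (congrArg (h p) (inv_mul_cancel_left _ _))

theorem h_topMin_mul {b : W} (hb : b ∈ parabolicSubgroup cs I₀) :
    h p (cs.topMin I₀) * h p b = h p (cs.topMin I₀ * b) :=
  h_mul_h p (cs.length_rightMin_mul _ hb)

theorem topProj_mul_simple {t : B} (ht : t ∈ I₀) (x : HeckeAlgebra p) :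
    topProj p I₀ (x * h p (cs.simple t)) = topProj p I₀ x * ⟨h p (cs.simple t),
      h_mem_parabolicSubmodule p (cs.simple_mem_parabolicSubgroup ht)⟩ := by
  have ht' := cs.simple_mem_parabolicSubgroup ht
  induction x using h_induction with
  | add x y hx hy => rw [add_mul, map_add, map_add, hx, hy, add_mul]
  | smul c w =>
    rw [smul_mul_assoc, map_smul, map_smul, smul_mul_assoc]
    refine congrArg (c • ·) ?_
    by_cases hw : (cs.topMin I₀)⁻¹ * w ∈ parabolicSubgroup cs I₀
    · obtain ⟨b, rfl⟩ : ∃ b, w = cs.topMin I₀ * b := ⟨_, (mul_inv_cancel_left _ _).symm⟩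
      rw [inv_mul_cancel_left] at hw
      have h1 := cs.length_rightMin_mul cs.longest hw
      have h2 := cs.length_rightMin_mul cs.longest (mul_mem hw ht')
      rw [← CoxeterSystem.topMin] at h1 h2
      rw [topProj_topMin_mul p hw]
      refine Subtype.ext ?_
      change _ = h p b * h p (cs.simple t)
      rw [h_mul_h_simple, h_mul_h_simple, mul_assoc]
      by_cases hl : cs.length b < cs.length (b * cs.simple t)
      · rw [if_pos hl, if_pos (by omega), topProj_topMin_mul p (mul_mem hw ht')]
      · rw [if_neg hl, if_neg (by omega), map_add, map_smul, map_smul,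
          topProj_topMin_mul p (mul_mem hw ht'), topProj_topMin_mul p hw]
        rfl
    · have hw' : (cs.topMin I₀)⁻¹ * (w * cs.simple t) ∉ parabolicSubgroup cs I₀ := by
        rwa [← mul_assoc, Subgroup.mul_mem_cancel_right _ ht']
      have e1 := topProj_of_notMem p I₀ hw
      have e2 := topProj_of_notMem p I₀ hw'
      rw [e1, h_mul_h_simple]
      split_ifs <;> simp only [map_add, map_smul, e1, e2, smul_zero, add_zero, zero_mul]

theorem topProj_mul (x : HeckeAlgebra p) (d : parabolic p I₀) :
    topProj p I₀ (x * d) = topProj p I₀ x * d := by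
  have key : ∃ hd : d.1 ∈ parabolic p I₀, ∀ x,
      topProj p I₀ (x * d) = topProj p I₀ x * ⟨d, hd⟩ := by
    refine parabolic_induction p (motive := fun d => ∃ hd : d ∈ parabolic p I₀, ∀ x,
      topProj p I₀ (x * d) = topProj p I₀ x * ⟨d, hd⟩)
      (fun t ht => ⟨_, topProj_mul_simple p ht⟩)
      (fun c => ⟨(parabolic p I₀).algebraMap_mem c, fun x => ?_⟩)
      (fun a b ⟨ha, ha'⟩ ⟨hb, hb'⟩ => ⟨add_mem ha hb, fun x => ?_⟩)
      (fun a b ⟨ha, ha'⟩ ⟨hb, hb'⟩ => ⟨mul_mem ha hb, fun x => ?_⟩) d.2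
    · rw [← Algebra.commutes, ← Algebra.smul_def, map_smul, Algebra.smul_def, Algebra.commutes]
      rfl
    · rw [mul_add, map_add, ha', hb', ← mul_add]
      rfl
    · rw [← mul_assoc, hb', ha', mul_assoc]
      rfl
  exact key.choose_spec x

theorem topProj_h_topMin_mul (d : parabolic p I₀) :
    topProj p I₀ (h p (cs.topMin I₀) * d) = d := by
  rw [topProj_mul]
  have := topProj_topMin_mul p (one_mem (parabolicSubgroup cs I₀))
  rw [mul_one] at this
  rw [this]
  exact one_mul d

theorem h_conjTop_mul (t : I₀) : h p (cs.simple (cs.conjTop I₀ t)) * h p (cs.topMin I₀) =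
    h p (cs.topMin I₀) * h p (cs.simple t) := by
  have ht := cs.simple_mem_parabolicSubgroup t.2
  have h1 := cs.length_rightMin_mul cs.longest ht
  rw [← CoxeterSystem.topMin, cs.length_simple] at h1
  rw [h_topMin_mul p ht, h_mul_h, cs.simple_conjTop_mul]
  rw [cs.simple_conjTop_mul, h1, cs.length_simple, add_comm]

theorem topProj_conjTop_mul (t : I₀) (x : HeckeAlgebra p) :
    topProj p I₀ (h p (cs.simple (cs.conjTop I₀ t)) * x) = (⟨h p (cs.simple t),
      h_mem_parabolicSubmodule p (cs.simple_mem_parabolicSubgroup t.2)⟩ : parabolic p I₀) *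
        topProj p I₀ x := by
  have ht' := cs.simple_mem_parabolicSubgroup t.2
  induction x using h_induction with
  | add x y hx hy => rw [mul_add, map_add, map_add, hx, hy, mul_add]
  | smul c w =>
    rw [Algebra.mul_smul_comm, map_smul, map_smul, Algebra.mul_smul_comm]
    refine congrArg (c • ·) ?_
    by_cases hw : (cs.topMin I₀)⁻¹ * w ∈ parabolicSubgroup cs I₀
    · obtain ⟨b, rfl⟩ : ∃ b, w = cs.topMin I₀ * b := ⟨_, (mul_inv_cancel_left _ _).symm⟩
      rw [inv_mul_cancel_left] at hw
      rw [topProj_topMin_mul p hw, ← h_topMin_mul p hw, ← mul_assoc, h_conjTop_mul, mul_assoc]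
      have key : ∀ c d : parabolic p I₀, topProj p I₀ (h p (cs.topMin I₀) * (c.1 * d.1)) = c * d :=
        fun c d => topProj_h_topMin_mul p (c * d)
      exact key ⟨h p (cs.simple t), h_mem_parabolicSubmodule p ht'⟩
        ⟨h p b, h_mem_parabolicSubmodule p hw⟩
    · have hw' : (cs.topMin I₀)⁻¹ * (cs.simple (cs.conjTop I₀ t) * w) ∉
          parabolicSubgroup cs I₀ := by
        have e : (cs.topMin I₀)⁻¹ * cs.simple (cs.conjTop I₀ t) =
            cs.simple t * (cs.topMin I₀)⁻¹ := by
          rw [eq_mul_inv_iff_mul_eq, mul_assoc, cs.simple_conjTop_mul, inv_mul_cancel_left]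
        rwa [← mul_assoc, e, mul_assoc, Subgroup.mul_mem_cancel_left _ ht']
      have e1 := topProj_of_notMem p I₀ hw
      have e2 := topProj_of_notMem p I₀ hw'
      classical
      rw [e1, h_simple_mul_h]
      split_ifs <;> simp only [map_add, map_smul, e1, e2, smul_zero, add_zero, mul_zero]

theorem exists_mul_h_topMin {J : Finset I₀} {b : HeckeAlgebra p}
    (hb : b ∈ parabolicFamily p (J.map (cs.conjTop I₀))) :
    ∃ c ∈ parabolicFamilyOf p I₀ J, b * h p (cs.topMin I₀) = h p (cs.topMin I₀) * c ∧
      ∀ x, topProj p I₀ (b * x) = c * topProj p I₀ x := by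
  refine parabolic_induction p (motive := fun b => ∃ c ∈ parabolicFamilyOf p I₀ J,
      b * h p (cs.topMin I₀) = h p (cs.topMin I₀) * c ∧
      ∀ x, topProj p I₀ (b * x) = c * topProj p I₀ x)
      (fun s hs => ?_) (fun c => ?_) (fun a b ha hb => ?_) (fun a b ha hb => ?_) hb
  · obtain ⟨t, ht, rfl⟩ := Finset.mem_map.1 (Finset.mem_coe.1 hs)
    exact ⟨⟨h p (cs.simple t), h_mem_parabolicSubmodule p (cs.simple_mem_parabolicSubgroup t.2)⟩,
      h_mem_parabolicSubmodule p (cs.simple_mem_parabolicSubgroup ⟨t, ht, rfl⟩),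
      h_conjTop_mul p t, topProj_conjTop_mul p t⟩
  · refine ⟨algebraMap R _ c, Subalgebra.algebraMap_mem _ c, Algebra.commutes _ _, fun x => ?_⟩
    rw [← Algebra.smul_def, ← Algebra.smul_def, map_smul]
  · obtain ⟨a', ha1, ha2, ha3⟩ := ha
    obtain ⟨b', hb1, hb2, hb3⟩ := hb
    refine ⟨a' + b', add_mem ha1 hb1, ?_, fun x => ?_⟩
    · rw [add_mul, ha2, hb2, ← mul_add]
      rfl
    · rw [add_mul, map_add, ha3, hb3, add_mul]
  · obtain ⟨a', ha1, ha2, ha3⟩ := ha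
    obtain ⟨b', hb1, hb2, hb3⟩ := hb
    refine ⟨a' * b', mul_mem ha1 hb1, ?_, fun x => ?_⟩
    · rw [mul_assoc, hb2, ← mul_assoc, ha2, mul_assoc]
      rfl
    · rw [mul_assoc, ha3, hb3, mul_assoc]

theorem exists_h_topMin_mul {J : Finset I₀} {c : parabolic p I₀}
    (hc : c ∈ parabolicFamilyOf p I₀ J) :
    ∃ b ∈ parabolicFamily p (J.map (cs.conjTop I₀)),
      h p (cs.topMin I₀) * c = b * h p (cs.topMin I₀) := by
  refine parabolic_induction p (motive := fun c => ∃ b ∈ parabolicFamily p (J.map (cs.conjTop I₀)),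
      h p (cs.topMin I₀) * c = b * h p (cs.topMin I₀))
      (fun s hs => ?_) (fun c => ?_) (fun a b ha hb => ?_) (fun a b ha hb => ?_) hc
  · obtain ⟨t, ht, rfl⟩ := hs
    exact ⟨h p (cs.simple (cs.conjTop I₀ t)), h_mem_parabolicSubmodule p (cs.simple_mem_parabolicSubgroup
      (Finset.mem_coe.2 (Finset.mem_map_of_mem _ ht))), (h_conjTop_mul p t).symm⟩
  · exact ⟨algebraMap R _ c, Subalgebra.algebraMap_mem _ c, (Algebra.commutes _ _).symm⟩
  · obtain ⟨a', ha1, ha2⟩ := ha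
    obtain ⟨b', hb1, hb2⟩ := hb
    exact ⟨a' + b', add_mem ha1 hb1, by rw [mul_add, ha2, hb2, add_mul]⟩
  · obtain ⟨a', ha1, ha2⟩ := ha
    obtain ⟨b', hb1, hb2⟩ := hb
    exact ⟨a' * b', mul_mem ha1 hb1, by rw [← mul_assoc, ha2, mul_assoc, hb2, mul_assoc]⟩

end HeckeAlgebra
end

noncomputable section

open CategoryTheory

namespace HeckeAlgebra

attribute [local instance] leftModuleOfTensor rightModuleOfTensor baseModuleOfTensor
  isScalarTowerOfTensor

variable {B W R : Type*} [Group W] {M : CoxeterMatrix B} {cs : CoxeterSystem M W}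
  [CommRing R] (p : HeckeParameter cs R) {I₀ : Set B}

/-- The element `1 ⊗ x` of `H_{I₀} ⊗_{H_I} H_{I₀}`. -/
def parabolicTmul (I : Finset I₀) :
    parabolic p I₀ →+ parabolic p I₀ →+ (twoSidedCoeff (parabolicFamilyOf p I₀)).obj I :=
  AddMonoidHom.mkBiadd
    (fun y x => SubTensor.tmul R (parabolicFamilyOf p I₀ I) (parabolic p I₀)ᵐᵒᵖ y x)
    (fun y y' x => congrArg Submodule.Quotient.mk (TensorProduct.add_tmul y y' x))
    (fun y x x' => SubTensor.tmul_add R _ _ y x x')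

theorem smul_parabolicTmul (I : Finset I₀) (b d y x : parabolic p I₀) :
    (b ⊗ₜ[R] MulOpposite.op d) • parabolicTmul p I y x = parabolicTmul p I (b * y) (x * d) := rfl

theorem parabolicTmul_mul {I : Finset I₀} {c : parabolic p I₀} (hc : c ∈ parabolicFamilyOf p I₀ I)
    (y x : parabolic p I₀) : parabolicTmul p I (y * c) x = parabolicTmul p I y (c * x) :=
  SubTensor.mul_tmul R (parabolicFamilyOf p I₀ I) _ y ⟨c, hc⟩ x

/-- The element `a ⊗ (1 ⊗ x)` of `H ⊗_{H_{I₀}} (H_{I₀} ⊗_{H_I} H_{I₀})`. -/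
def indTmul (I : Finset I₀) : HeckeAlgebra p →+ parabolic p I₀ →+ (indCoeff p I₀).obj I :=
  AddMonoidHom.mkBiadd
    (fun a x => SubTensor.tmul R (parabolic p I₀) (parabolic p I₀)ᵐᵒᵖ a (parabolicTmul p I 1 x))
    (fun a a' _ => congrArg Submodule.Quotient.mk (TensorProduct.add_tmul a a' _))
    (fun a _ _ => (congrArg _ (map_add (parabolicTmul p I 1) _ _)).trans
      (SubTensor.tmul_add R _ _ a _ _))

theorem smul_indTmul (I : Finset I₀) (a b : HeckeAlgebra p) (d x : parabolic p I₀) :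
    (a ⊗ₜ[R] MulOpposite.op d) • indTmul p I b x = indTmul p I (a * b) (x * d) := by
  have e : ((1 : parabolic p I₀) ⊗ₜ[R] MulOpposite.op d) • parabolicTmul p I 1 x =
      parabolicTmul p I 1 (x * d) := by rw [smul_parabolicTmul, one_mul]
  exact congrArg (SubTensor.tmul R (parabolic p I₀) (parabolic p I₀)ᵐᵒᵖ (a * b)) e

theorem tmul_parabolicTmul (I : Finset I₀) (a : HeckeAlgebra p) (y x : parabolic p I₀) :
    SubTensor.tmul R (parabolic p I₀) (parabolic p I₀)ᵐᵒᵖ a (parabolicTmul p I y x) =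
      indTmul p I (a * y) x := by
  have e : (y ⊗ₜ[R] MulOpposite.op (1 : parabolic p I₀)) • parabolicTmul p I 1 x =
      parabolicTmul p I y x := by rw [smul_parabolicTmul, mul_one, mul_one]
  refine ((SubTensor.mul_tmul R (parabolic p I₀) (parabolic p I₀)ᵐᵒᵖ a y
    (parabolicTmul p I 1 x)).trans ?_).symm
  exact congrArg (SubTensor.tmul R (parabolic p I₀) (parabolic p I₀)ᵐᵒᵖ a) e

theorem indTmul_mul {I : Finset I₀} {c : parabolic p I₀} (hc : c ∈ parabolicFamilyOf p I₀ I)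
    (a : HeckeAlgebra p) (x : parabolic p I₀) :
    indTmul p I (a * c) x = indTmul p I a (c * x) := by
  rw [← tmul_parabolicTmul]
  refine congrArg (SubTensor.tmul R (parabolic p I₀) (parabolic p I₀)ᵐᵒᵖ a) ?_
  rw [← parabolicTmul_mul p hc, one_mul]

theorem indTmul_smul (I : Finset I₀) (r : R) (a : HeckeAlgebra p) (x : parabolic p I₀) :
    indTmul p I (r • a) x = indTmul p I a (r • x) := by
  have h1 : r • a = a * (algebraMap R (parabolic p I₀) r : parabolic p I₀) :=
    (Algebra.smul_def r a).trans (Algebra.commutes r a)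
  rw [h1, indTmul_mul p (Subalgebra.algebraMap_mem _ r), Algebra.smul_def]

theorem parabolicTmul_induction {I : Finset I₀}
    {motive : (twoSidedCoeff (parabolicFamilyOf p I₀)).obj I → Prop}
    (add : ∀ x y, motive x → motive y → motive (x + y))
    (tmul : ∀ y x, motive (parabolicTmul p I y x))
    (z : (twoSidedCoeff (parabolicFamilyOf p I₀)).obj I) : motive z :=
  SubTensor.induction R (parabolicFamilyOf p I₀ I) (parabolic p I₀)ᵐᵒᵖ
    (by have := tmul 0 0; rwa [map_zero] at this) tmul add z

theorem indTmul_induction {I : Finset I₀} {motive : (indCoeff p I₀).obj I → Prop}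
    (add : ∀ x y, motive x → motive y → motive (x + y))
    (tmul : ∀ a x, motive (indTmul p I a x)) (z : (indCoeff p I₀).obj I) : motive z := by
  refine SubTensor.induction R (parabolic p I₀) (parabolic p I₀)ᵐᵒᵖ
    (by have := tmul 0 0; rwa [map_zero] at this) (fun a n => ?_) add z
  induction n using parabolicTmul_induction with
  | add m n hm hn =>
    rw [SubTensor.tmul_add]
    exact add _ _ hm hn
  | tmul y x =>
    rw [tmul_parabolicTmul]
    exact tmul _ x

variable [Finite W]

/-- The additive map underlying the comparison `H ⊗_{H_{d I d⁻¹}} H → H ⊗_{H_I} H_{I₀}`. -/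
def compareAdd (J : Finset I₀) :
    (resCoeff p I₀).obj (J.map (cs.conjTop I₀)) →+ (indCoeff p I₀).obj J :=
  SubTensor.lift (parabolicFamily p (J.map (cs.conjTop I₀)))
    (AddMonoidHom.mkBiadd
      (fun a x => indTmul p J (a * h p (cs.topMin I₀)) (topProj p I₀ x))
      (fun a a' x => by rw [add_mul, map_add, AddMonoidHom.add_apply])
      (fun a x x' => by rw [map_add, map_add]))
    (fun r a x => by
      change indTmul p J ((r • a) * h p (cs.topMin I₀)) (topProj p I₀ x) =
        indTmul p J (a * h p (cs.topMin I₀)) (topProj p I₀ (r • x))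
      rw [smul_mul_assoc, indTmul_smul, map_smul (topProj p I₀)])
    (fun a b c x => by
      obtain ⟨b, hb⟩ := b
      change indTmul p J ((a * b) * h p (cs.topMin I₀)) (topProj p I₀ (x * c.unop)) =
        indTmul p J (a * h p (cs.topMin I₀)) (topProj p I₀ (b * x * c.unop))
      obtain ⟨c', hc, e1, e2⟩ := exists_mul_h_topMin p hb
      rw [mul_assoc a, e1, ← mul_assoc a, indTmul_mul p hc, mul_assoc b, e2])

theorem compareAdd_resTmul (J : Finset I₀) (a x : HeckeAlgebra p) :
    compareAdd p J (resTmul p (J.map (cs.conjTop I₀)) a x) =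
      indTmul p J (a * h p (cs.topMin I₀)) (topProj p I₀ x) := rfl

theorem compareAdd_smul (J : Finset I₀) (a : HeckeAlgebra p) (d : (parabolic p I₀)ᵐᵒᵖ)
    (z : (resCoeff p I₀).obj (J.map (cs.conjTop I₀))) :
    compareAdd p J ((a ⊗ₜ[R] d) • z) = (a ⊗ₜ[R] d) • compareAdd p J z := by
  induction d using MulOpposite.rec' with | _ d
  induction z using resTmul_induction with
  | add x y hx hy =>
    exact (congrArg _ (smul_add (a ⊗ₜ[R] MulOpposite.op d) x y)).trans <|
      (map_add (compareAdd p J) _ _).trans <| (congrArg₂ (· + ·) hx hy).trans <|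
      (smul_add (a ⊗ₜ[R] MulOpposite.op d) _ _).symm.trans
        (congrArg _ (map_add (compareAdd p J) x y).symm)
  | tmul b w =>
    rw [smul_resTmul, compareAdd_resTmul, compareAdd_resTmul, smul_indTmul, topProj_mul, mul_assoc]

/-- The comparison `H ⊗_{H_{d I d⁻¹}} H → H ⊗_{H_I} H_{I₀}`, `a ⊗ d x ↦ a d ⊗ x` for `x` in
`H_{I₀}`. -/
def compare (J : Finset I₀) : (resCoeff p I₀).obj (J.map (cs.conjTop I₀))
    →ₗ[HeckeAlgebra p ⊗[R] (parabolic p I₀)ᵐᵒᵖ] (indCoeff p I₀).obj J :=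
  AddMonoidHom.toTensorLinearMap (compareAdd p J) (compareAdd_smul p J)

theorem compare_resTmul (J : Finset I₀) (a x : HeckeAlgebra p) :
    compare p J (resTmul p (J.map (cs.conjTop I₀)) a x) =
      indTmul p J (a * h p (cs.topMin I₀)) (topProj p I₀ x) := rfl

theorem compare_surjective (J : Finset I₀) : Function.Surjective (compare p J) := by
  intro z
  induction z using indTmul_induction with
  | add x y hx hy =>
    obtain ⟨x, rfl⟩ := hx
    obtain ⟨y, rfl⟩ := hy
    exact ⟨x + y, map_add _ x y⟩
  | tmul a x =>
    obtain ⟨u, hu⟩ := isUnit_h p (cs.topMin I₀)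
    refine ⟨resTmul p _ (a * ↑u⁻¹) (h p (cs.topMin I₀) * x), ?_⟩
    rw [compare_resTmul, topProj_h_topMin_mul, ← hu, Units.inv_mul_cancel_right]

theorem compare_restr {J J' : Finset I₀} (hJ : J ≤ J')
    (z : (resCoeff p I₀).obj (J.map (cs.conjTop I₀))) :
    compare p J' (CoeffSystem.restr (resCoeff p I₀) (Finset.map_subset_map.2 hJ) z) =
      CoeffSystem.restr (indCoeff p I₀) hJ (compare p J z) := by
  induction z using resTmul_induction with
  | add x y hx hy =>
    rw [map_add, map_add, hx, hy, map_add, map_add]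
  | tmul a w => rfl

variable (I₀) in
/-- The inverse of `h_d`, where `d` is the longest minimal representative of the cosets
`w W_{I₀}`. -/
def topInv : HeckeAlgebra p := ((isUnit_h p (cs.topMin I₀)).unit⁻¹ : (HeckeAlgebra p)ˣ)

theorem h_topMin_mul_topInv : h p (cs.topMin I₀) * topInv p I₀ = 1 := IsUnit.mul_val_inv _

theorem topInv_mul_h_topMin : topInv p I₀ * h p (cs.topMin I₀) = 1 := IsUnit.val_inv_mul _

theorem resTmul_mul_topInv {J : Finset I₀} {c : parabolic p I₀}
    (hc : c ∈ parabolicFamilyOf p I₀ J) (a x : HeckeAlgebra p) :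
    resTmul (I₀ := I₀) p (J.map (cs.conjTop I₀)) (a * c * topInv p I₀) (h p (cs.topMin I₀) * x) =
      resTmul p (J.map (cs.conjTop I₀)) (a * topInv p I₀) (h p (cs.topMin I₀) * (c * x)) := by
  obtain ⟨b, hb, e⟩ := exists_h_topMin_mul p hc
  have e' : (c : HeckeAlgebra p) * topInv p I₀ = topInv p I₀ * b := by
    calc (c : HeckeAlgebra p) * topInv p I₀
        = topInv p I₀ * (h p (cs.topMin I₀) * c) * topInv p I₀ := by
          rw [← mul_assoc, topInv_mul_h_topMin, one_mul]
      _ = topInv p I₀ * b := by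
          rw [e, mul_assoc, mul_assoc, h_topMin_mul_topInv, mul_one]
  rw [mul_assoc, e', ← mul_assoc, resTmul_mul p hb, ← mul_assoc, ← mul_assoc, e]

/-- The map `y ⊗ x ↦ y d⁻¹ ⊗ d x` from `H_{I₀} ⊗_{H_I} H_{I₀}` to `H ⊗_{H_{d I d⁻¹}} H`. -/
def compareInvParabolic (J : Finset I₀) : (twoSidedCoeff (parabolicFamilyOf p I₀)).obj J →+
    (resCoeff p I₀).obj (J.map (cs.conjTop I₀)) :=
  SubTensor.lift (parabolicFamilyOf p I₀ J)
    (AddMonoidHom.mkBiadd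
      (fun y x => resTmul p (J.map (cs.conjTop I₀))
        (y * topInv p I₀)
        (h p (cs.topMin I₀) * x))
      (fun y y' x => by
        rw [AddMemClass.coe_add, add_mul, map_add, AddMonoidHom.add_apply])
      (fun y x x' => by rw [AddMemClass.coe_add, mul_add, map_add]))
    (fun r y x => by
      change resTmul p (J.map (cs.conjTop I₀))
        ((r • (y : HeckeAlgebra p)) * topInv p I₀)
        (h p (cs.topMin I₀) * x) = resTmul p (J.map (cs.conjTop I₀))
        (y * topInv p I₀)
        (h p (cs.topMin I₀) * (r • (x : HeckeAlgebra p)))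
      rw [smul_mul_assoc, resTmul_smul, mul_smul_comm])
    (fun y c d x => by
      refine (resTmul_mul_topInv p c.2 y (x * d.unop)).trans ?_
      exact congrArg (fun z => resTmul p _ _ (h p (cs.topMin I₀) * z))
        (mul_assoc (c : HeckeAlgebra p) x d.unop).symm)

theorem compareInvParabolic_tmul (J : Finset I₀) (y x : parabolic p I₀) :
    compareInvParabolic p J (parabolicTmul p J y x) = resTmul p (J.map (cs.conjTop I₀))
      (y * topInv p I₀)
      (h p (cs.topMin I₀) * x) := rfl

theorem compareInvParabolic_smul (J : Finset I₀) (b : parabolic p I₀) (d : (parabolic p I₀)ᵐᵒᵖ)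
    (z : (twoSidedCoeff (parabolicFamilyOf p I₀)).obj J) :
    compareInvParabolic p J ((b ⊗ₜ[R] d) • z) =
      ((b : HeckeAlgebra p) ⊗ₜ[R] d) • compareInvParabolic p J z := by
  induction d using MulOpposite.rec' with | _ d
  induction z using parabolicTmul_induction with
  | add x y hx hy => rw [smul_add, map_add, hx, hy, map_add, smul_add]
  | tmul y x =>
    rw [smul_parabolicTmul, compareInvParabolic_tmul, compareInvParabolic_tmul, smul_resTmul,
      ← mul_assoc, mul_assoc (h p (cs.topMin I₀))]
    rfl

/-- The map `a ⊗ x ↦ a d⁻¹ ⊗ d x`, a right inverse of `compare`. -/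
def compareInv (J : Finset I₀) :
    (indCoeff p I₀).obj J →+ (resCoeff p I₀).obj (J.map (cs.conjTop I₀)) :=
  SubTensor.lift (N := (twoSidedCoeff (parabolicFamilyOf p I₀)).obj J) (parabolic p I₀)
    (AddMonoidHom.mkBiadd
      (fun a n => (a ⊗ₜ[R] MulOpposite.op (1 : parabolic p I₀)) • compareInvParabolic p J n)
      (fun a a' n => by rw [TensorProduct.add_tmul, add_smul])
      (fun a n n' => by rw [map_add, smul_add]))
    (fun r a n => by
      change ((r • a) ⊗ₜ[R] MulOpposite.op (1 : parabolic p I₀)) • compareInvParabolic p J n =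
        (a ⊗ₜ[R] MulOpposite.op (1 : parabolic p I₀)) • compareInvParabolic p J
          ((algebraMap R (parabolic p I₀) r ⊗ₜ[R] (1 : (parabolic p I₀)ᵐᵒᵖ)) • n)
      rw [compareInvParabolic_smul, ← mul_smul, Algebra.TensorProduct.tmul_mul_tmul, mul_one,
        Algebra.smul_def, Algebra.commutes]
      rfl)
    (fun a b d n => by
      change ((a * b) ⊗ₜ[R] MulOpposite.op (1 : parabolic p I₀)) • compareInvParabolic p J
          (((1 : parabolic p I₀) ⊗ₜ[R] d) • n) =
        (a ⊗ₜ[R] MulOpposite.op (1 : parabolic p I₀)) • compareInvParabolic p J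
          (((1 : parabolic p I₀) ⊗ₜ[R] d) • (b ⊗ₜ[R] (1 : (parabolic p I₀)ᵐᵒᵖ)) • n)
      rw [← mul_smul ((1 : parabolic p I₀) ⊗ₜ[R] d), compareInvParabolic_smul,
        Algebra.TensorProduct.tmul_mul_tmul, compareInvParabolic_smul, ← mul_smul, ← mul_smul,
        Algebra.TensorProduct.tmul_mul_tmul, Algebra.TensorProduct.tmul_mul_tmul, one_mul, mul_one,
        OneMemClass.coe_one, mul_one])

theorem compareInv_indTmul (J : Finset I₀) (a : HeckeAlgebra p) (x : parabolic p I₀) :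
    compareInv p J (indTmul p J (a * h p (cs.topMin I₀)) x) =
      resTmul p _ a (h p (cs.topMin I₀) * x) := by
  refine Eq.trans (b := ((a * h p (cs.topMin I₀)) ⊗ₜ[R] MulOpposite.op (1 : parabolic p I₀)) •
    compareInvParabolic p J (parabolicTmul p J 1 x)) rfl ?_
  rw [compareInvParabolic_tmul, smul_resTmul, OneMemClass.coe_one, one_mul, mul_one,
    mul_assoc a, h_topMin_mul_topInv, mul_one]

theorem resTmul_mem_of_inv_mul_notMem {I : Finset B} {w : W}
    (hw : (cs.topMin I₀)⁻¹ * w ∉ parabolicSubgroup cs I₀) (a : HeckeAlgebra p) :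
    resTmul p I a (h p w) ∈ lengthFiltration p I₀ (cs.length (cs.topMin I₀)) I := by
  obtain ⟨b, hb, e⟩ := cs.exists_eq_rightMin_mul I₀ w
  have hlt : cs.length (cs.rightMin I₀ w) < cs.length (cs.topMin I₀) := by
    cases hf : cs.freeAscent I₀ w with
    | none =>
      rw [cs.rightMin_eq_topMin I₀ hf] at e
      rw [e, inv_mul_cancel_left] at hw
      exact absurd hb hw
    | some s => exact cs.length_rightMin_lt_topMin I₀ hf
  rw [e, ← h_mul_h p (cs.length_rightMin_mul w hb), resTmul_mul_h p hb]
  exact Submodule.smul_mem _ _ (resTmul_mem p hlt a)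

theorem compareInv_compare_sub_mem (J : Finset I₀)
    (z : (resCoeff p I₀).obj (J.map (cs.conjTop I₀))) :
    compareInv p J (compare p J z) - z ∈
      lengthFiltration p I₀ (cs.length (cs.topMin I₀)) (J.map (cs.conjTop I₀)) := by
  induction z using resTmul_induction with
  | add x y hx hy =>
    rw [map_add, map_add, add_sub_add_comm]
    exact Submodule.add_mem _ hx hy
  | tmul a w =>
    rw [compare_resTmul]
    by_cases hw : (cs.topMin I₀)⁻¹ * w ∈ parabolicSubgroup cs I₀
    · obtain ⟨b, rfl⟩ : ∃ b, w = cs.topMin I₀ * b := ⟨_, (mul_inv_cancel_left _ _).symm⟩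
      rw [inv_mul_cancel_left] at hw
      rw [compareInv_indTmul, topProj_topMin_mul p hw, h_topMin_mul p hw, sub_self]
      exact Submodule.zero_mem _
    · rw [topProj_of_notMem p I₀ hw, map_zero, map_zero, zero_sub]
      exact Submodule.neg_mem _ (resTmul_mem_of_inv_mul_notMem p hw a)

theorem compare_eq_zero_iff (J : Finset I₀) (z : (resCoeff p I₀).obj (J.map (cs.conjTop I₀))) :
    compare p J z = 0 ↔
      z ∈ lengthFiltration p I₀ (cs.length (cs.topMin I₀)) (J.map (cs.conjTop I₀)) := by
  constructor
  · intro hz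
    have := compareInv_compare_sub_mem p J z
    rw [hz, map_zero, zero_sub] at this
    exact neg_mem_iff.1 this
  · intro hz
    refine (Submodule.mem_bot _).1 (map_mem_lengthFiltration p (compare p J) ⊥ (fun w hw => ?_) hz)
    rw [Submodule.mem_bot, compare_resTmul, topProj_of_notMem, map_zero]
    intro hm
    have := cs.length_rightMin_mul cs.longest hm
    rw [← CoxeterSystem.topMin, mul_inv_cancel_left] at this
    omega

theorem lengthFiltration_topMin_eq_top [Finite B] {I : Finset B}
    (hI : ∀ J : Finset I₀, J.map (cs.conjTop I₀) ≠ I) :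
    lengthFiltration p I₀ (cs.length (cs.topMin I₀)) I = ⊤ := by
  classical
  have hs : ∃ s ∈ I, s ∉ Set.range (cs.conjTop I₀) := by
    by_contra! hI'
    refine hI (I.preimage (cs.conjTop I₀) (cs.conjTop I₀).injective.injOn) ?_
    rw [Finset.map_eq_image, Finset.image_preimage]
    exact Finset.filter_true_of_mem hI'
  obtain ⟨s, hs, hs'⟩ := hs
  refine eq_top_iff.2 fun z _ => ?_
  refine map_mem_of_forall_isMin p LinearMap.id _ (fun x hx => hx) (fun w hw hr hmin => ?_)
    (lengthFiltration_top p (I₀ := I₀) ▸ Submodule.mem_top)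
  cases hf : cs.freeAscent I₀ w with
  | none =>
    have h1 := cs.rightMin_eq_topMin I₀ hf
    rw [hr] at h1
    rw [h1] at hmin
    exact absurd (cs.mem_range_conjTop I₀ (hmin s hs)) hs'
  | some r =>
    have h2 := cs.length_rightMin_lt_topMin I₀ hf
    rw [hr] at h2
    omega

theorem nonempty_iso_complex [LinearOrder B] [Fintype B] (p : HeckeParameter cs R) (I₀ : Set B) :
    Nonempty ((HomotopyCategory.quotient _ (ComplexShape.up ℤ)).obj
        (CoeffSystem.complex (resCoeff p I₀)) ≅
      (HomotopyCategory.quotient _ (ComplexShape.up ℤ)).obj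
        (CoeffSystem.complex (indCoeff p I₀))) :=
  (isContraction_split p I₀).nonempty_iso (cs.conjTop I₀) (compare p)
    (fun _ _ hJ z => compare_restr p hJ z) (compare_surjective p) (compare_eq_zero_iff p)
    (fun _ hI => lengthFiltration_topMin_eq_top p hI)

theorem nonempty_resX_iso_indX [LinearOrder B] [Finite B] (p : HeckeParameter cs R) (I₀ : Set B) :
    Nonempty ((HomotopyCategory.quotient _ (ComplexShape.up ℤ)).obj (resX p I₀) ≅
      (HomotopyCategory.quotient _ (ComplexShape.up ℤ)).obj (indX p I₀)) := by
  have := Fintype.ofFinite B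
  have := Fintype.ofFinite I₀
  obtain ⟨e⟩ := nonempty_iso_complex p I₀
  exact ⟨(HomotopyCategory.quotient _ _).mapIso (CoeffSystem.restrictIso _ _) ≪≫ e ≪≫
    ((HomotopyCategory.quotient _ _).mapIso (CoeffSystem.indIso _ _ _)).symm⟩

end HeckeAlgebra
end

theorem theorem17 {B W R : Type*} [LinearOrder B] [Finite B] [Group W] [Finite W]
    {M : CoxeterMatrix B} (cs : CoxeterSystem M W) [CommRing R] (p : HeckeParameter cs R)
    (I₀ : Set B) :
    Nonempty (Kb.of (HeckeAlgebra.resX p I₀) (HeckeAlgebra.isBoundedFG_resX p I₀) ≅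
      Kb.of (HeckeAlgebra.indX p I₀) (HeckeAlgebra.isBoundedFG_indX p I₀)) := by
  obtain ⟨e⟩ := HeckeAlgebra.nonempty_resX_iso_indX p I₀
  exact ⟨(CategoryTheory.ObjectProperty.fullyFaithfulι _).preimageIso e⟩
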